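/- Let $\Omega\subset\mathbb{R}^3$ be a bounded domain (nonempty, open, connected) with $C^4$ boundary and outer unit normal $\nu$. For $\alpha>0$ let $S_\alpha$ be the open $\alpha$-tube about $\partial\Omega$, and let $\kappa>0$ be the largest number such that $\Lambda:\partial\Omega\times(-\kappa,\kappa)\to S_\kappa$, $(q,s)\mapsto q+s\,\nu(q)$, is a $C^3$-diffeomorphism; write $\Lambda^{-1}(x)=(q(x),s(x))$. Fix a norm of $H^2(\partial\Omega)$ given by a finite $C^4$ atlas of $\partial\Omega$ and a subordinate $C^4$ partition of unity. For continuous $\eta:\partial\Omega\to(-\kappa,\kappa)$ put $$\Omega_\eta:=(\Omega\setminus S_\kappa)\cup\{x\in S_\kappa : s(x)<\eta(q(x))\},$$ and $\tau(\eta):=(1-\|\eta\|_{L^\infty(\partial\Omega)}/\kappa)^{-1}$ if $\|\eta\|_{L^\infty(\partial\Omega)}<\kappa$, $\tau(\eta):=\infty$ otherwise. For $T\ge1$ call $\beta\in C^\infty(\mathbb{R})$ admissible for $T$ if $\beta=0$ in a neighbourhood of $-1$, $\beta=1$ in a neighbourhood of $0$, and $|\beta'(s)|\,(1-1/T)<1$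 for all $s\in[-1,0]$; equivalently, $|\beta'(s)|<\kappa/|\eta(q)|$ for all $s\in[-1,0]$, all $q\in\partial\Omega$ and all continuous $\eta$ with $\tau(\eta)\le T$. The Hanzawa transform $\Psi_\eta$ built with $\beta$ is the identity on $\Omega\setminus S_\kappa$, and $$\Psi_\eta(x)=x+\eta(q(x))\,\beta(s(x)/\kappa)\,\nu(q(x))\qquad\text{for }x\in\Omega\cap S_\kappa .$$ For every $T\ge1$ an admissible $\beta$ exists. Moreover, let $1<p\le\infty$, $1\le r<p$, $M\ge0$, $T\ge1$, and let $\beta$ be admissible for $T$. Then there is a constant $C$, depending only on $\Omega$ (with the chosen $H^2(\partial\Omega)$-norm), $p$, $r$, $M$, $T$ and $\beta$, such that for every $\eta\in H^2(\partial\Omega)$ (identified with its continuous representative) with $\|\eta\|_{L^\infty(\partial\Omega)}<\kappa$, $\|\eta\|_{H^2(\partial\Omega)}\le M$ and $\tau(\eta)\le T$, the map $\Psi_\eta:\Omega\to\Omega_\eta$ is bijective, and 1. $v\mapsto v\circ\Psi_\eta$ is a well-defined bounded linear map from $L^p(\Omega_\eta)$ to $L^r(\Omega)$ and from $W^{1,p}(\Omega_\eta)$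 to $W^{1,r}(\Omega)$, with norms at most $C$; 2. $v\mapsto v\circ\Psi_\eta^{-1}$ is a well-defined bounded linear map from $L^p(\Omega)$ to $L^r(\Omega_\eta)$ and from $W^{1,p}(\Omega)$ to $W^{1,r}(\Omega_\eta)$, with norms at most $C$. In particular, once $\beta$ is chosen depending on the bound $T$ for $\tau(\eta)$, the continuity constants depend only on $\Omega$, $p$, $r$, $\|\eta\|_{H^2(\partial\Omega)}$ and $\tau(\eta)$, and stay bounded while $\|\eta\|_{H^2(\partial\Omega)}$ and $\tau(\eta)$ stay bounded. -/

import Mathlib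

open Set MeasureTheory Topology
open scoped NNReal ENNReal ContDiff

noncomputable section

/-- The Euclidean space `ℝ^d`. -/
abbrev Euc (d : ℕ) : Type := EuclideanSpace ℝ (Fin d)

/-! ### Sobolev spaces on open subsets of `ℝ^d` -/

/-- `g` is the distributional derivative `∂_{α 0} ⋯ ∂_{α (k-1)} v` on the open set `U`
(both functions being locally integrable on `U`). -/
def IsWeakDeriv {d : ℕ} (U : Set (Euc d)) {k : ℕ} (α : Fin k → Fin d) (v g : Euc d → ℝ) : Prop :=
  LocallyIntegrableOn v U volume ∧ LocallyIntegrableOn g U volume ∧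
    ∀ φ : Euc d → ℝ, ContDiff ℝ ∞ φ → HasCompactSupport φ → tsupport φ ⊆ U →
      ∫ x in U, v x * iteratedFDeriv ℝ k φ x (fun j => EuclideanSpace.single (α j) 1) =
        (-1) ^ k * ∫ x in U, g x * φ x

/-- `g j α`, for `j ≤ k`, are all the distributional derivatives of `v` on `U` of order at
most `k`. -/
def IsWeakJet {d : ℕ} (U : Set (Euc d)) (k : ℕ) (v : Euc d → ℝ)
    (g : (j : ℕ) → (Fin j → Fin d) → Euc d → ℝ) : Prop :=
  ∀ j ≤ k, ∀ α : Fin j → Fin d, IsWeakDeriv U α v (g j α)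

/-- Membership in `W^{k,p}(U)`: `v` and its distributional derivatives up to order `k` lie
in `L^p(U)`. -/
def MemSobolev {d : ℕ} (U : Set (Euc d)) (k : ℕ) (p : ℝ≥0∞) (v : Euc d → ℝ) : Prop :=
  MemLp v p (volume.restrict U) ∧
    ∃ g : (j : ℕ) → (Fin j → Fin d) → Euc d → ℝ, IsWeakJet U k v g ∧
      ∀ j ≤ k, ∀ α : Fin j → Fin d, MemLp (g j α) p (volume.restrict U)

/-- The norm of `W^{k,p}(U)`: the sum of the `L^p(U)`-norms of the distributional derivatives
up to order `k`. These are unique almost everywhere, so that the infimum is over equal numbers;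
it is over the empty family, hence `⊤`, if some derivative is not a locally integrable function. -/
def sobolevNorm {d : ℕ} (U : Set (Euc d)) (k : ℕ) (p : ℝ≥0∞) (v : Euc d → ℝ) : ℝ≥0∞ :=
  ⨅ g : (j : ℕ) → (Fin j → Fin d) → Euc d → ℝ, ⨅ _ : IsWeakJet U k v g,
    ∑ j ∈ Finset.range (k + 1), ∑ α : Fin j → Fin d, eLpNorm (g j α) p (volume.restrict U)

/-- `v ↦ v ∘ Φ` is bounded from `L^p(U)` to `L^r(V)` with constant `C`. The map being linear,
the norm bound for all representatives contains that it is well defined on classes modulo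
null sets. -/
def CompBoundedLp {d : ℕ} (U V : Set (Euc d)) (Φ : Euc d → Euc d) (p r : ℝ≥0∞) (C : ℝ≥0) :
    Prop :=
  ∀ v : Euc d → ℝ, MemLp v p (volume.restrict U) →
    MemLp (v ∘ Φ) r (volume.restrict V) ∧
      eLpNorm (v ∘ Φ) r (volume.restrict V) ≤ C * eLpNorm v p (volume.restrict U)

/-- `v ↦ v ∘ Φ` is bounded from `W^{1,p}(U)` to `W^{1,r}(V)` with constant `C`. -/
def CompBoundedSobolev {d : ℕ} (U V : Set (Euc d)) (Φ : Euc d → Euc d) (p r : ℝ≥0∞) (C : ℝ≥0) :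
    Prop :=
  ∀ v : Euc d → ℝ, MemSobolev U 1 p v →
    MemSobolev V 1 r (v ∘ Φ) ∧ sobolevNorm V 1 r (v ∘ Φ) ≤ C * sobolevNorm U 1 p v

/-! ### Domains with `C⁴` boundary -/

/-- `φ` is a `C⁴` defining function of `Ω` in the open set `U`. -/
def IsDefiningFunction (Ω U : Set (Euc 3)) (φ : Euc 3 → ℝ) : Prop :=
  IsOpen U ∧ ContDiffOn ℝ 4 φ U ∧ (∀ x ∈ U, gradient φ x ≠ 0) ∧ Ω ∩ U = {x ∈ U | φ x < 0}

/-- A bounded domain (nonempty, open, connected) of `ℝ³` with `C⁴` boundary. -/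
structure IsC4Domain (Ω : Set (Euc 3)) : Prop where
  isOpen : IsOpen Ω
  isConnected : IsConnected Ω
  isBounded : Bornology.IsBounded Ω
  boundary : ∀ q ∈ frontier Ω, ∃ U φ, q ∈ U ∧ IsDefiningFunction Ω U φ

/-- `n` is the outer unit normal of `Ω` at `q`: the normalized gradient of a defining function. -/
def IsOuterNormal (Ω : Set (Euc 3)) (q n : Euc 3) : Prop :=
  ∃ U φ, q ∈ U ∧ IsDefiningFunction Ω U φ ∧ n = ‖gradient φ q‖⁻¹ • gradient φ q

/-- The outer unit normal field `ν` (used at the points of `frontier Ω` only, where it is uniquely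
determined). -/
def outerNormal (Ω : Set (Euc 3)) (q : Euc 3) : Euc 3 :=
  Classical.epsilon (IsOuterNormal Ω q)

/-! ### The space `H²` on a closed surface -/

/-- A `C⁴` chart of the surface `Γ`, given by its inverse `par`, a `C⁴` immersion of the open set
`dom ⊆ ℝ²` that is a homeomorphism onto an open part of `Γ`. -/
structure SurfaceChart (Γ : Set (Euc 3)) where
  dom : Set (Euc 2)
  par : Euc 2 → Euc 3
  isOpen_dom : IsOpen dom
  contDiffOn : ContDiffOn ℝ 4 par dom
  immersion : ∀ x ∈ dom, Function.Injective (fderiv ℝ par x)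
  injOn : InjOn par dom
  isOpenMap : ∀ W ⊆ dom, IsOpen W → ∃ O : Set (Euc 3), IsOpen O ∧ par '' W = Γ ∩ O

/-- A finite `C⁴` atlas of the surface `Γ` with a subordinate `C⁴` partition of unity. -/
structure SurfaceAtlas (Γ : Set (Euc 3)) where
  card : ℕ
  chart : Fin card → SurfaceChart Γ
  weight : Fin card → Euc 3 → ℝ
  weight_nonneg : ∀ k, ∀ q ∈ Γ, 0 ≤ weight k q
  weight_contDiffOn : ∀ k, ContDiffOn ℝ 4 (weight k ∘ (chart k).par) (chart k).dom
  weight_support : ∀ k, closure {q ∈ Γ | weight k q ≠ 0} ⊆ (chart k).par '' (chart k).dom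
  weight_sum : ∀ q ∈ Γ, ∑ k, weight k q = 1

/-- The norm of `H²(Γ) = W^{2,2}(Γ)` in the given atlas; it is `⊤` for functions outside
`H²(Γ)`. -/
def h2Norm {Γ : Set (Euc 3)} (A : SurfaceAtlas Γ) (η : Euc 3 → ℝ) : ℝ≥0∞ :=
  ∑ k, sobolevNorm (A.chart k).dom 2 2
    (fun x => η ((A.chart k).par x) * A.weight k ((A.chart k).par x))

/-- The supremum norm over `Γ`, which is the `L^∞(Γ)`-norm for continuous functions. -/
def supNormOn (Γ : Set (Euc 3)) (η : Euc 3 → ℝ) : ℝ :=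
  ⨆ q : Γ, |η q|

/-! ### Tubular neighbourhoods -/

/-- The map `Λ (q, s) = q + s ν(q)`. -/
def tubeMap (Ω : Set (Euc 3)) (z : Euc 3 × ℝ) : Euc 3 :=
  z.1 + z.2 • outerNormal Ω z.1

/-- The open tube `S_α` of radius `α` about `∂Ω`. -/
def tube (Ω : Set (Euc 3)) (α : ℝ) : Set (Euc 3) :=
  Metric.thickening α (frontier Ω)

/-- `Λ` is a `C³` diffeomorphism of `∂Ω × (-α, α)` onto the tube `S_α`. -/
def IsTubularRadius (Ω : Set (Euc 3)) (α : ℝ) : Prop :=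
  BijOn (tubeMap Ω) (frontier Ω ×ˢ Ioo (-α) α) (tube Ω α) ∧
    (∀ c : SurfaceChart (frontier Ω),
      ContDiffOn ℝ 3 (fun z : Euc 2 × ℝ => tubeMap Ω (c.par z.1, z.2)) (c.dom ×ˢ Ioo (-α) α)) ∧
    ∃ g : Euc 3 → Euc 3 × ℝ, ContDiffOn ℝ 3 g (tube Ω α) ∧
      LeftInvOn g (tubeMap Ω) (frontier Ω ×ˢ Ioo (-α) α)

/-- The number `κ`, the largest radius for which `Λ` is a `C³` diffeomorphism onto the tube. -/
def tubeRadius (Ω : Set (Euc 3)) : ℝ :=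
  sSup {α : ℝ | 0 < α ∧ IsTubularRadius Ω α}

/-- The inverse `x ↦ (q(x), s(x))` of `Λ` on the tube `S_κ`. -/
def tubeInv (Ω : Set (Euc 3)) : Euc 3 → Euc 3 × ℝ :=
  Function.invFunOn (tubeMap Ω) (frontier Ω ×ˢ Ioo (-tubeRadius Ω) (tubeRadius Ω))

/-- The foot point `q(x) ∈ ∂Ω` of a point `x` of `S_κ`. -/
def foot (Ω : Set (Euc 3)) (x : Euc 3) : Euc 3 := (tubeInv Ω x).1

/-- The signed distance `s(x)` of a point `x` of `S_κ` to `∂Ω`, negative inside `Ω`. -/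
def tubeHeight (Ω : Set (Euc 3)) (x : Euc 3) : ℝ := (tubeInv Ω x).2

/-! ### Displaced domains and the Hanzawa transform -/

/-- The domain `Ω_η = (Ω ∖ S_κ) ∪ {x ∈ S_κ | s(x) < η(q(x))}`. -/
def displacedDomain (Ω : Set (Euc 3)) (η : Euc 3 → ℝ) : Set (Euc 3) :=
  (Ω \ tube Ω (tubeRadius Ω)) ∪ {x ∈ tube Ω (tubeRadius Ω) | tubeHeight Ω x < η (foot Ω x)}

open Classical in
/-- The quantity `τ(η)`: `(1 - ‖η‖_∞ / κ)⁻¹` if `‖η‖_∞ < κ`, and `∞` otherwise. -/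
def tau (Ω : Set (Euc 3)) (η : Euc 3 → ℝ) : ℝ≥0∞ :=
  if supNormOn (frontier Ω) η < tubeRadius Ω then
    ENNReal.ofReal (1 - supNormOn (frontier Ω) η / tubeRadius Ω)⁻¹
  else ⊤

/-- `β` is a cut-off function admissible for the displacements with `τ(η) ≤ T`. As `τ(η) ≤ T` means
`‖η‖_∞ ≤ (1 - 1 / T) κ`, the last condition says that `|β'(s)| < κ / |η(q)|` on `[-1, 0]` for all
these `η` and all `q ∈ ∂Ω`. -/
structure IsCutoff (T : ℝ≥0) (β : ℝ → ℝ) : Prop where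
  contDiff : ContDiff ℝ ∞ β
  eq_zero : ∀ᶠ s in 𝓝 (-1 : ℝ), β s = 0
  eq_one : ∀ᶠ s in 𝓝 (0 : ℝ), β s = 1
  deriv_lt : ∀ s ∈ Icc (-1 : ℝ) 0, |deriv β s| * (1 - (T : ℝ)⁻¹) < 1

open Classical in
/-- The Hanzawa transform `Ψ_η` built with the cut-off function `β` (used on `Ω` only). -/
def hanzawa (Ω : Set (Euc 3)) (β : ℝ → ℝ) (η : Euc 3 → ℝ) (x : Euc 3) : Euc 3 :=
  if x ∈ tube Ω (tubeRadius Ω) then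
    x + (η (foot Ω x) * β (tubeHeight Ω x / tubeRadius Ω)) • outerNormal Ω (foot Ω x)
  else x

/-- The inverse `Ψ_η⁻¹ : Ω_η → Ω` of the Hanzawa transform. -/
def hanzawaInv (Ω : Set (Euc 3)) (β : ℝ → ℝ) (η : Euc 3 → ℝ) : Euc 3 → Euc 3 :=
  Function.invFunOn (hanzawa Ω β η) Ω

end

/-! In tubular coordinates (q, s) the Hanzawa transform keeps the foot point q and moves the height
by s ↦ s + η(q) γ(s), where γ is the rescaled cut-off, continued by 0 to the left and by 1 to the
right. Admissibility is a strict inequality on the compact interval [-1, 0]. It therefore leaves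
room: there are a > (1 - 1/T) κ and K ≥ sup |γ'| with a K < 1. For |η| < a the shift is, on each
normal line, a strictly increasing bijection that expands distances by at most 2 and contracts them
by at most 1 - a K. It fixes the heights below -α for some α < κ and sends 0 to η(q). This gives
bijectivity (`bijOn_hanzawa`). The inverse is again a displacement along the normals, by a C¹
function of (η(q), s). Both maps are thus instances of `IsTubeMap` with an `IsDisplacement`, and the
estimates are proved once for this class.

Lebesgue spaces. No derivative of η is needed. After straightening the collar |s| ≤ α by charts,
which distorts volume by bounded factors, the map acts on each fibre {q} × ℝ only, and there
preimages of sets grow at most by the antilipschitz constant. By Fubini the image of Lebesgue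
measure is at most a constant times Lebesgue measure (`exists_map_volume_le`). This bounds v ↦ v ∘ Φ
on L^p and shows that it respects null sets.

Sobolev spaces. The chain rule gives D(v ∘ Φ) = (Dv ∘ Φ) DΦ, where DΦ is bounded up to a term linear
in the gradient of η. Since the boundary is a surface, ∇η ∈ H¹ lies in L^q for every finite q, by
the Gagliardo-Nirenberg-Sobolev inequality in the charts (`exists_planar_approx`,
`exists_height_approx`), but in general not in L^∞. Hölder's inequality with 1/r = 1/p₀ + 1/q, for a
finite p₀ with r < p₀ ≤ p, then costs the passage from p to r.

As Φ need not be Lipschitz, the chain rule is itself proved by approximation. Mollifying η in the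
charts gives C¹ maps Φₙ → Φ pointwise, with differentials converging in L¹
(`exists_hasApproxDeriv`). This settles smooth v (`HasApproxDeriv.integral_comp`). A Sobolev
function v is then mollified near the compact image of the support of the test function; the bound
on the image measure transports the L^p convergence, and DΦ ∈ L^q allows passing to the limit
(`HasApproxDeriv.integral_comp_sobolev`). -/

open Filter

/-! ### Mollification on `ℝ^d` -/

/-- The standard sequence of bump functions with supports shrinking to the origin. -/
noncomputable def bumpSeq (d n : ℕ) : ContDiffBump (0 : Euc d) where
  rIn := ((n : ℝ) + 1)⁻¹ / 2
  rOut := ((n : ℝ) + 1)⁻¹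
  rIn_pos := by positivity
  rIn_lt_rOut := half_lt_self (by positivity)

/-- The mollifying kernels. -/
noncomputable def mollifier (d n : ℕ) : Euc d → ℝ := (bumpSeq d n).normed volume

/-- The mollification of `w` at scale `1 / (n + 1)`. -/
noncomputable def mollify {d : ℕ} (n : ℕ) (w : Euc d → ℝ) : Euc d → ℝ :=
  convolution (mollifier d n) w (ContinuousLinearMap.lsmul ℝ ℝ) volume

section Mollify

variable {d : ℕ}

lemma bumpSeq_rOut_tendsto : Tendsto (fun n => (bumpSeq d n).rOut) atTop (𝓝 0) :=
  tendsto_inv_atTop_zero.comp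
    (tendsto_atTop_add_const_right _ 1 tendsto_natCast_atTop_atTop)

lemma mollifier_contDiff (n : ℕ) : ContDiff ℝ ∞ (mollifier d n) :=
  (bumpSeq d n).contDiff_normed

lemma mollifier_hasCompactSupport (n : ℕ) : HasCompactSupport (mollifier d n) :=
  (bumpSeq d n).hasCompactSupport_normed

lemma mollifier_nonneg (n : ℕ) (x : Euc d) : 0 ≤ mollifier d n x :=
  (bumpSeq d n).nonneg_normed x

lemma tsupport_mollifier (n : ℕ) :
    tsupport (mollifier d n) = Metric.closedBall 0 (bumpSeq d n).rOut :=
  (bumpSeq d n).tsupport_normed_eq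

lemma mollify_apply (n : ℕ) (w : Euc d → ℝ) (x : Euc d) :
    mollify n w x = ∫ t, mollifier d n (x - t) * w t := by
  simp only [mollify, convolution_lsmul_swap, smul_eq_mul]

lemma mollify_contDiff (n : ℕ) {w : Euc d → ℝ} (hw : LocallyIntegrable w volume) :
    ContDiff ℝ ∞ (mollify n w) :=
  (mollifier_hasCompactSupport n).contDiff_convolution_left _ (mollifier_contDiff n) hw

lemma fderiv_mollify_apply (n : ℕ) {w : Euc d → ℝ} (hw : LocallyIntegrable w volume)
    (x e : Euc d) :
    fderiv ℝ (mollify n w) x e = ∫ t, fderiv ℝ (mollifier d n) (x - t) e * w t := by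
  have hρ : ContDiff ℝ 1 (mollifier d n) := (mollifier_contDiff n).of_le (by simp)
  have h := (mollifier_hasCompactSupport n).hasFDerivAt_convolution_left
    (ContinuousLinearMap.lsmul ℝ ℝ) hρ hw x
  rw [mollify, h.fderiv, convolution_eq_swap]
  have hint : Integrable (fun t => ((ContinuousLinearMap.lsmul ℝ ℝ).precompL (Euc d)
      (fderiv ℝ (mollifier d n) (x - t))) (w t)) volume :=
    (((mollifier_hasCompactSupport n).fderiv ℝ).convolutionExists_left _
      (hρ.continuous_fderiv one_ne_zero) hw x).integrable_swap
  rw [ContinuousLinearMap.integral_apply hint]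
  rfl

lemma dist_mollify_le (n : ℕ) {w : Euc d → ℝ} (hw : AEStronglyMeasurable w volume)
    {x : Euc d} {ε : ℝ} (h : ∀ y ∈ Metric.ball x (bumpSeq d n).rOut, dist (w y) (w x) ≤ ε) :
    dist (mollify n w x) (w x) ≤ ε :=
  (bumpSeq d n).dist_normed_convolution_le hw h

lemma mollify_uniform {w : Euc d → ℝ} (hw : UniformContinuous w) :
    TendstoUniformly (fun n => mollify n w) w atTop := by
  rw [Metric.tendstoUniformly_iff]
  intro ε hε
  obtain ⟨δ, hδ, h⟩ := Metric.uniformContinuous_iff.1 hw (ε / 2) (by positivity)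
  filter_upwards [(bumpSeq_rOut_tendsto (d := d)).eventually_lt_const hδ] with n hn x
  rw [dist_comm]
  refine (dist_mollify_le n hw.continuous.aestronglyMeasurable (ε := ε / 2) ?_).trans_lt
    (half_lt_self hε)
  intro y hy
  exact (h ((Metric.mem_ball.1 hy).trans hn)).le

lemma mollify_eq_zero (n : ℕ) {w : Euc d → ℝ} {x : Euc d}
    (h : ∀ y ∈ Metric.closedBall x (bumpSeq d n).rOut, w y = 0) : mollify n w x = 0 := by
  rw [mollify_apply]
  refine integral_eq_zero_of_ae (Eventually.of_forall fun t => ?_)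
  by_cases ht : t ∈ Metric.closedBall x (bumpSeq d n).rOut
  · simp [h t ht]
  · have : mollifier d n (x - t) = 0 := by
      apply image_eq_zero_of_notMem_tsupport
      rw [tsupport_mollifier]
      simpa [dist_eq_norm, norm_sub_rev] using ht
    simp [this]

lemma integral_mollifier (n : ℕ) : ∫ x, mollifier d n x = 1 := (bumpSeq d n).integral_normed

lemma lintegral_mollifier (n : ℕ) : ∫⁻ x, ENNReal.ofReal (mollifier d n x) = 1 := by
  have hi : Integrable (mollifier d n) volume := (bumpSeq d n).integrable_normed
  rw [← ofReal_integral_eq_lintegral_ofReal hi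
    (Eventually.of_forall (mollifier_nonneg n)), integral_mollifier, ENNReal.ofReal_one]

/-- Jensen's inequality for the probability measure whose density is the kernel, in the form that
L^1 norms are at most L^p norms for such a measure. -/
lemma enorm_mollify_rpow_le (n : ℕ) {w : Euc d → ℝ} (hw : AEStronglyMeasurable w volume)
    {p : ℝ} (hp : 1 ≤ p) (x : Euc d) :
    ‖mollify n w x‖ₑ ^ p ≤ ∫⁻ t, ENNReal.ofReal (mollifier d n t) * ‖w (x - t)‖ₑ ^ p := by
  have hm : Measurable fun t => ENNReal.ofReal (mollifier d n t) :=
    (mollifier_contDiff n).continuous.measurable.ennreal_ofReal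
  set ν : Measure (Euc d) := volume.withDensity fun t => ENNReal.ofReal (mollifier d n t)
  have : IsProbabilityMeasure ν := ⟨by simp [ν, lintegral_mollifier]⟩
  have hwx : AEStronglyMeasurable (fun t => w (x - t)) volume :=
    hw.comp_quasiMeasurePreserving (quasiMeasurePreserving_sub_left volume x)
  have hwν : AEStronglyMeasurable (fun t => w (x - t)) ν :=
    hwx.mono_ac (withDensity_absolutelyContinuous _ _)
  have h1 : ‖mollify n w x‖ₑ ≤ ∫⁻ t, ‖w (x - t)‖ₑ ∂ν := by
    rw [mollify, convolution_lsmul]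
    refine (enorm_integral_le_lintegral_enorm _).trans ?_
    rw [lintegral_withDensity_eq_lintegral_mul₀' hm.aemeasurable hwν.enorm]
    refine lintegral_mono fun t => ?_
    simp [Real.enorm_of_nonneg (mollifier_nonneg n t)]
  have h2 : ∫⁻ t, ‖w (x - t)‖ₑ ∂ν ≤ (∫⁻ t, ‖w (x - t)‖ₑ ^ p ∂ν) ^ (1 / p) := by
    have := eLpNorm_le_eLpNorm_of_exponent_le (μ := ν) (f := fun t => w (x - t))
      (p := 1) (q := ENNReal.ofReal p) (by simpa using hp) hwν
    rw [eLpNorm_one_eq_lintegral_enorm, eLpNorm_eq_lintegral_rpow_enorm_toReal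
      (by simp; linarith) (by simp), ENNReal.toReal_ofReal (by linarith)] at this
    exact this
  have hp0 : 0 < p := by linarith
  calc ‖mollify n w x‖ₑ ^ p ≤ ((∫⁻ t, ‖w (x - t)‖ₑ ^ p ∂ν) ^ (1 / p)) ^ p := by
        gcongr; exact h1.trans h2
    _ = ∫⁻ t, ‖w (x - t)‖ₑ ^ p ∂ν := by
        rw [← ENNReal.rpow_mul, one_div_mul_cancel hp0.ne', ENNReal.rpow_one]
    _ = _ := by
        rw [lintegral_withDensity_eq_lintegral_mul₀' hm.aemeasurable (hwν.enorm.pow_const p)]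
        rfl

/-- Integrate `enorm_mollify_rpow_le` over x, interchange the integrals and use translation
invariance; the kernel has total mass 1. -/
lemma eLpNorm_mollify_le (n : ℕ) {w : Euc d → ℝ} (hw : AEStronglyMeasurable w volume)
    {p : ℝ≥0} (hp : 1 ≤ p) : eLpNorm (mollify n w) p volume ≤ eLpNorm w p volume := by
  have hp0 : (p : ℝ≥0∞) ≠ 0 := by
    have : p ≠ 0 := by positivity
    exact_mod_cast this
  have hp' : (1 : ℝ) ≤ p := by exact_mod_cast hp
  rw [eLpNorm_eq_lintegral_rpow_enorm_toReal hp0 (by simp),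
    eLpNorm_eq_lintegral_rpow_enorm_toReal hp0 (by simp)]
  simp only [ENNReal.coe_toReal]
  refine ENNReal.rpow_le_rpow ?_ (by positivity)
  have hm : Measurable fun t => ENNReal.ofReal (mollifier d n t) :=
    (mollifier_contDiff n).continuous.measurable.ennreal_ofReal
  calc ∫⁻ x, ‖mollify n w x‖ₑ ^ (p : ℝ)
      ≤ ∫⁻ x, ∫⁻ t, ENNReal.ofReal (mollifier d n t) * ‖w (x - t)‖ₑ ^ (p : ℝ) :=
        lintegral_mono fun x => enorm_mollify_rpow_le n hw hp' x
    _ = ∫⁻ t, ∫⁻ x, ENNReal.ofReal (mollifier d n t) * ‖w (x - t)‖ₑ ^ (p : ℝ) := by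
        refine lintegral_lintegral_swap ?_
        have h1 : AEStronglyMeasurable (fun z : Euc d × Euc d => w (z.1 - z.2))
            (volume.prod volume) :=
          hw.comp_quasiMeasurePreserving (quasiMeasurePreserving_sub_of_right_invariant _ _)
        exact (hm.comp measurable_snd).aemeasurable.mul (h1.enorm.pow_const _)
    _ = ∫⁻ t, ENNReal.ofReal (mollifier d n t) * ∫⁻ x, ‖w x‖ₑ ^ (p : ℝ) := by
        refine lintegral_congr fun t => ?_
        rw [lintegral_const_mul' _ _ (by simp),
          lintegral_sub_right_eq_self (fun x => ‖w x‖ₑ ^ (p : ℝ)) t]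
    _ = ∫⁻ x, ‖w x‖ₑ ^ (p : ℝ) := by
        rw [lintegral_mul_const _ hm, lintegral_mollifier, one_mul]

lemma mollify_sub (n : ℕ) {w w' : Euc d → ℝ} (hw : LocallyIntegrable w volume)
    (hw' : LocallyIntegrable w' volume) :
    mollify n (w - w') = mollify n w - mollify n w' := by
  have key : ∀ {u : Euc d → ℝ}, LocallyIntegrable u volume → ∀ x,
      Integrable (fun t => mollifier d n (x - t) * u t) volume := fun hu x =>
    ((mollifier_hasCompactSupport n).convolutionExists_left (ContinuousLinearMap.lsmul ℝ ℝ)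
      (mollifier_contDiff n).continuous hu x).integrable_swap
  ext x
  rw [Pi.sub_apply, mollify_apply, mollify_apply, mollify_apply,
    ← integral_sub (key hw x) (key hw' x)]
  simp [mul_sub]

/-- The convergence is uniform and takes place on one compact set, the closed 1-neighbourhood of the
support, because all kernels have radius at most 1. -/
lemma tendsto_eLpNorm_mollify_sub_of_continuous {g : Euc d → ℝ} (hg : Continuous g)
    (hgs : HasCompactSupport g) (p : ℝ≥0∞) :
    Tendsto (fun n => eLpNorm (mollify n g - g) p volume) atTop (𝓝 0) := by
  set K := Metric.cthickening 1 (tsupport g) with hK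
  have hKc : IsCompact K := hgs.isCompact.cthickening
  have hsupp : ∀ n, ∀ x, x ∉ K → (mollify n g - g) x = 0 := by
    intro n x hx
    have h1 : g x = 0 := image_eq_zero_of_notMem_tsupport fun h =>
      hx (Metric.self_subset_cthickening _ h)
    have h2 : mollify n g x = 0 := by
      refine mollify_eq_zero n fun y hy => image_eq_zero_of_notMem_tsupport fun h => hx ?_
      refine Metric.mem_cthickening_of_dist_le x y 1 _ h ?_
      rw [dist_comm]
      refine (Metric.mem_closedBall.1 hy).trans ?_
      change ((n : ℝ) + 1)⁻¹ ≤ 1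
      exact inv_le_one_of_one_le₀ (by simp)
    simp [h1, h2]
  have hunif := mollify_uniform (hgs.uniformContinuous_of_continuous hg)
  have hKfin : volume K ^ p.toReal⁻¹ ≠ ⊤ :=
    ENNReal.rpow_ne_top_of_nonneg (by simp) hKc.measure_lt_top.ne
  rw [ENNReal.tendsto_nhds_zero]
  intro ε hε
  obtain ⟨δ, hδ, hδε⟩ : ∃ δ : ℝ≥0, 0 < δ ∧ volume K ^ p.toReal⁻¹ * δ ≤ ε := by
    rcases eq_or_ne ε ⊤ with rfl | hε'
    · exact ⟨1, one_pos, le_top⟩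
    · obtain ⟨δ, hδ, h⟩ := ENNReal.exists_nnreal_pos_mul_lt hKfin hε.ne'
      exact ⟨δ, hδ, by rw [mul_comm]; exact h.le⟩
  filter_upwards [Metric.tendstoUniformly_iff.1 hunif δ hδ] with n hn
  have hind : mollify n g - g = K.indicator (mollify n g - g) := by
    ext x
    by_cases hx : x ∈ K
    · simp [hx]
    · rw [indicator_of_notMem hx, hsupp n x hx]
  rw [hind, eLpNorm_indicator_eq_eLpNorm_restrict hKc.measurableSet]
  refine (eLpNorm_le_of_ae_bound (C := δ) (Eventually.of_forall fun x => ?_)).trans ?_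
  · have := hn x
    rw [dist_comm, dist_eq_norm] at this
    exact this.le
  · simpa using hδε

/-- Mollification is a contraction of L^p, so convergence on the dense class of continuous compactly
supported functions suffices; this is where p must be finite. -/
theorem tendsto_eLpNorm_mollify_sub {w : Euc d → ℝ} {p : ℝ≥0} (hp : 1 ≤ p)
    (hw : MemLp w p volume) :
    Tendsto (fun n => eLpNorm (mollify n w - w) p volume) atTop (𝓝 0) := by
  have hp1 : (1 : ℝ≥0∞) ≤ p := by exact_mod_cast hp
  rw [ENNReal.tendsto_nhds_zero]
  intro ε hε
  have hε3 : ε / 3 ≠ 0 := (ENNReal.div_pos hε.ne' (by simp)).ne'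
  obtain ⟨g, hgs, hwg, hg, hgp⟩ := hw.exists_hasCompactSupport_eLpNorm_sub_le
    ENNReal.coe_ne_top hε3
  filter_upwards [ENNReal.tendsto_nhds_zero.1
    (tendsto_eLpNorm_mollify_sub_of_continuous hg hgs p) (ε / 3) (pos_iff_ne_zero.2 hε3)]
    with n hn
  have hwl : LocallyIntegrable w volume := hw.locallyIntegrable hp1
  have hgl : LocallyIntegrable g volume := hg.locallyIntegrable
  have hdecomp : mollify n w - w = (mollify n (w - g) + (mollify n g - g)) + (g - w) := by
    rw [mollify_sub n hwl hgl]; abel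
  have hsm : ∀ {u : Euc d → ℝ}, LocallyIntegrable u volume →
      AEStronglyMeasurable (mollify n u) volume := fun hu =>
    (mollify_contDiff n hu).continuous.aestronglyMeasurable
  rw [hdecomp]
  calc _ ≤ (eLpNorm (mollify n (w - g)) p volume + eLpNorm (mollify n g - g) p volume)
        + eLpNorm (g - w) p volume := by
        refine (eLpNorm_add_le (((hsm (hwl.sub hgl))).add ((hsm hgl).sub hg.aestronglyMeasurable))
          (hg.aestronglyMeasurable.sub hw.1) hp1).trans ?_
        gcongr
        exact eLpNorm_add_le (hsm (hwl.sub hgl)) ((hsm hgl).sub hg.aestronglyMeasurable) hp1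
    _ ≤ (ε / 3 + ε / 3) + ε / 3 := by
        gcongr
        · exact (eLpNorm_mollify_le n (hw.1.sub hg.aestronglyMeasurable) hp).trans hwg
        · rw [eLpNorm_sub_comm]; exact hwg
    _ = ε := ENNReal.add_thirds ε

end Mollify

/-! ### Weak partial derivatives -/

/-- The `i`-th standard basis vector. -/
noncomputable abbrev axis {d : ℕ} (i : Fin d) : Euc d := EuclideanSpace.single i (1 : ℝ)

/-- `g` is the weak `i`-th partial derivative of `v` on `U`. -/
def HasWeakPartial {d : ℕ} (U : Set (Euc d)) (i : Fin d) (v g : Euc d → ℝ) : Prop :=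
  LocallyIntegrableOn v U volume ∧ LocallyIntegrableOn g U volume ∧
    ∀ φ : Euc d → ℝ, ContDiff ℝ ∞ φ → HasCompactSupport φ → tsupport φ ⊆ U →
      ∫ x in U, v x * fderiv ℝ φ x (axis i) = -∫ x in U, g x * φ x

/-- `Φ` is a continuous map on `V` with weak differential `D`, approximable by `C¹` maps. -/
structure HasApproxDeriv {d : ℕ} (V : Set (Euc d)) (Φ : Euc d → Euc d)
    (D : Euc d → Euc d →L[ℝ] Euc d) : Prop where
  continuousOn : ContinuousOn Φ V
  integrableOn : IntegrableOn D V volume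
  approx : ∃ Φn : ℕ → Euc d → Euc d, (∀ n, ContDiffOn ℝ 1 (Φn n) V) ∧
    (∀ x ∈ V, Tendsto (fun n => Φn n x) atTop (𝓝 (Φ x))) ∧
    Tendsto (fun n => eLpNorm (fun x => fderiv ℝ (Φn n) x - D x) 1 (volume.restrict V))
      atTop (𝓝 0)

section WeakDeriv

variable {d : ℕ}

lemma isWeakDeriv_one_iff {U : Set (Euc d)} {α : Fin 1 → Fin d} {v g : Euc d → ℝ} :
    IsWeakDeriv U α v g ↔ HasWeakPartial U (α 0) v g := by
  simp [IsWeakDeriv, HasWeakPartial, iteratedFDeriv_one_apply]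

/-- The kernel t ↦ ρₙ(x - t) is itself a test function on U as soon as the ball about x lies in U,
and its t-derivative is minus its x-derivative, which absorbs the sign in the weak derivative. Only
the values on that ball enter, so v and g may be replaced by cut-off versions w and w'. -/
lemma fderiv_mollify_eq {U : Set (Euc d)} {i : Fin d} {v g w w' : Euc d → ℝ} (hU : IsOpen U)
    (h : HasWeakPartial U i v g) (hw : LocallyIntegrable w volume) {n : ℕ} {x : Euc d}
    (hxU : Metric.closedBall x (bumpSeq d n).rOut ⊆ U)
    (hwv : ∀ y ∈ Metric.closedBall x (bumpSeq d n).rOut, w y = v y)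
    (hwg : ∀ y ∈ Metric.closedBall x (bumpSeq d n).rOut, w' y = g y) :
    fderiv ℝ (mollify n w) x (axis i) = mollify n w' x := by
  set r := (bumpSeq d n).rOut
  have hzero : ∀ t, t ∉ Metric.closedBall x r → x - t ∉ tsupport (mollifier d n) := by
    intro t ht
    rw [tsupport_mollifier]
    simpa [dist_eq_norm, norm_sub_rev] using ht
  have hρ : ContDiff ℝ ∞ (mollifier d n) := mollifier_contDiff n
  have hφ : ContDiff ℝ ∞ (fun t => mollifier d n (x - t)) :=
    hρ.comp (contDiff_const.sub contDiff_id)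
  have hsub : tsupport (fun t => mollifier d n (x - t)) ⊆ Metric.closedBall x r := by
    refine closure_minimal ?_ Metric.isClosed_closedBall
    intro t ht
    by_contra hcon
    exact ht (image_eq_zero_of_notMem_tsupport (hzero t hcon))
  have hfd : ∀ t, fderiv ℝ (fun t => mollifier d n (x - t)) t (axis i)
      = -(fderiv ℝ (mollifier d n) (x - t) (axis i)) := by
    intro t
    have h1 : HasFDerivAt (fun t : Euc d => x - t) (-ContinuousLinearMap.id ℝ (Euc d)) t :=
      (hasFDerivAt_id t).const_sub x
    have h2 := ((hρ.differentiable (by simp)) (x - t)).hasFDerivAt.comp t h1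
    have h3 : fderiv ℝ (fun t => mollifier d n (x - t)) t = _ := h2.fderiv
    rw [h3]; simp
  have key := h.2.2 _ hφ (HasCompactSupport.of_support_subset_isCompact
    (isCompact_closedBall x r) (subset_closure.trans hsub)) (hsub.trans hxU)
  rw [fderiv_mollify_apply n hw, mollify_apply]
  have h1 : ∫ t, fderiv ℝ (mollifier d n) (x - t) (axis i) * w t
      = -∫ t in U, v t * fderiv ℝ (fun t => mollifier d n (x - t)) t (axis i) := by
    rw [← integral_neg, ← integral_indicator hU.measurableSet]
    refine integral_congr_ae (Eventually.of_forall fun t => ?_)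
    by_cases ht : t ∈ Metric.closedBall x r
    · simp only [indicator_of_mem (hxU ht), hfd, hwv t ht]; ring
    · have : fderiv ℝ (mollifier d n) (x - t) = 0 :=
        image_eq_zero_of_notMem_tsupport fun hc => hzero t ht (tsupport_fderiv_subset ℝ hc)
      by_cases htU : t ∈ U <;> simp [htU, hfd, this]
  have h2 : ∫ t, mollifier d n (x - t) * w' t = ∫ t in U, g t * mollifier d n (x - t) := by
    rw [← integral_indicator hU.measurableSet]
    refine integral_congr_ae (Eventually.of_forall fun t => ?_)
    by_cases ht : t ∈ Metric.closedBall x r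
    · simp only [indicator_of_mem (hxU ht), hwg t ht]; ring
    · have : mollifier d n (x - t) = 0 := image_eq_zero_of_notMem_tsupport (hzero t ht)
      by_cases htU : t ∈ U <;> simp [htU, this]
  rw [h1, key, h2, neg_neg]

/-- Local approximation of a Sobolev function by smooth functions. -/
theorem exists_smooth_approx {U L : Set (Euc d)} (hU : IsOpen U) (hL : IsCompact L) (hLU : L ⊆ U)
    {p : ℝ≥0} (hp : 1 ≤ p) {v : Euc d → ℝ} {g : Fin d → Euc d → ℝ}
    (hg : ∀ i, HasWeakPartial U i v (g i)) (hvp : MemLp v p (volume.restrict U))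
    (hgp : ∀ i, MemLp (g i) p (volume.restrict U)) :
    ∃ vn : ℕ → Euc d → ℝ, (∀ n, ContDiff ℝ ∞ (vn n)) ∧ (∀ n, HasCompactSupport (vn n)) ∧
      Tendsto (fun n => eLpNorm (fun x => vn n x - v x) p (volume.restrict L)) atTop (𝓝 0) ∧
      ∀ i, Tendsto (fun n => eLpNorm (fun x => fderiv ℝ (vn n) x (axis i) - g i x) p
        (volume.restrict L)) atTop (𝓝 0) := by
  have hp1 : (1 : ℝ≥0∞) ≤ p := by exact_mod_cast hp
  -- The functions are truncated to the δ-neighbourhood W of L. Once the mollification radius is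
  -- below δ, no point of L sees the truncation, so the derivatives of the mollified function are
  -- the mollified weak derivatives there.
  obtain ⟨δ, hδ, hδU⟩ := hL.exists_cthickening_subset_open hU hLU
  set W := Metric.cthickening δ L
  have hWm : MeasurableSet W := Metric.isClosed_cthickening.measurableSet
  have hLW : L ⊆ W := Metric.self_subset_cthickening _
  have hind : ∀ {u : Euc d → ℝ}, MemLp u p (volume.restrict U) →
      MemLp (W.indicator u) p volume := fun hu => by
    rw [memLp_indicator_iff_restrict hWm]
    exact hu.mono_measure (Measure.restrict_mono hδU le_rfl)
  have hball : ∀ n, (bumpSeq d n).rOut ≤ δ → ∀ x ∈ L,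
      Metric.closedBall x (bumpSeq d n).rOut ⊆ W := by
    intro n hn x hx y hy
    exact Metric.mem_cthickening_of_dist_le y x δ L hx ((Metric.mem_closedBall.1 hy).trans hn)
  have hLm : MeasurableSet L := hL.measurableSet
  have hconv : ∀ {u : Euc d → ℝ}, MemLp u p (volume.restrict U) →
      Tendsto (fun n => eLpNorm (fun x => mollify n (W.indicator u) x - u x) p
        (volume.restrict L)) atTop (𝓝 0) := by
    intro u hu
    refine tendsto_of_tendsto_of_tendsto_of_le_of_le tendsto_const_nhds
      (tendsto_eLpNorm_mollify_sub hp (hind hu)) (fun _ => zero_le) fun n => ?_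
    have : eLpNorm (fun x => mollify n (W.indicator u) x - u x) p (volume.restrict L)
        = eLpNorm (mollify n (W.indicator u) - W.indicator u) p (volume.restrict L) := by
      refine eLpNorm_congr_ae ?_
      filter_upwards [ae_restrict_mem hLm] with x hx
      simp [indicator_of_mem (hLW hx)]
    exact this.trans_le (eLpNorm_mono_measure _ Measure.restrict_le_self)
  have hwl : LocallyIntegrable (W.indicator v) volume := (hind hvp).locallyIntegrable hp1
  refine ⟨fun n => mollify n (W.indicator v), fun n => mollify_contDiff n hwl, fun n => ?_,
    hconv hvp, fun i => ?_⟩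
  · refine (mollifier_hasCompactSupport n).convolution _ ?_
    exact HasCompactSupport.of_support_subset_isCompact hL.cthickening support_indicator_subset
  · refine (hconv (hgp i)).congr' ?_
    filter_upwards [(bumpSeq_rOut_tendsto (d := d)).eventually_le_const hδ] with n hn
    refine eLpNorm_congr_ae ?_
    filter_upwards [ae_restrict_mem hLm] with x hx
    rw [fderiv_mollify_eq (w' := W.indicator (g i)) hU (hg i) hwl ((hball n hn x hx).trans hδU)
      (fun y hy => indicator_of_mem (hball n hn x hx hy) _)
      (fun y hy => indicator_of_mem (hball n hn x hx hy) _)]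

lemma integrableOn_mul_of_tsupport {V : Set (Euc d)} {f φ : Euc d → ℝ} (hf : ContinuousOn f V)
    (hφ : Continuous φ) (hφc : HasCompactSupport φ) (hφV : tsupport φ ⊆ V) :
    Integrable (fun x => f x * φ x) volume := by
  rw [← integrableOn_iff_integrable_of_support_subset (s := tsupport φ)]
  · exact ((hf.mono hφV).mul hφ.continuousOn).integrableOn_compact hφc
  · intro x hx
    exact subset_tsupport _ (right_ne_zero_of_mul hx)

lemma setIntegral_mul_eq {V : Set (Euc d)} {f φ : Euc d → ℝ} (hφV : tsupport φ ⊆ V) :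
    ∫ x in V, f x * φ x = ∫ x, f x * φ x := by
  refine setIntegral_eq_integral_of_forall_compl_eq_zero fun x hx => ?_
  rw [image_eq_zero_of_notMem_tsupport fun h => hx (hφV h), mul_zero]

lemma setIntegral_mul_fderiv_eq_neg {V : Set (Euc d)} (hV : IsOpen V) {u φ : Euc d → ℝ}
    (hu : ContDiffOn ℝ 1 u V) (hφ : ContDiff ℝ ∞ φ) (hφc : HasCompactSupport φ)
    (hφV : tsupport φ ⊆ V) (e : Euc d) :
    ∫ x in V, u x * fderiv ℝ φ x e = -∫ x in V, fderiv ℝ u x e * φ x := by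
  have hsub : tsupport (fun x => fderiv ℝ φ x e) ⊆ tsupport φ :=
    (closure_mono fun x hx => by
      intro h0
      exact hx (by simp [h0])).trans (tsupport_fderiv_subset ℝ)
  have hφ'c : HasCompactSupport (fun x => fderiv ℝ φ x e) := hφc.fderiv_apply ℝ e
  have hcφ' : Continuous (fun x => fderiv ℝ φ x e) :=
    (hφ.continuous_fderiv (by simp)).clm_apply continuous_const
  have hcu' : ContinuousOn (fun x => fderiv ℝ u x e) V :=
    (hu.continuousOn_fderiv_of_isOpen hV le_rfl).clm_apply continuousOn_const
  rw [setIntegral_mul_eq (hsub.trans hφV), setIntegral_mul_eq hφV]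
  refine integral_mul_fderiv_eq_neg_fderiv_mul_of_integrable
    (integrableOn_mul_of_tsupport hcu' hφ.continuous hφc hφV)
    (integrableOn_mul_of_tsupport hu.continuousOn hcφ' hφ'c (hsub.trans hφV))
    (integrableOn_mul_of_tsupport hu.continuousOn hφ.continuous hφc hφV) (fun x hx => ?_)
    fun x _ => (hφ.differentiable (by simp)) x
  exact (hu.differentiableOn one_ne_zero).differentiableAt (hV.mem_nhds (hφV hx))

/-- The chain rule for a smooth outer function. -/
theorem HasApproxDeriv.integral_comp {V : Set (Euc d)} (hV : IsOpen V) {Φ : Euc d → Euc d}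
    {D : Euc d → Euc d →L[ℝ] Euc d} (hΦ : HasApproxDeriv V Φ D) {w : Euc d → ℝ}
    (hw : ContDiff ℝ 1 w) (hwc : HasCompactSupport w) {φ : Euc d → ℝ} (hφ : ContDiff ℝ ∞ φ)
    (hφc : HasCompactSupport φ) (hφV : tsupport φ ⊆ V) (e : Euc d) :
    ∫ x in V, w (Φ x) * fderiv ℝ φ x e = -∫ x in V, fderiv ℝ w (Φ x) (D x e) * φ x := by
  obtain ⟨Φn, hΦn, hlim, hD⟩ := hΦ.approx
  obtain ⟨B, hB⟩ := hwc.exists_bound_of_continuous hw.continuous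
  obtain ⟨B', hB'⟩ := (hwc.fderiv ℝ).exists_bound_of_continuous (hw.continuous_fderiv one_ne_zero)
  obtain ⟨Bφ, hBφ⟩ := hφc.exists_bound_of_continuous hφ.continuous
  have hB'0 : 0 ≤ B' := (norm_nonneg _).trans (hB' 0)
  have hBφ0 : 0 ≤ Bφ := (norm_nonneg _).trans (hBφ 0)
  have hcφ' : Continuous (fun x => fderiv ℝ φ x e) :=
    (hφ.continuous_fderiv (by simp)).clm_apply continuous_const
  have hφ'i : Integrable (fun x => fderiv ℝ φ x e) volume :=
    hcφ'.integrable_of_hasCompactSupport (hφc.fderiv_apply ℝ e)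
  have hVm := hV.measurableSet
  have hw' : Continuous (fderiv ℝ w) := hw.continuous_fderiv one_ne_zero
  have hfn : ∀ n, ContinuousOn (fderiv ℝ (Φn n)) V := fun n =>
    (hΦn n).continuousOn_fderiv_of_isOpen hV le_rfl
  have hmeas : ∀ n, AEStronglyMeasurable (fun x => fderiv ℝ w (Φn n x)) (volume.restrict V) :=
    fun n => (hw'.comp_continuousOn (hΦn n).continuousOn).aestronglyMeasurable hVm
  have hDm : AEStronglyMeasurable D (volume.restrict V) := hΦ.integrableOn.aestronglyMeasurable
  have hDe : Integrable (fun x => D x e) (volume.restrict V) :=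
    hΦ.integrableOn.apply_continuousLinearMap e
  have hφm : AEStronglyMeasurable φ (volume.restrict V) := hφ.continuous.aestronglyMeasurable
  have hmeasD : ∀ n, AEStronglyMeasurable (fun x => fderiv ℝ w (Φn n x) (D x e))
      (volume.restrict V) := fun n =>
    (ContinuousLinearMap.id ℝ (Euc d →L[ℝ] ℝ)).aestronglyMeasurable_comp₂ (hmeas n)
      hDe.aestronglyMeasurable
  -- the left-hand sides converge
  have hA : Tendsto (fun n => ∫ x in V, w (Φn n x) * fderiv ℝ φ x e) atTop
      (𝓝 (∫ x in V, w (Φ x) * fderiv ℝ φ x e)) := by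
    refine tendsto_integral_of_dominated_convergence (fun x => B * ‖fderiv ℝ φ x e‖) (fun n => ?_)
      (hφ'i.norm.const_mul B).integrableOn (fun n => ?_) ?_
    · exact ((hw.continuous.comp_continuousOn (hΦn n).continuousOn).mul
        hcφ'.continuousOn).aestronglyMeasurable hVm
    · refine Eventually.of_forall fun x => ?_
      rw [norm_mul]
      exact mul_le_mul_of_nonneg_right (hB _) (norm_nonneg _)
    · filter_upwards [ae_restrict_mem hVm] with x hx
      exact ((hw.continuous.tendsto _).comp (hlim x hx)).mul_const _
  -- the right-hand sides converge
  have hC : Tendsto (fun n => ∫ x in V, fderiv ℝ w (Φn n x) (D x e) * φ x) atTop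
      (𝓝 (∫ x in V, fderiv ℝ w (Φ x) (D x e) * φ x)) := by
    refine tendsto_integral_of_dominated_convergence (fun x => B' * ‖D x e‖ * Bφ) (fun n => ?_)
      ((hDe.norm.const_mul B').mul_const Bφ) (fun n => ?_) ?_
    · exact (hmeasD n).mul hφm
    · refine Eventually.of_forall fun x => ?_
      rw [norm_mul]
      gcongr
      · exact (ContinuousLinearMap.le_opNorm _ _).trans
          (mul_le_mul_of_nonneg_right (hB' _) (norm_nonneg _))
      · exact hBφ x
    · filter_upwards [ae_restrict_mem hVm] with x hx
      have h1 := (hw'.tendsto _).comp (hlim x hx)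
      exact (((ContinuousLinearMap.apply ℝ ℝ (D x e)).continuous.tendsto _).comp h1).mul_const _
  -- Replacing the differential of Φₙ by the limit D costs at most sup |Dw| · |e| · sup |φ| times
  -- their L¹ distance. With D in its place, dominated convergence applied above.
  have hE : Tendsto (fun n => (∫ x in V, fderiv ℝ w (Φn n x) (fderiv ℝ (Φn n) x e) * φ x)
      - ∫ x in V, fderiv ℝ w (Φn n x) (D x e) * φ x) atTop (𝓝 0) := by
    have hbound : ∀ n, ‖(∫ x in V, fderiv ℝ w (Φn n x) (fderiv ℝ (Φn n) x e) * φ x)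
        - ∫ x in V, fderiv ℝ w (Φn n x) (D x e) * φ x‖ₑ ≤ ENNReal.ofReal (B' * ‖e‖ * Bφ) *
        eLpNorm (fun x => fderiv ℝ (Φn n) x - D x) 1 (volume.restrict V) := by
      intro n
      have hi1 : Integrable (fun x => fderiv ℝ w (Φn n x) (fderiv ℝ (Φn n) x e) * φ x)
          (volume.restrict V) :=
        (integrableOn_mul_of_tsupport
          ((hw'.comp_continuousOn (hΦn n).continuousOn).clm_apply
            ((hfn n).clm_apply continuousOn_const)) hφ.continuous hφc hφV).integrableOn
      have hi2 : Integrable (fun x => fderiv ℝ w (Φn n x) (D x e) * φ x) (volume.restrict V) := by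
        refine ((hDe.norm.const_mul B').mul_const Bφ).mono'
          ((hmeasD n).mul hφm)
          (Eventually.of_forall fun x => ?_)
        rw [norm_mul]
        gcongr
        · exact (ContinuousLinearMap.le_opNorm _ _).trans
            (mul_le_mul_of_nonneg_right (hB' _) (norm_nonneg _))
        · exact hBφ x
      rw [← integral_sub hi1 hi2, eLpNorm_one_eq_lintegral_enorm,
        ← lintegral_const_mul' _ _ ENNReal.ofReal_ne_top]
      refine (enorm_integral_le_lintegral_enorm _).trans (lintegral_mono fun x => ?_)
      rw [← sub_mul, ← map_sub, ← sub_apply]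
      rw [← ofReal_norm, ← ofReal_norm, ← ENNReal.ofReal_mul (by positivity)]
      refine ENNReal.ofReal_le_ofReal ?_
      rw [norm_mul]
      calc _ ≤ (B' * (‖fderiv ℝ (Φn n) x - D x‖ * ‖e‖)) * Bφ := by
            gcongr
            · refine (ContinuousLinearMap.le_opNorm _ _).trans ?_
              gcongr
              · exact hB' _
              · exact ContinuousLinearMap.le_opNorm _ _
            · exact hBφ x
        _ = _ := by ring
    rw [tendsto_zero_iff_enorm_tendsto_zero]
    refine tendsto_of_tendsto_of_tendsto_of_le_of_le tendsto_const_nhds ?_ (fun _ => zero_le) hbound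
    simpa using ENNReal.Tendsto.const_mul hD (Or.inr ENNReal.ofReal_ne_top)
  have hF := hE.add hC
  simp only [sub_add_cancel, zero_add] at hF
  refine tendsto_nhds_unique hA ?_
  refine hF.neg.congr fun n => ?_
  have hcomp : ContDiffOn ℝ 1 (fun x => w (Φn n x)) V := hw.comp_contDiffOn (hΦn n)
  rw [setIntegral_mul_fderiv_eq_neg hV hcomp hφ hφc hφV e]
  congr 1
  refine setIntegral_congr_fun hVm fun x hx => ?_
  have h1 : DifferentiableAt ℝ (Φn n) x :=
    ((hΦn n).differentiableOn one_ne_zero).differentiableAt (hV.mem_nhds hx)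
  have h2 := ((hw.differentiable one_ne_zero) (Φn n x)).hasFDerivAt.comp x h1.hasFDerivAt
  have h3 : fderiv ℝ (fun x => w (Φn n x)) x = _ := h2.fderiv
  simp [h3]

end WeakDeriv

/-! ### Measure distortion, Hölder convergence and the chain rule for Sobolev functions -/

section Composition

variable {d : ℕ}

lemma clm_apply_eq_sum (L : Euc d →L[ℝ] ℝ) (u : Euc d) : L u = ∑ j, L (axis j) * u j := by
  conv_lhs => rw [← (EuclideanSpace.basisFun (Fin d) ℝ).sum_repr u]
  simp [map_sum, mul_comm]

lemma tendsto_integral_mul_of_eLpNorm {X : Type*} [MeasurableSpace X] {μ : Measure X}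
    [IsFiniteMeasure μ] {p q r : ℝ≥0∞} [ENNReal.HolderTriple p q r] (hr : 1 ≤ r)
    {fn : ℕ → X → ℝ} {f g : X → ℝ} (hfn : ∀ n, MemLp (fn n) p μ) (hf : MemLp f p μ)
    (hg : MemLp g q μ) (h : Tendsto (fun n => eLpNorm (fun x => fn n x - f x) p μ) atTop (𝓝 0)) :
    Tendsto (fun n => ∫ x, fn n x * g x ∂μ) atTop (𝓝 (∫ x, f x * g x ∂μ)) := by
  have hmul : ∀ {u : X → ℝ}, MemLp u p μ → Integrable (fun x => u x * g x) μ := fun hu =>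
    (MemLp.smul (r := r) hg hu).integrable hr
  have hle : ∀ n, eLpNorm ((fun x => fn n x * g x) - fun x => f x * g x) 1 μ ≤
      eLpNorm (fun x => fn n x - f x) p μ * eLpNorm g q μ
        * μ univ ^ (1 / (1 : ℝ≥0∞).toReal - 1 / r.toReal) := by
    intro n
    have heq : ((fun x => fn n x * g x) - fun x => f x * g x)
        = (fun x => fn n x - f x) • g := by
      ext x; simp [sub_mul]
    rw [heq]
    have hm : AEStronglyMeasurable (fun x => fn n x - f x) μ := (hfn n).1.sub hf.1
    refine (eLpNorm_le_eLpNorm_mul_rpow_measure_univ hr (hm.smul hg.1)).trans ?_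
    gcongr
    exact eLpNorm_smul_le_mul_eLpNorm hg.1 hm
  refine tendsto_integral_of_L1' _ (hmul hf).aestronglyMeasurable
    (Eventually.of_forall fun n => hmul (hfn n)) ?_
  refine tendsto_of_tendsto_of_tendsto_of_le_of_le tendsto_const_nhds ?_ (fun _ => zero_le) hle
  have hfin : eLpNorm g q μ * μ univ ^ (1 / (1 : ℝ≥0∞).toReal - 1 / r.toReal) ≠ ⊤ := by
    refine ENNReal.mul_ne_top hg.2.ne (ENNReal.rpow_ne_top_of_nonneg ?_ (measure_ne_top _ _))
    rcases eq_or_ne r ⊤ with rfl | hr'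
    · simp
    · have : 1 ≤ r.toReal := by
        rw [← ENNReal.toReal_one]; exact ENNReal.toReal_mono hr' hr
      simp only [ENNReal.toReal_one, div_one, sub_nonneg]
      exact div_le_one_of_le₀ this (by linarith)
  simpa [mul_assoc] using ENNReal.Tendsto.mul_const h (Or.inr hfin)

/-- The usual factor is the total mass to the power 1/r - 1/p. This exponent lies in [0, 1], so c ≥
1 bounds the factor for all exponents at once. -/
lemma eLpNorm_le_mul_of_exponent_le {X E : Type*} [MeasurableSpace X] [NormedAddCommGroup E]
    {μ : Measure X} {c : ℝ≥0} (hc : 1 ≤ c) (hμ : μ univ ≤ c) {p r : ℝ≥0∞} (hr : 1 ≤ r)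
    (hrp : r ≤ p) {f : X → E} (hf : AEStronglyMeasurable f μ) :
    eLpNorm f r μ ≤ c * eLpNorm f p μ := by
  refine (eLpNorm_le_eLpNorm_mul_rpow_measure_univ hrp hf).trans ?_
  rw [mul_comm]
  gcongr
  have hinv : ∀ {s : ℝ≥0∞}, 1 ≤ s → 0 ≤ 1 / s.toReal ∧ 1 / s.toReal ≤ 1 := by
    intro s hs
    refine ⟨by positivity, ?_⟩
    rcases eq_or_ne s ⊤ with rfl | hs'
    · simp
    · have : 1 ≤ s.toReal := by
        rw [← ENNReal.toReal_one]; exact ENNReal.toReal_mono hs' hs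
      exact div_le_one_of_le₀ this (by linarith)
  have h0 : 0 ≤ 1 / r.toReal - 1 / p.toReal := by
    rw [sub_nonneg]
    rcases eq_or_ne p ⊤ with rfl | hp'
    · simp
    · have h1 : r.toReal ≤ p.toReal := ENNReal.toReal_mono hp' hrp
      have h2 : 0 < r.toReal :=
        ENNReal.toReal_pos (one_pos.trans_le hr).ne' (ne_top_of_le_ne_top hp' hrp)
      exact one_div_le_one_div_of_le h2 h1
  have h1 : 1 / r.toReal - 1 / p.toReal ≤ 1 := by
    have := (hinv hr).2
    have := (hinv (hr.trans hrp)).1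
    linarith
  calc μ univ ^ (1 / r.toReal - 1 / p.toReal) ≤ (c : ℝ≥0∞) ^ (1 / r.toReal - 1 / p.toReal) :=
        ENNReal.rpow_le_rpow hμ h0
    _ ≤ (c : ℝ≥0∞) ^ (1 : ℝ) :=
        ENNReal.rpow_le_rpow_of_exponent_le (by exact_mod_cast hc) h1
    _ = c := ENNReal.rpow_one _

lemma eLpNorm_comp_le_of_map_le {X Y : Type*} [MeasurableSpace X] [MeasurableSpace Y]
    {μ : Measure X} {ν : Measure Y} {Φ : X → Y} (hΦ : AEMeasurable Φ μ) {c : ℝ≥0} (hc : 1 ≤ c)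
    (hmap : μ.map Φ ≤ (c : ℝ≥0∞) • ν) {p : ℝ≥0} (hp : 1 ≤ p) {f : Y → ℝ}
    (hf : AEStronglyMeasurable f ν) :
    eLpNorm (f ∘ Φ) p μ ≤ c * eLpNorm f p ν := by
  have hac : μ.map Φ ≪ ν := Measure.absolutelyContinuous_of_le_smul hmap
  rw [← eLpNorm_map_measure (hf.mono_ac hac) hΦ]
  refine (eLpNorm_mono_measure f hmap).trans ?_
  rw [eLpNorm_smul_measure_of_ne_top ENNReal.coe_ne_top, smul_eq_mul]
  gcongr
  have hp' : (1 : ℝ) ≤ p := by exact_mod_cast hp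
  calc (c : ℝ≥0∞) ^ (1 / (p : ℝ≥0∞)).toReal ≤ (c : ℝ≥0∞) ^ (1 : ℝ) := by
        refine ENNReal.rpow_le_rpow_of_exponent_le (by exact_mod_cast hc) ?_
        rw [ENNReal.toReal_div]
        simp only [ENNReal.toReal_one, ENNReal.coe_toReal]
        exact div_le_one_of_le₀ hp' (by linarith)
    _ = c := ENNReal.rpow_one _

lemma aestronglyMeasurable_comp_of_map_le {X Y : Type*} [MeasurableSpace X] [MeasurableSpace Y]
    {μ : Measure X} {ν : Measure Y} {Φ : X → Y} (hΦ : AEMeasurable Φ μ) {c : ℝ≥0}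
    (hmap : μ.map Φ ≤ (c : ℝ≥0∞) • ν) {f : Y → ℝ} (hf : AEStronglyMeasurable f ν) :
    AEStronglyMeasurable (f ∘ Φ) μ :=
  (hf.mono_ac (Measure.absolutelyContinuous_of_le_smul hmap)).comp_aemeasurable hΦ

/-- Localizes the distortion bound: approximation of v is available on compact subsets of U only, so
the image measure of K has to be compared with volume on the image of K. -/
lemma map_restrict_image_le {U V K : Set (Euc d)} {Φ : Euc d → Euc d}
    (hV : MeasurableSet V) (hΦ : ContinuousOn Φ V) {c : ℝ≥0}
    (hmap : (volume.restrict V).map Φ ≤ (c : ℝ≥0∞) • volume.restrict U)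
    (hK : IsCompact K) (hKV : K ⊆ V) :
    (volume.restrict K).map Φ ≤ (c : ℝ≥0∞) • volume.restrict (Φ '' K) := by
  have hL : MeasurableSet (Φ '' K) := (hK.image_of_continuousOn (hΦ.mono hKV)).measurableSet
  have hmV : AEMeasurable Φ (volume.restrict V) := hΦ.aemeasurable hV
  have hmK : AEMeasurable Φ (volume.restrict K) :=
    hmV.mono_measure (Measure.restrict_mono hKV le_rfl)
  refine Measure.le_iff.2 fun s hs => ?_
  rw [Measure.map_apply_of_aemeasurable hmK hs]
  calc (volume.restrict K) (Φ ⁻¹' s)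
      = (volume.restrict K) (Φ ⁻¹' (s ∩ Φ '' K)) := by
        refine measure_congr ?_
        filter_upwards [ae_restrict_mem hK.measurableSet] with x hx
        have : x ∈ Φ ⁻¹' s ↔ x ∈ Φ ⁻¹' (s ∩ Φ '' K) :=
          ⟨fun h => ⟨h, mem_image_of_mem _ hx⟩, fun h => h.1⟩
        exact propext this
    _ ≤ (volume.restrict V) (Φ ⁻¹' (s ∩ Φ '' K)) :=
        Measure.restrict_mono hKV le_rfl _
    _ = ((volume.restrict V).map Φ) (s ∩ Φ '' K) :=
        (Measure.map_apply_of_aemeasurable hmV (hs.inter hL)).symm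
    _ ≤ ((c : ℝ≥0∞) • volume.restrict U) (s ∩ Φ '' K) := hmap _
    _ ≤ ((c : ℝ≥0∞) • volume.restrict (Φ '' K)) s := by
        simp only [Measure.smul_apply, smul_eq_mul]
        rw [Measure.restrict_apply hs]
        exact mul_le_mul_right (Measure.restrict_le_self _) _

lemma ContinuousOn.memLp_restrict_of_isCompact {E : Type*} [NormedAddCommGroup E]
    {K : Set (Euc d)} {f : Euc d → E}
    (hf : ContinuousOn f K) (hK : IsCompact K) (p : ℝ≥0∞) : MemLp f p (volume.restrict K) := by
  have : IsFiniteMeasure (volume.restrict K) := ⟨by simpa using hK.measure_lt_top⟩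
  obtain ⟨C, hC⟩ := hK.exists_bound_of_continuousOn hf
  exact MemLp.of_bound (hf.aestronglyMeasurable_of_isCompact hK hK.measurableSet) C
    ((ae_restrict_mem hK.measurableSet).mono hC)

/-- The chain rule for the composition of a Sobolev function with a map whose weak differential is
in the complementary Lebesgue space. -/
theorem HasApproxDeriv.integral_comp_sobolev {U V : Set (Euc d)} (hU : IsOpen U) (hV : IsOpen V)
    {Φ : Euc d → Euc d} {D : Euc d → Euc d →L[ℝ] Euc d} (hΦ : HasApproxDeriv V Φ D)
    (hΦU : MapsTo Φ V U) {c : ℝ≥0} (hc : 1 ≤ c)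
    (hmap : (volume.restrict V).map Φ ≤ (c : ℝ≥0∞) • volume.restrict U)
    {p : ℝ≥0} {q r : ℝ≥0∞} [ENNReal.HolderTriple p q r] (hp : 1 ≤ p) (hr : 1 ≤ r)
    (hD : MemLp D q (volume.restrict V)) {v : Euc d → ℝ} {g : Fin d → Euc d → ℝ}
    (hg : ∀ i, HasWeakPartial U i v (g i)) (hvp : MemLp v p (volume.restrict U))
    (hgp : ∀ i, MemLp (g i) p (volume.restrict U)) {φ : Euc d → ℝ} (hφ : ContDiff ℝ ∞ φ)
    (hφc : HasCompactSupport φ) (hφV : tsupport φ ⊆ V) (e : Euc d) :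
    ∫ x in V, v (Φ x) * fderiv ℝ φ x e = -∫ x in V, (∑ j, g j (Φ x) * D x e j) * φ x := by
  set K := tsupport φ
  have hK : IsCompact K := hφc.isCompact
  have hΦK : ContinuousOn Φ K := hΦ.continuousOn.mono hφV
  set L := Φ '' K
  have hL : IsCompact L := hK.image_of_continuousOn hΦK
  have hLU : L ⊆ U := (image_mono hφV).trans hΦU.image_subset
  have hmK : AEMeasurable Φ (volume.restrict K) := hΦK.aemeasurable hK.measurableSet
  have hmapK : (volume.restrict K).map Φ ≤ (c : ℝ≥0∞) • volume.restrict L :=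
    map_restrict_image_le hV.measurableSet hΦ.continuousOn hmap hK hφV
  have : IsFiniteMeasure (volume.restrict K) := ⟨by simpa using hK.measure_lt_top⟩
  -- Only the values of v on the image L of the support of φ matter, and L is compact in U, so local
  -- approximation is enough and no regularity of U is needed.
  obtain ⟨vn, hvn, hvnc, hlim, hlim'⟩ := exists_smooth_approx hU hL hLU hp hg hvp hgp
  -- reduction to integrals over `K`
  have hred : ∀ {u ψ : Euc d → ℝ}, (∀ x, x ∉ K → ψ x = 0) →
      ∫ x in V, u x * ψ x = ∫ x in K, u x * ψ x := by
    intro u ψ hψ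
    refine setIntegral_eq_of_subset_of_forall_sdiff_eq_zero hV.measurableSet hφV fun x hx => ?_
    rw [hψ x hx.2, mul_zero]
  have hz : ∀ x, x ∉ K → φ x = 0 := fun x hx => image_eq_zero_of_notMem_tsupport hx
  have hz' : ∀ x, x ∉ K → fderiv ℝ φ x e = 0 := fun x hx => by
    rw [image_eq_zero_of_notMem_tsupport (f := fderiv ℝ φ)
      fun h => hx (tsupport_fderiv_subset ℝ h)]; rfl
  have hUL : ∀ {u : Euc d → ℝ}, MemLp u p (volume.restrict U) → MemLp u p (volume.restrict L) :=
    fun hu => hu.mono_measure (Measure.restrict_mono hLU le_rfl)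
  have hcompK : ∀ {u : Euc d → ℝ}, MemLp u p (volume.restrict L) →
      MemLp (u ∘ Φ) p (volume.restrict K) := fun hu =>
    ⟨aestronglyMeasurable_comp_of_map_le hmK hmapK hu.1,
      (eLpNorm_comp_le_of_map_le hmK hc hmapK hp hu.1).trans_lt
        (ENNReal.mul_lt_top ENNReal.coe_lt_top hu.2)⟩
  -- L^p convergence on L becomes L^p convergence of the compositions on K through the image measure
  -- bound, and Hölder's inequality then tests it against L^q functions. It is used with ψ a
  -- derivative of φ, and with ψ a component of D times φ.
  have hconv : ∀ {un : ℕ → Euc d → ℝ} {u : Euc d → ℝ}, (∀ n, Continuous (un n)) →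
      MemLp u p (volume.restrict U) →
      Tendsto (fun n => eLpNorm (fun x => un n x - u x) p (volume.restrict L)) atTop (𝓝 0) →
      ∀ {ψ : Euc d → ℝ}, MemLp ψ q (volume.restrict K) →
      Tendsto (fun n => ∫ x in K, un n (Φ x) * ψ x) atTop (𝓝 (∫ x in K, u (Φ x) * ψ x)) := by
    intro un u hun hu hlim ψ hψ
    have hunL : ∀ n, MemLp (un n) p (volume.restrict L) := fun n =>
      (hun n).continuousOn.memLp_restrict_of_isCompact hL _
    suffices hlimK : Tendsto (fun n => eLpNorm (fun x => un n (Φ x) - u (Φ x)) p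
        (volume.restrict K)) atTop (𝓝 0) by
      exact tendsto_integral_mul_of_eLpNorm (p := p) (q := q) (r := r)
        (fn := fun n x => un n (Φ x)) (f := fun x => u (Φ x)) hr
        (fun n => hcompK (hunL n)) (hcompK (hUL hu)) hψ hlimK
    refine tendsto_of_tendsto_of_tendsto_of_le_of_le (g := fun _ => (0 : ℝ≥0∞))
      (h := fun n => c * eLpNorm (fun x => un n x - u x) p (volume.restrict L))
      tendsto_const_nhds ?_ (fun _ => zero_le) fun n => ?_
    · simpa using ENNReal.Tendsto.const_mul hlim (Or.inr ENNReal.coe_ne_top)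
    · exact eLpNorm_comp_le_of_map_le (f := fun x => un n x - u x) hmK hc hmapK hp
        ((hunL n).sub (hUL hu)).1
  have hφ'q : MemLp (fun x => fderiv ℝ φ x e) q (volume.restrict K) :=
    ((hφ.continuous_fderiv (by simp)).clm_apply
      continuous_const).continuousOn.memLp_restrict_of_isCompact hK _
  have hφtop : MemLp φ ⊤ (volume.restrict K) :=
    hφ.continuous.continuousOn.memLp_restrict_of_isCompact hK _
  have hDK : MemLp D q (volume.restrict K) := hD.mono_measure (Measure.restrict_mono hφV le_rfl)
  have hDj : ∀ j, MemLp (fun x => D x e j * φ x) q (volume.restrict K) := by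
    intro j
    have h1 : MemLp (fun x => D x e j) q (volume.restrict K) := by
      have := ((EuclideanSpace.proj j : Euc d →L[ℝ] ℝ).comp
        (ContinuousLinearMap.apply ℝ (Euc d) e)).comp_memLp' hDK
      exact this
    exact MemLp.smul (r := q) hφtop h1
  have hA := hconv (fun n => (hvn n).continuous) hvp hlim hφ'q
  have hB : Tendsto (fun n => ∑ j, ∫ x in K, fderiv ℝ (vn n) (Φ x) (axis j) * (D x e j * φ x))
      atTop (𝓝 (∑ j, ∫ x in K, g j (Φ x) * (D x e j * φ x))) :=
    tendsto_finsetSum _ fun j _ => hconv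
      (un := fun n y => fderiv ℝ (vn n) y (axis j))
      (fun n => ((hvn n).continuous_fderiv (by simp)).clm_apply continuous_const) (hgp j)
      (hlim' j) (hDj j)
  have hsum : ∀ {G : Fin d → Euc d → ℝ}, (∀ j, MemLp (fun x => G j (Φ x)) p (volume.restrict K)) →
      ∑ j, ∫ x in K, G j (Φ x) * (D x e j * φ x)
        = ∫ x in V, (∑ j, G j (Φ x) * D x e j) * φ x := by
    intro G hG
    rw [hred hz, ← integral_finsetSum]
    · refine integral_congr_ae (Eventually.of_forall fun x => ?_)
      simp only [Finset.sum_mul, mul_assoc]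
    · intro j _
      exact (MemLp.smul (r := r) (hDj j) (hG j)).integrable hr
  rw [hred hz']
  refine tendsto_nhds_unique hA ?_
  rw [← hsum fun j => hcompK (hUL (hgp j))]
  refine hB.neg.congr fun n => ?_
  rw [hsum (G := fun j y => fderiv ℝ (vn n) y (axis j)) fun j => hcompK
    ((((hvn n).continuous_fderiv (by simp)).clm_apply
      continuous_const).continuousOn.memLp_restrict_of_isCompact hL _), ← hred hz',
    hΦ.integral_comp hV ((hvn n).of_le (by simp)) (hvnc n) hφ hφc hφV e]
  congr 1
  refine integral_congr_ae (Eventually.of_forall fun x => ?_)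
  simp only [clm_apply_eq_sum (fderiv ℝ (vn n) (Φ x)) (D x e)]

/-- The fundamental lemma of the calculus of variations. It is needed because a weak jet has a
component of order zero, determined almost everywhere only. -/
lemma IsWeakDeriv.ae_eq_of_zero {U : Set (Euc d)} (hU : IsOpen U) {α : Fin 0 → Fin d}
    {v g : Euc d → ℝ} (h : IsWeakDeriv U α v g) : v =ᵐ[volume.restrict U] g := by
  have hsub : LocallyIntegrableOn (fun x => v x - g x) U volume := h.1.sub h.2.1
  have key := hU.ae_eq_zero_of_integral_contDiff_smul_eq_zero hsub (fun φ hφ hφc hφU => by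
    have h1 := h.2.2 φ hφ hφc hφU
    simp only [iteratedFDeriv_zero_apply, pow_zero, one_mul] at h1
    have hint : ∀ {u : Euc d → ℝ}, LocallyIntegrableOn u U volume →
        Integrable (fun x => u x * φ x) volume := fun hu => by
      have := (hu.integrableOn_compact_subset hφU hφc.isCompact).mul_continuousOn
        hφ.continuous.continuousOn hφc.isCompact
      rwa [integrableOn_iff_integrable_of_support_subset] at this
      exact fun x hx => subset_tsupport _ (right_ne_zero_of_mul hx)
    rw [setIntegral_mul_eq hφU, setIntegral_mul_eq hφU] at h1
    simp only [smul_eq_mul, mul_comm (φ _), sub_mul]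
    rw [integral_sub (hint h.1) (hint h.2.1), h1, sub_self])
  rw [Filter.EventuallyEq, ae_restrict_iff' hU.measurableSet]
  filter_upwards [key] with x hx hxU
  exact sub_eq_zero.1 (hx hxU)

end Composition

/-! ### Boundedness of composition operators on Lebesgue and Sobolev spaces -/

section CompBounded

lemma eLpNorm_mul_le_of_holder {X : Type*} [MeasurableSpace X] {μ : Measure X} {p q r : ℝ≥0∞}
    [ENNReal.HolderTriple p q r] {f g : X → ℝ} (hf : AEStronglyMeasurable f μ)
    (hg : AEStronglyMeasurable g μ) :
    eLpNorm (fun x => f x * g x) r μ ≤ eLpNorm f p μ * eLpNorm g q μ := by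
  have h : (fun x => f x * g x) = f • g := by ext; simp
  rw [h]
  exact eLpNorm_smul_le_mul_eLpNorm hg hf

lemma memLp_mul_of_holder {X : Type*} [MeasurableSpace X] {μ : Measure X} {p q r : ℝ≥0∞}
    [ENNReal.HolderTriple p q r] {f g : X → ℝ} (hf : MemLp f p μ) (hg : MemLp g q μ) :
    MemLp (fun x => f x * g x) r μ := by
  have h : (fun x => f x * g x) = f • g := by ext; simp
  rw [h]
  exact MemLp.smul hg hf

lemma sum_fin_one_fun {d : ℕ} (F : (Fin 1 → Fin d) → ℝ≥0∞) : ∑ α, F α = ∑ i, F (fun _ => i) :=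
  ((Equiv.funUnique (Fin 1) (Fin d)).symm.sum_comp F).symm

variable {d : ℕ} {U V : Set (Euc d)} {Φ : Euc d → Euc d} {c₀ c₁ : ℝ≥0} {p₀ : ℝ≥0} {p r : ℝ≥0∞}

lemma eLpNorm_comp_le_exponents (hVm : MeasurableSet V) (hΦ : ContinuousOn Φ V) (hc₀ : 1 ≤ c₀)
    (hc₁ : 1 ≤ c₁) (hU0 : volume U ≤ c₀)
    (hmap : (volume.restrict V).map Φ ≤ (c₁ : ℝ≥0∞) • volume.restrict U) (hp₀ : 1 ≤ p₀)
    (hp : p₀ ≤ p) {v : Euc d → ℝ} (hv : AEStronglyMeasurable v (volume.restrict U)) :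
    eLpNorm (v ∘ Φ) p₀ (volume.restrict V) ≤ (c₁ * c₀ : ℝ≥0) * eLpNorm v p (volume.restrict U) := by
  have hp₀' : (1 : ℝ≥0∞) ≤ p₀ := by exact_mod_cast hp₀
  refine (eLpNorm_comp_le_of_map_le (hΦ.aemeasurable hVm) hc₁ hmap hp₀ hv).trans ?_
  rw [ENNReal.coe_mul, mul_assoc]
  gcongr
  exact eLpNorm_le_mul_of_exponent_le hc₀ (by simpa using hU0) hp₀' hp hv

/-- The estimate passes through the finite exponent p₀: from p down to p₀ on U, across Φ at exponent
p₀, and from p₀ down to r on V. Each lowering of the exponent costs c₀, the crossing costs c₁. -/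
theorem compBoundedLp_of_map_le (hVm : MeasurableSet V) (hΦ : ContinuousOn Φ V) (hc₀ : 1 ≤ c₀)
    (hc₁ : 1 ≤ c₁) (hU0 : volume U ≤ c₀) (hV0 : volume V ≤ c₀)
    (hmap : (volume.restrict V).map Φ ≤ (c₁ : ℝ≥0∞) • volume.restrict U)
    (hr : 1 ≤ r) (hrp : r ≤ p₀) (hp : p₀ ≤ p) :
    CompBoundedLp U V Φ p r (c₀ * (c₁ * c₀)) := by
  intro v hv
  have hp₀ : 1 ≤ p₀ := by exact_mod_cast hr.trans hrp
  have hm := aestronglyMeasurable_comp_of_map_le (hΦ.aemeasurable hVm) hmap hv.1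
  have hle : eLpNorm (v ∘ Φ) r (volume.restrict V)
      ≤ (c₀ * (c₁ * c₀) : ℝ≥0) * eLpNorm v p (volume.restrict U) := by
    refine (eLpNorm_le_mul_of_exponent_le hc₀ (by simpa using hV0) hr hrp hm).trans ?_
    rw [ENNReal.coe_mul, mul_assoc]
    gcongr
    exact eLpNorm_comp_le_exponents hVm hΦ hc₀ hc₁ hU0 hmap hp₀ hp hv.1
  exact ⟨⟨hm, hle.trans_lt (ENNReal.mul_lt_top ENNReal.coe_lt_top hv.2)⟩, hle⟩

/-- The weak derivatives of the composition are the sums of (∂ⱼv ∘ Φ) times components of D, so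
Hölder's inequality with exponents p₀ and q gives the bound. The factor d counts the directions of
differentiation, each being estimated by the sum over all ∂ⱼv. -/
theorem HasApproxDeriv.compBoundedSobolev (hU : IsOpen U) (hV : IsOpen V)
    {D : Euc d → Euc d →L[ℝ] Euc d} (hΦ : HasApproxDeriv V Φ D) (hΦU : MapsTo Φ V U)
    (hc₀ : 1 ≤ c₀) (hc₁ : 1 ≤ c₁) (hU0 : volume U ≤ c₀) (hV0 : volume V ≤ c₀)
    (hmap : (volume.restrict V).map Φ ≤ (c₁ : ℝ≥0∞) • volume.restrict U)
    (hr : 1 ≤ r) (hrp : r ≤ p₀) (hp : p₀ ≤ p) {q : ℝ≥0∞} [ENNReal.HolderTriple p₀ q r]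
    {c₂ : ℝ≥0} (hDm : AEStronglyMeasurable D (volume.restrict V))
    (hD : eLpNorm D q (volume.restrict V) ≤ c₂) :
    CompBoundedSobolev U V Φ p r (c₀ * (c₁ * c₀) + d * (c₂ * (c₁ * c₀))) := by
  have hp₀ : 1 ≤ p₀ := by exact_mod_cast hr.trans hrp
  have hp1 : (1 : ℝ≥0∞) ≤ p₀ := by exact_mod_cast hp₀
  have hVm := hV.measurableSet
  have hΦm : AEMeasurable Φ (volume.restrict V) := hΦ.continuousOn.aemeasurable hVm
  have : IsFiniteMeasure (volume.restrict V) :=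
    ⟨by simpa using hV0.trans_lt ENNReal.coe_lt_top⟩
  have : IsFiniteMeasure (volume.restrict U) :=
    ⟨by simpa using hU0.trans_lt ENNReal.coe_lt_top⟩
  have hDq : MemLp D q (volume.restrict V) := ⟨hDm, hD.trans_lt ENNReal.coe_lt_top⟩
  set C : ℝ≥0 := c₀ * (c₁ * c₀) + d * (c₂ * (c₁ * c₀)) with hC
  have hC1 : 1 ≤ C := (one_le_mul hc₀ (one_le_mul hc₁ hc₀)).trans le_self_add
  have hLp := compBoundedLp_of_map_le hVm hΦ.continuousOn hc₀ hc₁ hU0 hV0 hmap hr hrp hp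
  -- the chain rule for one jet
  have key : ∀ {v : Euc d → ℝ} {g : (j : ℕ) → (Fin j → Fin d) → Euc d → ℝ},
      MemLp v p (volume.restrict U) → IsWeakJet U 1 v g →
      (∀ j ≤ 1, ∀ α : Fin j → Fin d, MemLp (g j α) p (volume.restrict U)) →
      ∃ g' : (j : ℕ) → (Fin j → Fin d) → Euc d → ℝ, IsWeakJet V 1 (v ∘ Φ) g' ∧
        (∀ j ≤ 1, ∀ α : Fin j → Fin d, MemLp (g' j α) r (volume.restrict V)) ∧
        ∑ j ∈ Finset.range 2, ∑ α : Fin j → Fin d, eLpNorm (g' j α) r (volume.restrict V) ≤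
          C * ∑ j ∈ Finset.range 2, ∑ α : Fin j → Fin d,
            eLpNorm (g j α) p (volume.restrict U) := by
    intro v g hv hg hgp
    let γ : Fin d → Euc d → ℝ := fun i => g 1 (fun _ => i)
    have hγ : ∀ i, MemLp (γ i) p (volume.restrict U) := fun i => hgp 1 le_rfl _
    have hγ₀ : ∀ i, MemLp (γ i) p₀ (volume.restrict U) := fun i => (hγ i).mono_exponent hp
    have hcomp₀ : ∀ i, MemLp (γ i ∘ Φ) p₀ (volume.restrict V) := fun i =>
      ⟨aestronglyMeasurable_comp_of_map_le hΦm hmap (hγ i).1,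
        (eLpNorm_comp_le_of_map_le hΦm hc₁ hmap hp₀ (hγ i).1).trans_lt
          (ENNReal.mul_lt_top ENNReal.coe_lt_top (hγ₀ i).2)⟩
    have hDe : ∀ i j : Fin d, MemLp (fun x => D x (axis i) j) q (volume.restrict V) ∧
        eLpNorm (fun x => D x (axis i) j) q (volume.restrict V) ≤ c₂ := by
      intro i j
      refine ⟨((EuclideanSpace.proj j : Euc d →L[ℝ] ℝ).comp
        (ContinuousLinearMap.apply ℝ (Euc d) (axis i))).comp_memLp' hDq,
        (eLpNorm_mono fun x => ?_).trans hD⟩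
      calc ‖D x (axis i) j‖ ≤ ‖D x (axis i)‖ := PiLp.norm_apply_le _ _
        _ ≤ ‖D x‖ * ‖(axis i : Euc d)‖ := ContinuousLinearMap.le_opNorm _ _
        _ = ‖D x‖ := by simp
    let γ' : Fin d → Euc d → ℝ := fun i x => ∑ j, γ j (Φ x) * D x (axis i) j
    have hterm : ∀ i j, MemLp (fun x => γ j (Φ x) * D x (axis i) j) r (volume.restrict V) :=
      fun i j => memLp_mul_of_holder (hcomp₀ j) (hDe i j).1
    have hγ' : ∀ i, MemLp (γ' i) r (volume.restrict V) := fun i =>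
      memLp_finsetSum _ fun j _ => hterm i j
    have hγ'le : ∀ i, eLpNorm (γ' i) r (volume.restrict V) ≤
        (c₂ * (c₁ * c₀) : ℝ≥0) * ∑ j, eLpNorm (γ j) p (volume.restrict U) := by
      intro i
      have heq : γ' i = ∑ j, fun x => γ j (Φ x) * D x (axis i) j := by
        ext x; simp [γ']
      rw [heq, Finset.mul_sum]
      refine (eLpNorm_sum_le (fun j _ => (hterm i j).1) hr).trans
        (Finset.sum_le_sum fun j _ => ?_)
      calc eLpNorm (fun x => γ j (Φ x) * D x (axis i) j) r (volume.restrict V)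
          ≤ eLpNorm (γ j ∘ Φ) p₀ (volume.restrict V) *
            eLpNorm (fun x => D x (axis i) j) q (volume.restrict V) :=
            eLpNorm_mul_le_of_holder (hcomp₀ j).1 (hDe i j).1.1
        _ ≤ ((c₁ * c₀ : ℝ≥0) * eLpNorm (γ j) p (volume.restrict U)) * c₂ := by
            exact mul_le_mul' (eLpNorm_comp_le_exponents hVm hΦ.continuousOn hc₀ hc₁ hU0 hmap hp₀
              hp (hγ j).1) (hDe i j).2
        _ = _ := by
            rw [ENNReal.coe_mul c₂]; ring
    have hloc : ∀ {u : Euc d → ℝ}, MemLp u r (volume.restrict V) →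
        LocallyIntegrableOn u V volume := fun hu =>
      IntegrableOn.locallyIntegrableOn (hu.integrable hr)
    have hvΦ := hloc (hLp v hv).1
    -- The jet transported by the chain rule; the orders above 1 are never consulted.
    let g' : (j : ℕ) → (Fin j → Fin d) → Euc d → ℝ := fun j => match j with
      | 0 => fun α => g 0 α ∘ Φ
      | 1 => fun α => γ' (α 0)
      | _ => fun _ => 0
    have hg'0 : ∀ α : Fin 0 → Fin d, MemLp (g' 0 α) r (volume.restrict V) ∧
        eLpNorm (g' 0 α) r (volume.restrict V) ≤
          (c₀ * (c₁ * c₀) : ℝ≥0) * eLpNorm (g 0 α) p (volume.restrict U) := fun α =>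
      hLp _ (hgp 0 zero_le_one α)
    refine ⟨g', ?_, ?_, ?_⟩
    · intro j hj α
      interval_cases j
      -- The order-zero component equals v off a null set of U, and the image measure bound makes
      -- the preimage of that set null in V.
      · have hae : v ∘ Φ =ᵐ[volume.restrict V] g' 0 α := by
          have h1 := (hg 0 zero_le_one α).ae_eq_of_zero hU
          have h2 := (Measure.absolutelyContinuous_of_le_smul hmap).ae_le h1
          exact ae_of_ae_map hΦm h2
        refine ⟨hvΦ, hloc (hg'0 α).1, fun φ hφ _ _ => ?_⟩
        simp only [iteratedFDeriv_zero_apply, pow_zero, one_mul]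
        refine integral_congr_ae ?_
        filter_upwards [hae] with x hx
        rw [hx]
      · rw [isWeakDeriv_one_iff]
        refine ⟨hvΦ, hloc (hγ' _), fun φ hφ hφc hφV => ?_⟩
        refine hΦ.integral_comp_sobolev (p := p₀) (q := q) (r := r) hU hV hΦU hc₁ hmap hp₀ hr hDq
          (fun i => ?_) (hv.mono_exponent hp) hγ₀ hφ hφc hφV (axis (α 0))
        exact isWeakDeriv_one_iff.1 (hg 1 le_rfl (fun _ => i))
    · intro j hj α
      interval_cases j
      · exact (hg'0 α).1
      · exact hγ' _
    · simp only [Finset.sum_range_succ, Finset.sum_range_zero, zero_add, sum_fin_one_fun]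
      set S₀ := ∑ α : Fin 0 → Fin d, eLpNorm (g 0 α) p (volume.restrict U)
      set S₁ := ∑ i, eLpNorm (g 1 fun _ => i) p (volume.restrict U)
      have hS0 : ∑ α : Fin 0 → Fin d, eLpNorm (g' 0 α) r (volume.restrict V) ≤
          (c₀ * (c₁ * c₀) : ℝ≥0) * S₀ := by
        rw [Finset.mul_sum]
        exact Finset.sum_le_sum fun α _ => (hg'0 α).2
      have hS1 : ∑ i, eLpNorm (g' 1 fun _ => i) r (volume.restrict V) ≤
          (d * (c₂ * (c₁ * c₀)) : ℝ≥0) * S₁ := by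
        refine (Finset.sum_le_sum fun i _ => hγ'le i).trans ?_
        rw [Finset.sum_const, Finset.card_univ, Fintype.card_fin, nsmul_eq_mul, ← mul_assoc,
          ENNReal.coe_mul (d : ℝ≥0)]
        simp [S₁]
      calc _ ≤ (c₀ * (c₁ * c₀) : ℝ≥0) * S₀ + (d * (c₂ * (c₁ * c₀)) : ℝ≥0) * S₁ :=
            add_le_add hS0 hS1
        _ ≤ C * S₀ + C * S₁ := by
            gcongr
            · exact le_self_add
            · exact le_add_self
        _ = C * (S₀ + S₁) := (mul_add _ _ _).symm
  intro v hv
  refine ⟨?_, ?_⟩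
  · obtain ⟨g, hg, hgp⟩ := hv.2
    obtain ⟨g', hg', hgr, -⟩ := key hv.1 hg hgp
    exact ⟨(hLp v hv.1).1, g', hg', hgr⟩
  · have hC0 : (C : ℝ≥0∞) ≠ 0 := by
      have : C ≠ 0 := (one_pos.trans_le hC1).ne'
      exact_mod_cast this
    simp only [sobolevNorm, ENNReal.mul_iInf_of_ne hC0 ENNReal.coe_ne_top]
    refine le_iInf₂ fun g hg => ?_
    by_cases hgp : ∀ j ≤ 1, ∀ α : Fin j → Fin d, MemLp (g j α) p (volume.restrict U)
    · obtain ⟨g', hg', -, hle⟩ := key hv.1 hg hgp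
      exact (iInf₂_le g' hg').trans hle
    · push Not at hgp
      obtain ⟨j, hj, α, hα⟩ := hgp
      have htop : eLpNorm (g j α) p (volume.restrict U) = ⊤ := by
        by_contra hne
        exact hα ⟨(hg j hj α).2.1.aestronglyMeasurable, lt_top_iff_ne_top.2 hne⟩
      have : ∑ j ∈ Finset.range (1 + 1), ∑ α : Fin j → Fin d,
          eLpNorm (g j α) p (volume.restrict U) = ⊤ := by
        refine ENNReal.sum_eq_top.2 ⟨j, Finset.mem_range.2 (by omega), ?_⟩
        exact ENNReal.sum_eq_top.2 ⟨α, Finset.mem_univ _, htop⟩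
      rw [this, ENNReal.mul_top hC0]
      exact le_top

end CompBounded

/-! ### Compactly supported functions in `W^{2,2}` of a planar domain -/

section Planar

variable {d : ℕ}

lemma exists_smooth_cutoff {K U : Set (Euc d)} (hK : IsCompact K) (hU : IsOpen U) (hKU : K ⊆ U) :
    ∃ χ : Euc d → ℝ, ContDiff ℝ ∞ χ ∧ (∀ᶠ x in 𝓝ˢ K, χ x = 1) ∧ (∀ x, χ x ∈ Icc 0 1) ∧
      HasCompactSupport χ ∧ tsupport χ ⊆ U := by
  obtain ⟨δ, hδ, hδU⟩ := hK.exists_cthickening_subset_open hU hKU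
  have hKc : IsCompact (Metric.cthickening δ K) := hK.cthickening
  have hint : K ⊆ interior (Metric.cthickening δ K) :=
    (Metric.self_subset_thickening hδ K).trans
      (interior_maximal (Metric.thickening_subset_cthickening δ K) Metric.isOpen_thickening)
  obtain ⟨f, h1, h0, h01⟩ := exists_contMDiffMap_one_nhds_of_subset_interior (n := (⊤ : ℕ∞))
    (modelWithCornersSelf ℝ (Euc d)) hK.isClosed hint
  have hts : tsupport (f : Euc d → ℝ) ⊆ Metric.cthickening δ K :=
    closure_minimal (fun x hx => by
      by_contra hcon
      exact hx (h0 x hcon)) hKc.isClosed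
  exact ⟨f, f.contMDiff.contDiff, h1, h01, hKc.of_isClosed_subset (isClosed_tsupport _) hts,
    hts.trans hδU⟩

lemma continuous_indicator_of_support {U K : Set (Euc d)} (hU : IsOpen U) (hK : IsCompact K)
    (hKU : K ⊆ U) {v : Euc d → ℝ} (hv : ContinuousOn v U) (hv0 : ∀ x ∈ U \ K, v x = 0) :
    Continuous (U.indicator v) ∧ ∀ x ∉ K, U.indicator v x = 0 := by
  have h0 : ∀ x ∉ K, U.indicator v x = 0 := by
    intro x hx
    by_cases hxU : x ∈ U
    · rw [indicator_of_mem hxU, hv0 x ⟨hxU, hx⟩]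
    · exact indicator_of_notMem hxU _
  refine ⟨continuous_iff_continuousAt.2 fun x => ?_, h0⟩
  by_cases hx : x ∈ K
  · have hxU := hU.mem_nhds (hKU hx)
    refine (hv.continuousAt hxU).congr ?_
    filter_upwards [hxU] with y hy
    rw [indicator_of_mem hy]
  · refine (continuousAt_const (y := (0 : ℝ))).congr ?_
    filter_upwards [hK.isClosed.isOpen_compl.mem_nhds hx] with y hy
    exact (h0 y hy).symm

lemma ae_tendsto_mollify {w : Euc d → ℝ} (hw : LocallyIntegrable w volume) :
    ∀ᵐ x, Tendsto (fun n => mollify n w x) atTop (𝓝 (w x)) := by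
  refine ContDiffBump.ae_convolution_tendsto_right_of_locallyIntegrable (K := 2)
    bumpSeq_rOut_tendsto (Eventually.of_forall fun n => ?_) hw
  change ((n : ℝ) + 1)⁻¹ ≤ 2 * (((n : ℝ) + 1)⁻¹ / 2)
  linarith

lemma mollify_support_subset {K : Set (Euc d)} {w : Euc d → ℝ} (hw : ∀ x ∉ K, w x = 0) {n : ℕ}
    {δ : ℝ} (hn : (bumpSeq d n).rOut ≤ δ) : ∀ x ∉ Metric.cthickening δ K, mollify n w x = 0 := by
  intro x hx
  refine mollify_eq_zero n fun y hy => hw y fun hyK => hx ?_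
  refine Metric.mem_cthickening_of_dist_le x y δ K hyK ?_
  rw [dist_comm]
  exact (Metric.mem_closedBall.1 hy).trans hn

lemma norm_clm_le_sum (L : Euc d →L[ℝ] ℝ) : ‖L‖ ≤ ∑ j, ‖L (axis j)‖ := by
  refine L.opNorm_le_bound (Finset.sum_nonneg fun _ _ => norm_nonneg _) fun u => ?_
  rw [clm_apply_eq_sum, Finset.sum_mul]
  refine (norm_sum_le _ _).trans (Finset.sum_le_sum fun j _ => ?_)
  rw [norm_mul]
  gcongr
  exact PiLp.norm_apply_le _ _

/-- The covector field with the given components. -/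
noncomputable def covector (g : Fin d → Euc d → ℝ) (x : Euc d) : Euc d →L[ℝ] ℝ :=
  ∑ i, g i x • (EuclideanSpace.proj i : Euc d →L[ℝ] ℝ)

lemma covector_axis (g : Fin d → Euc d → ℝ) (x : Euc d) (i : Fin d) :
    covector g x (axis i) = g i x := by
  simp [covector]

lemma eLpNorm_clm_le_sum {F : Euc d → Euc d →L[ℝ] ℝ} {μ : Measure (Euc d)} {p : ℝ≥0∞}
    (hp : 1 ≤ p) (hF : ∀ i, AEStronglyMeasurable (fun x => F x (axis i)) μ) :
    eLpNorm F p μ ≤ ∑ i, eLpNorm (fun x => F x (axis i)) p μ := by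
  have h1 : eLpNorm F p μ ≤ eLpNorm (∑ i, fun x => ‖F x (axis i)‖) p μ := by
    refine eLpNorm_mono fun x => ?_
    refine (norm_clm_le_sum (F x)).trans ?_
    rw [Finset.sum_apply]
    exact le_abs_self _
  refine h1.trans ((eLpNorm_sum_le (fun i _ => (hF i).norm) hp).trans_eq ?_)
  simp only [eLpNorm_norm]

lemma covector_aestronglyMeasurable {g : Fin d → Euc d → ℝ} {μ : Measure (Euc d)}
    (hg : ∀ i, AEStronglyMeasurable (g i) μ) : AEStronglyMeasurable (covector g) μ := by
  have : covector g = ∑ i, fun x => g i x • (EuclideanSpace.proj i : Euc d →L[ℝ] ℝ) := by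
    ext1 x; simp [covector]
  rw [this]
  exact Finset.aestronglyMeasurable_sum _ fun i _ => (hg i).smul_const _

/-- A compactly supported function with two weak derivatives extends by zero to the whole space,
together with its derivatives. -/
lemma exists_weakPartial_extension {U K : Set (Euc d)} (hU : IsOpen U) (hK : IsCompact K)
    (hKU : K ⊆ U) {v : Euc d → ℝ} (hv : ContinuousOn v U) (hv0 : ∀ x ∈ U \ K, v x = 0)
    {χ : Euc d → ℝ} (hχ : ContDiff ℝ ∞ χ) (hχK : ∀ᶠ x in 𝓝ˢ K, χ x = 1)
    (hχc : HasCompactSupport χ) (hχU : tsupport χ ⊆ U)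
    {g : (j : ℕ) → (Fin j → Fin d) → Euc d → ℝ} (hg : IsWeakJet U 2 v g) :
    (∀ i, HasWeakPartial univ i (U.indicator v)
      (U.indicator fun x => χ x * g 1 (fun _ => i) x)) ∧
    ∀ i j, HasWeakPartial univ j (U.indicator fun x => χ x * g 1 (fun _ => i) x)
      (U.indicator fun x => χ x * g 2 ![i, j] x) := by
  obtain ⟨hvc, hv0'⟩ := continuous_indicator_of_support hU hK hKU hv hv0
  have hχint : ∀ {u : Euc d → ℝ}, LocallyIntegrableOn u U volume →
      LocallyIntegrableOn (U.indicator fun x => χ x * u x) univ volume := by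
    intro u hu
    refine IntegrableOn.locallyIntegrableOn ?_
    rw [integrableOn_univ, integrable_indicator_iff hU.measurableSet]
    have h1 : IntegrableOn (fun x => χ x * u x) (tsupport χ) volume :=
      (hu.integrableOn_compact_subset hχU hχc.isCompact).continuousOn_mul
        hχ.continuous.continuousOn hχc.isCompact
    rw [integrableOn_iff_integrable_of_support_subset] at h1
    · exact h1.integrableOn
    · exact fun x hx => subset_tsupport _ (left_ne_zero_of_mul hx)
  have hprod : ∀ {φ : Euc d → ℝ}, ContDiff ℝ ∞ φ → ContDiff ℝ ∞ (fun x => χ x * φ x) ∧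
      HasCompactSupport (fun x => χ x * φ x) ∧ tsupport (fun x => χ x * φ x) ⊆ U := fun hφ =>
    ⟨hχ.mul hφ, hχc.mul_right, (tsupport_mul_subset_left).trans hχU⟩
  have hmulR : ∀ (u φ : Euc d → ℝ), ∫ x, U.indicator (fun x => χ x * u x) x * φ x
      = ∫ x in U, u x * (χ x * φ x) := by
    intro u φ
    rw [← integral_indicator hU.measurableSet]
    refine integral_congr_ae (Eventually.of_forall fun x => ?_)
    by_cases hx : x ∈ U
    · simp only [indicator_of_mem hx]; ring
    · simp [hx]
  have hnear : ∀ (φ : Euc d → ℝ), ∀ x ∈ K, (fun y => χ y * φ y) =ᶠ[𝓝 x] φ := by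
    intro φ x hx
    filter_upwards [(eventually_nhdsSet_iff_forall.1 hχK) x hx] with y hy
    rw [hy, one_mul]
  have hmulL : ∀ (ψ ψ' : Euc d → ℝ), (∀ x ∈ K, ψ x = ψ' x) →
      ∫ x, U.indicator v x * ψ x = ∫ x in U, v x * ψ' x := by
    intro ψ ψ' h
    rw [← integral_indicator hU.measurableSet]
    refine integral_congr_ae (Eventually.of_forall fun x => ?_)
    by_cases hx : x ∈ K
    · simp only [indicator_of_mem (hKU hx), h x hx]
    · have h1 : U.indicator (fun x => v x * ψ' x) x = U.indicator v x * ψ' x := by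
        by_cases hxU : x ∈ U <;> simp [hxU]
      simp only [h1, hv0' x hx, zero_mul]
  have hfirst : ∀ i, HasWeakPartial univ i (U.indicator v)
      (U.indicator fun x => χ x * g 1 (fun _ => i) x) := by
    intro i
    refine ⟨hvc.locallyIntegrable.locallyIntegrableOn _,
      hχint (hg 1 one_le_two fun _ => i).2.1, fun φ hφ hφc _ => ?_⟩
    obtain ⟨h1, h2, h3⟩ := hprod hφ
    rw [setIntegral_univ, setIntegral_univ, hmulR,
      hmulL _ (fun x => fderiv ℝ (fun y => χ y * φ y) x (axis i))
        (fun x hx => by rw [(hnear φ x hx).fderiv_eq])]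
    exact (isWeakDeriv_one_iff.1 (hg 1 one_le_two fun _ => i)).2.2 _ h1 h2 h3
  refine ⟨hfirst, fun i j => ⟨(hfirst i).2.1, hχint (hg 2 le_rfl ![i, j]).2.1,
    fun φ hφ hφc _ => ?_⟩⟩
  -- The second-order identity concerns v, not its first derivative. Testing the first-order
  -- identity with ∂ⱼφ turns the claim into one about v; there χ may be inserted in front of φ, as
  -- it is 1 near K and v vanishes on U off K.
  have hφ' : ContDiff ℝ ∞ (fun x => fderiv ℝ φ x (axis j)) :=
    (hφ.fderiv_right (m := ∞) (by simp)).clm_apply contDiff_const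
  have hstep := (hfirst i).2.2 _ hφ' (hφc.fderiv_apply ℝ _) (subset_univ _)
  obtain ⟨h1, h2, h3⟩ := hprod hφ
  have h4 := (hg 2 le_rfl ![i, j]).2.2 _ h1 h2 h3
  rw [setIntegral_univ] at hstep ⊢
  rw [setIntegral_univ] at hstep ⊢
  have hsnd : ∀ {φ : Euc d → ℝ}, ContDiff ℝ ∞ φ → ∀ x,
      iteratedFDeriv ℝ 2 φ x (fun k => EuclideanSpace.single (![i, j] k) 1)
        = fderiv ℝ (fun y => fderiv ℝ φ y (axis j)) x (axis i) := by
    intro φ hφ x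
    rw [iteratedFDeriv_two_apply]
    have hd : DifferentiableAt ℝ (fderiv ℝ φ) x :=
      ((hφ.fderiv_right (m := ∞) (by simp)).differentiable (by simp)) x
    rw [fderiv_clm_apply hd (differentiableAt_const _)]
    simp
  rw [← neg_eq_iff_eq_neg.2 hstep, hmulR]
  rw [hmulL _ (fun x => fderiv ℝ (fun y => fderiv ℝ (fun z => χ z * φ z) y (axis j)) x (axis i))]
  · simp only [hsnd h1] at h4
    rw [h4]; simp
  · intro x hx
    have : (fun y => fderiv ℝ (fun z => χ z * φ z) y (axis j)) =ᶠ[𝓝 x]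
        fun y => fderiv ℝ φ y (axis j) := by
      filter_upwards [(hnear φ x hx).fderiv (𝕜 := ℝ)] with y hy
      rw [hy]
    rw [this.fderiv_eq]

end Planar

/-! ### The planar Sobolev embedding and smooth approximation -/

section Planar

lemma eLpNorm_indicator_cutoff_le {d : ℕ} {U : Set (Euc d)} (hU : IsOpen U) {χ u : Euc d → ℝ}
    (hχ : ∀ x, χ x ∈ Icc 0 1) (p : ℝ≥0∞) :
    eLpNorm (U.indicator fun x => χ x * u x) p volume ≤ eLpNorm u p (volume.restrict U) := by
  rw [eLpNorm_indicator_eq_eLpNorm_restrict hU.measurableSet]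
  refine eLpNorm_mono fun x => ?_
  rw [norm_mul, Real.norm_of_nonneg (hχ x).1]
  exact mul_le_of_le_one_left (norm_nonneg _) (hχ x).2

lemma eLpNorm_restrict_of_eq_zero {X E : Type*} [MeasurableSpace X] [NormedAddCommGroup E]
    {μ : Measure X} {f : X → E} {s : Set X} (h : ∀ x ∉ s, f x = 0) (p : ℝ≥0∞) :
    eLpNorm f p (μ.restrict s) = eLpNorm f p μ :=
  eLpNorm_restrict_eq_of_support_subset fun x hx => by
    by_contra hc
    exact hx (h x hc)

/-- The Gagliardo-Nirenberg-Sobolev inequality in the plane, for a finite exponent `q ≥ 2`. -/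
lemma exists_eLpNorm_le_planar {K' : Set (Euc 2)} (hK' : IsCompact K') {q : ℝ≥0} (hq : 2 ≤ q) :
    ∃ C : ℝ≥0, ∀ u : Euc 2 → ℝ, ContDiff ℝ ∞ u → (∀ x ∉ K', u x = 0) →
      eLpNorm u q volume ≤ C * ∑ j, eLpNorm (fun x => fderiv ℝ u x (axis j)) 2 volume := by
  have hq0 : 0 < q := lt_of_lt_of_le (by norm_num) hq
  -- The exponent with 1/t = 1/q + 1/2, so that q is its Sobolev conjugate in dimension 2. It lies
  -- in [1, 2) because 2 ≤ q < ∞, and the L^t norm on the bounded set K' is controlled by the L²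
  -- norm.
  set t : ℝ≥0 := 2 * q / (q + 2) with ht
  have ht1 : 1 ≤ t := by
    rw [ht, one_le_div (by positivity), two_mul]; gcongr
  have ht2 : t < 2 := by
    rw [ht, div_lt_iff₀ (by positivity), mul_add]
    exact lt_add_of_pos_right _ (by norm_num)
  have htq : (t : ℝ)⁻¹ - ((Module.finrank ℝ (Euc 2) : ℕ) : ℝ)⁻¹ ≤ (q : ℝ)⁻¹ := by
    have hq' : (0 : ℝ) < q := by exact_mod_cast hq0
    rw [finrank_euclideanSpace_fin, ht]
    push_cast
    apply le_of_eq
    field_simp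
    ring
  set c₀ : ℝ≥0 := max 1 (volume K').toNNReal
  have hc₀ : (1 : ℝ≥0) ≤ c₀ := le_max_left _ _
  have hc₀' : (volume.restrict K') univ ≤ c₀ := by
    rw [Measure.restrict_apply_univ, ← ENNReal.coe_toNNReal hK'.measure_lt_top.ne]
    exact_mod_cast le_max_right _ _
  set Cg : ℝ≥0 := eLpNormLESNormFDerivOfLeConst ℝ (volume : Measure (Euc 2)) K' t q
  refine ⟨Cg * c₀, fun u hu husupp => ?_⟩
  have hcu' : Continuous (fderiv ℝ u) := hu.continuous_fderiv (by simp)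
  have h1 : eLpNorm u q volume ≤ Cg * eLpNorm (fderiv ℝ u) t volume := by
    refine eLpNorm_le_eLpNorm_fderiv_of_le volume (hu.of_le (by simp)) (fun x hx => ?_) ht1 ?_
      htq hK'.isBounded
    · by_contra hcon; exact hx (husupp x hcon)
    · rw [finrank_euclideanSpace_fin]; exact_mod_cast ht2
  have hsub : ∀ x ∉ K', fderiv ℝ u x = 0 := fun x hx => by
    by_contra hne
    refine hx ((support_fderiv_subset ℝ).trans (closure_minimal (fun y hy => ?_) hK'.isClosed)
      hne)
    by_contra hcon; exact hy (husupp y hcon)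
  have h2 : eLpNorm (fderiv ℝ u) t volume ≤ c₀ * eLpNorm (fderiv ℝ u) 2 volume := by
    have hsub' : ∀ x ∉ K', ‖fderiv ℝ u x‖ = 0 := fun x hx => by rw [hsub x hx, norm_zero]
    have key : eLpNorm (fun x => ‖fderiv ℝ u x‖) t (volume.restrict K')
        ≤ c₀ * eLpNorm (fun x => ‖fderiv ℝ u x‖) 2 (volume.restrict K') :=
      eLpNorm_le_mul_of_exponent_le hc₀ hc₀' (by exact_mod_cast ht1)
        (by exact_mod_cast ht2.le) hcu'.norm.aestronglyMeasurable
    rw [eLpNorm_restrict_of_eq_zero hsub', eLpNorm_restrict_of_eq_zero hsub'] at key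
    simpa only [eLpNorm_norm] using key
  have h3 : eLpNorm (fderiv ℝ u) 2 volume ≤
      ∑ j, eLpNorm (fun x => fderiv ℝ u x (axis j)) 2 volume :=
    eLpNorm_clm_le_sum one_le_two fun j =>
      (hcu'.clm_apply continuous_const).aestronglyMeasurable
  rw [ENNReal.coe_mul, mul_assoc]
  exact h1.trans (mul_le_mul_right (h2.trans (mul_le_mul_right h3 _)) _)

/-- The Sobolev embedding `W^{2,2} ⊆ W^{1,q}` in the plane, for functions supported in a fixed
compact set, with approximation by smooth functions. -/
theorem exists_planar_approx {U K : Set (Euc 2)} (hU : IsOpen U) (hK : IsCompact K) (hKU : K ⊆ U)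
    {q : ℝ≥0} (hq : 2 ≤ q) :
    ∃ C : ℝ≥0, ∃ K' : Set (Euc 2), IsCompact K' ∧ K' ⊆ U ∧ ∀ v : Euc 2 → ℝ, ContinuousOn v U →
      (∀ x ∈ U \ K, v x = 0) → ∀ M : ℝ≥0, sobolevNorm U 2 2 v ≤ M →
      ∃ (fn : ℕ → Euc 2 → ℝ) (G : Euc 2 → Euc 2 →L[ℝ] ℝ), (∀ n, ContDiff ℝ ∞ (fn n)) ∧
        (∀ n, ∀ x ∉ K', fn n x = 0) ∧ TendstoUniformly fn (U.indicator v) atTop ∧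
        AEStronglyMeasurable G volume ∧ (∀ x ∉ K', G x = 0) ∧
        eLpNorm G q volume ≤ C * (M + 1) ∧
        Tendsto (fun n => eLpNorm (fun x => fderiv ℝ (fn n) x - G x) 2 volume) atTop (𝓝 0) := by
  obtain ⟨χ, hχ, hχK, hχ01, hχc, hχU⟩ := exists_smooth_cutoff hK hU hKU
  set K₁ := tsupport χ
  have hK₁ : IsCompact K₁ := hχc.isCompact
  have hKK₁ : K ⊆ K₁ := fun x hx => by
    have : χ x = 1 := (eventually_nhdsSet_iff_forall.1 hχK x hx).self_of_nhds
    exact subset_tsupport _ (by simp [this])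
  obtain ⟨δ, hδ, hδU⟩ := hK₁.exists_cthickening_subset_open hU hχU
  set K' := Metric.cthickening δ K₁
  have hK' : IsCompact K' := hK₁.cthickening
  have hK₁K' : K₁ ⊆ K' := Metric.self_subset_cthickening _
  -- From the index N on, mollification enlarges supports by at most δ and so keeps them in K'; the
  -- sequences below are shifted by N.
  obtain ⟨N, hN⟩ := eventually_atTop.1 ((bumpSeq_rOut_tendsto (d := 2)).eventually_le_const hδ)
  obtain ⟨Cg, hCg⟩ := exists_eLpNorm_le_planar hK' hq
  -- One factor 2 counts the components of the gradient, the other the second derivatives that bound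
  -- each of them.
  refine ⟨2 * (Cg * 2), K', hK', hδU, fun v hv hv0 M hM => ?_⟩
  -- a jet of controlled norm
  obtain ⟨g, hg, hgM⟩ : ∃ g : (j : ℕ) → (Fin j → Fin 2) → Euc 2 → ℝ, IsWeakJet U 2 v g ∧
      ∀ j ≤ 2, ∀ α : Fin j → Fin 2, eLpNorm (g j α) 2 (volume.restrict U) ≤ M + 1 := by
    -- The norm is defined as an infimum over jets; the slack 1 provides a jet below the bound, also
    -- when M = 0.
    have hlt : sobolevNorm U 2 2 v < M + 1 :=
      hM.trans_lt (ENNReal.lt_add_right ENNReal.coe_ne_top one_ne_zero)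
    simp only [sobolevNorm, iInf_lt_iff] at hlt
    obtain ⟨g, hg, hlt⟩ := hlt
    refine ⟨g, hg, fun j hj α => le_trans ?_ hlt.le⟩
    refine le_trans ?_ (Finset.single_le_sum
      (f := fun j => ∑ α : Fin j → Fin 2, eLpNorm (g j α) 2 (volume.restrict U))
      (fun _ _ => zero_le) (Finset.mem_range.2 (Nat.lt_succ_of_le hj)))
    exact Finset.single_le_sum (f := fun α => eLpNorm (g j α) 2 (volume.restrict U))
      (fun _ _ => zero_le) (Finset.mem_univ α)
  obtain ⟨hw1, hw2⟩ := exists_weakPartial_extension hU hK hKU hv hv0 hχ hχK hχc hχU hg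
  obtain ⟨hfc, hf0⟩ := continuous_indicator_of_support hU hK hKU hv hv0
  set f := U.indicator v
  set g₁ : Fin 2 → Euc 2 → ℝ := fun i => U.indicator fun x => χ x * g 1 (fun _ => i) x with hg₁
  set g₂ : Fin 2 → Fin 2 → Euc 2 → ℝ := fun i j => U.indicator fun x => χ x * g 2 ![i, j] x
    with hg₂
  have hcut0 : ∀ u : Euc 2 → ℝ, ∀ x ∉ K₁, U.indicator (fun x => χ x * u x) x = 0 := by
    intro u x hx
    have : χ x = 0 := image_eq_zero_of_notMem_tsupport hx
    by_cases hxU : x ∈ U <;> simp [hxU, this]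
  have hg₁M : ∀ i, eLpNorm (g₁ i) 2 volume ≤ M + 1 := fun i =>
    (eLpNorm_indicator_cutoff_le hU hχ01 2).trans (hgM 1 one_le_two _)
  have hg₂M : ∀ i j, eLpNorm (g₂ i j) 2 volume ≤ M + 1 := fun i j =>
    (eLpNorm_indicator_cutoff_le hU hχ01 2).trans (hgM 2 le_rfl _)
  have hfl : LocallyIntegrable f volume := hfc.locallyIntegrable
  have hg₁l : ∀ i, LocallyIntegrable (g₁ i) volume := fun i =>
    locallyIntegrableOn_univ.1 (hw1 i).2.1
  have hg₂l : ∀ i j, LocallyIntegrable (g₂ i j) volume := fun i j =>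
    locallyIntegrableOn_univ.1 (hw2 i j).2.1
  have hd1 : ∀ n i x, fderiv ℝ (mollify n f) x (axis i) = mollify n (g₁ i) x := fun n i x =>
    fderiv_mollify_eq isOpen_univ (hw1 i) hfl (subset_univ _) (fun _ _ => rfl) fun _ _ => rfl
  have hd2 : ∀ n i j x, fderiv ℝ (mollify n (g₁ i)) x (axis j) = mollify n (g₂ i j) x :=
    fun n i j x => fderiv_mollify_eq isOpen_univ (hw2 i j) (hg₁l i) (subset_univ _)
      (fun _ _ => rfl) fun _ _ => rfl
  have hsupp : ∀ {w : Euc 2 → ℝ}, (∀ x ∉ K₁, w x = 0) → ∀ n, ∀ x ∉ K', mollify (n + N) w x = 0 :=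
    fun hw n => mollify_support_subset hw (hN _ (Nat.le_add_left _ _))
  have hmollify2 : ∀ n i j, eLpNorm (mollify n (g₂ i j)) 2 volume ≤ M + 1 := fun n i j =>
    (eLpNorm_mollify_le (p := 2) n (hg₂l i j).aestronglyMeasurable one_le_two).trans (hg₂M i j)
  -- the embedding for the mollified first derivatives
  have hGNS : ∀ n i, eLpNorm (mollify (n + N) (g₁ i)) q volume ≤ Cg * (2 * (M + 1)) := by
    intro n i
    set u := mollify (n + N) (g₁ i)
    have hu : ContDiff ℝ ∞ u := mollify_contDiff _ (hg₁l i)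
    have husupp : ∀ x ∉ K', u x = 0 := hsupp (hcut0 _) n
    refine (hCg u hu husupp).trans ?_
    simp only [u, hd2]
    refine mul_le_mul_right ((Finset.sum_le_sum fun j _ => hmollify2 _ i j).trans_eq ?_) _
    simp only [Finset.sum_const, Finset.card_univ, Fintype.card_fin]
    ring
  -- Fatou's lemma: the mollified derivatives are bounded in L^q uniformly in n and converge almost
  -- everywhere, so the bound passes to the limit.
  have hlimq : ∀ i, eLpNorm (g₁ i) q volume ≤ Cg * (2 * (M + 1)) := by
    intro i
    refine (Lp.eLpNorm_lim_le_liminf_eLpNorm (f := fun n => mollify (n + N) (g₁ i))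
      (fun n => (mollify_contDiff _ (hg₁l i)).continuous.aestronglyMeasurable) (g₁ i) ?_).trans ?_
    · filter_upwards [ae_tendsto_mollify (hg₁l i)] with x hx
      exact hx.comp (tendsto_add_atTop_nat N)
    · refine liminf_le_of_frequently_le' (Frequently.of_forall fun n => hGNS n i)
  have hGm : AEStronglyMeasurable (covector g₁) volume :=
    covector_aestronglyMeasurable fun i => (hg₁l i).aestronglyMeasurable
  refine ⟨fun n => mollify (n + N) f, covector g₁, fun n => mollify_contDiff _ hfl,
    hsupp fun x hx => hf0 x fun h => hx (hKK₁ h), ?_, hGm, ?_, ?_, ?_⟩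
  · have hunif : UniformContinuous f :=
      (HasCompactSupport.intro hK hf0).uniformContinuous_of_continuous hfc
    intro u hu
    exact (tendsto_add_atTop_nat N).eventually (mollify_uniform hunif u hu)
  · intro x hx
    have : ∀ i, g₁ i x = 0 := fun i => hcut0 _ x fun h => hx (hK₁K' h)
    simp [covector, this]
  · have h1 : (1 : ℝ≥0∞) ≤ q := by exact_mod_cast (one_le_two.trans hq)
    refine (eLpNorm_clm_le_sum h1 fun i => ?_).trans ?_
    · simp only [covector_axis]; exact (hg₁l i).aestronglyMeasurable
    · simp only [covector_axis]
      refine (Finset.sum_le_sum fun i _ => hlimq i).trans_eq ?_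
      simp only [Finset.sum_const, Finset.card_univ, Fintype.card_fin]
      push_cast
      ring
  · have hlim : ∀ i, Tendsto (fun n => eLpNorm (fun x => mollify (n + N) (g₁ i) x - g₁ i x) 2
        volume) atTop (𝓝 0) := by
      intro i
      have hmem : MemLp (g₁ i) (2 : ℝ≥0) volume :=
        ⟨(hg₁l i).aestronglyMeasurable, (hg₁M i).trans_lt (by finiteness)⟩
      exact (tendsto_eLpNorm_mollify_sub one_le_two hmem).comp (tendsto_add_atTop_nat N)
    have hsum := tendsto_finsetSum (Finset.univ : Finset (Fin 2)) fun i _ => hlim i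
    simp only [Finset.sum_const_zero] at hsum
    refine tendsto_of_tendsto_of_tendsto_of_le_of_le tendsto_const_nhds hsum (fun _ => zero_le)
      fun n => ?_
    have hax : ∀ i x, (fderiv ℝ (mollify (n + N) f) x - covector g₁ x) (axis i)
        = mollify (n + N) (g₁ i) x - g₁ i x := fun i x => by
      rw [sub_apply, hd1, covector_axis]
    refine (eLpNorm_clm_le_sum one_le_two fun i => ?_).trans_eq ?_
    · simp only [hax]
      exact (mollify_contDiff _ (hg₁l i)).continuous.aestronglyMeasurable.sub
        (hg₁l i).aestronglyMeasurable
    · simp only [hax]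

end Planar

/-! ### Geometry of the tubular neighbourhood -/

/-- Near f a, a left inverse must coincide with the local inverse from the inverse function theorem,
hence inherits its regularity. It applies to inverses chosen without any regularity, such as the
tubular coordinates and `heightShiftInv`. -/
lemma ContDiffAt.of_eventually_leftInverse {E F : Type*} [NormedAddCommGroup E] [NormedSpace ℝ E]
    [CompleteSpace E] [NormedAddCommGroup F] [NormedSpace ℝ F] {f : E → F} {g : F → E} {a : E}
    {n : ℕ∞ω} (hn : n ≠ 0) (hf : ContDiffAt ℝ n f a) {f' : E ≃L[ℝ] F}
    (hf' : HasFDerivAt f (f' : E →L[ℝ] F) a) (hg : ∀ᶠ x in 𝓝 a, g (f x) = x) :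
    ContDiffAt ℝ n g (f a) :=
  (hf.to_localInverse hf' hn).congr_of_eventuallyEq
    ((hf.hasStrictFDerivAt' hf' hn).localInverse_unique hg)

section Tube

variable {Ω : Set (Euc 3)}

/-- The supremum of an empty or an unbounded set of reals is 0 by convention, so positivity of κ
excludes both. -/
lemma tubular_radii_nonempty_bddAbove (hκ : 0 < tubeRadius Ω) :
    {α : ℝ | 0 < α ∧ IsTubularRadius Ω α}.Nonempty ∧
      BddAbove {α : ℝ | 0 < α ∧ IsTubularRadius Ω α} := by
  constructor
  · by_contra h
    rw [not_nonempty_iff_eq_empty] at h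
    simp [tubeRadius, h] at hκ
  · by_contra h
    simp [tubeRadius, Real.sSup_of_not_bddAbove h] at hκ

/-- This replaces the attainment of the supremum: every statement at finitely many heights below κ
already takes place in a tube of some admissible radius α ≤ κ. -/
lemma exists_tubular_gt (hκ : 0 < tubeRadius Ω) {t : ℝ} (ht : t < tubeRadius Ω) :
    ∃ α, t < α ∧ 0 < α ∧ α ≤ tubeRadius Ω ∧ IsTubularRadius Ω α := by
  obtain ⟨hne, hbdd⟩ := tubular_radii_nonempty_bddAbove hκ
  obtain ⟨α, hα, hlt⟩ := exists_lt_of_lt_csSup hne ht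
  exact ⟨α, hlt, hα.1, le_csSup hbdd hα, hα.2⟩

lemma bijOn_tubeMap (hκ : 0 < tubeRadius Ω) :
    BijOn (tubeMap Ω) (frontier Ω ×ˢ Ioo (-tubeRadius Ω) (tubeRadius Ω))
      (tube Ω (tubeRadius Ω)) := by
  have hmem : ∀ {z : Euc 3 × ℝ} {α : ℝ}, z.1 ∈ frontier Ω → |z.2| < α →
      z ∈ frontier Ω ×ˢ Ioo (-α) α := fun h1 h2 => ⟨h1, abs_lt.1 h2⟩
  refine ⟨fun z hz => ?_, fun z hz z' hz' h => ?_, fun x hx => ?_⟩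
  · obtain ⟨α, h1, -, h2, h3⟩ := exists_tubular_gt hκ (abs_lt.2 hz.2)
    exact Metric.thickening_mono h2 _ (h3.1.mapsTo (hmem hz.1 h1))
  · obtain ⟨α, h1, -, h2, h3⟩ := exists_tubular_gt hκ (max_lt (abs_lt.2 hz.2) (abs_lt.2 hz'.2))
    exact h3.1.injOn (hmem hz.1 ((le_max_left _ _).trans_lt h1))
      (hmem hz'.1 ((le_max_right _ _).trans_lt h1)) h
  · obtain ⟨q, hq, hxq⟩ := Metric.mem_thickening_iff.1 hx
    obtain ⟨α, h1, -, h2, h3⟩ := exists_tubular_gt hκ hxq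
    obtain ⟨z, hz, rfl⟩ := h3.1.surjOn (Metric.mem_thickening_iff.2 ⟨q, hq, h1⟩ : x ∈ tube Ω α)
    exact ⟨z, ⟨hz.1, (neg_le_neg h2).trans_lt hz.2.1, hz.2.2.trans_le h2⟩, rfl⟩

lemma isOpen_tube (α : ℝ) : IsOpen (tube Ω α) := Metric.isOpen_thickening

lemma tubeInv_mem (hκ : 0 < tubeRadius Ω) {x : Euc 3} (hx : x ∈ tube Ω (tubeRadius Ω)) :
    foot Ω x ∈ frontier Ω ∧ tubeHeight Ω x ∈ Ioo (-tubeRadius Ω) (tubeRadius Ω) ∧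
      tubeMap Ω (foot Ω x, tubeHeight Ω x) = x := by
  have h := (bijOn_tubeMap hκ).surjOn hx
  have h1 := Function.invFunOn_mem h
  exact ⟨h1.1, h1.2, Function.invFunOn_eq h⟩

lemma tubeInv_tubeMap (hκ : 0 < tubeRadius Ω) {q : Euc 3} (hq : q ∈ frontier Ω) {t : ℝ}
    (ht : t ∈ Ioo (-tubeRadius Ω) (tubeRadius Ω)) :
    tubeMap Ω (q, t) ∈ tube Ω (tubeRadius Ω) ∧ foot Ω (tubeMap Ω (q, t)) = q ∧
      tubeHeight Ω (tubeMap Ω (q, t)) = t := by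
  have hz : (q, t) ∈ frontier Ω ×ˢ Ioo (-tubeRadius Ω) (tubeRadius Ω) := ⟨hq, ht⟩
  have h := (bijOn_tubeMap hκ).injOn.leftInvOn_invFunOn hz
  refine ⟨(bijOn_tubeMap hκ).mapsTo hz, ?_, ?_⟩
  · exact congrArg Prod.fst h
  · exact congrArg Prod.snd h

lemma eq_foot_add (hκ : 0 < tubeRadius Ω) {x : Euc 3} (hx : x ∈ tube Ω (tubeRadius Ω)) :
    x = foot Ω x + tubeHeight Ω x • outerNormal Ω (foot Ω x) :=
  (tubeInv_mem hκ hx).2.2.symm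

lemma IsC4Domain.isOuterNormal (hΩ : IsC4Domain Ω) {q : Euc 3} (hq : q ∈ frontier Ω) :
    IsOuterNormal Ω q (outerNormal Ω q) := by
  obtain ⟨U, φ, hqU, hφ⟩ := hΩ.boundary q hq
  exact Classical.epsilon_spec (p := IsOuterNormal Ω q) ⟨_, U, φ, hqU, hφ, rfl⟩

lemma IsC4Domain.isCompact_frontier (hΩ : IsC4Domain Ω) : IsCompact (frontier Ω) :=
  Metric.isCompact_of_isClosed_isBounded isClosed_frontier
    (hΩ.isBounded.closure.subset frontier_subset_closure)

/-- Near a boundary point, the normal line is in `Ω` on one side exactly. -/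
lemma IsC4Domain.eventually_normal (hΩ : IsC4Domain Ω) {q : Euc 3} (hq : q ∈ frontier Ω) :
    (∀ᶠ t in 𝓝[<] (0 : ℝ), tubeMap Ω (q, t) ∈ Ω) ∧
      ∀ᶠ t in 𝓝[>] (0 : ℝ), tubeMap Ω (q, t) ∉ Ω := by
  obtain ⟨U, φ, hqU, ⟨hU, hφ, hgrad, hΩU⟩, hν⟩ := hΩ.isOuterNormal hq
  have hmem : ∀ x ∈ U, x ∈ Ω ↔ φ x < 0 := fun x hx => by
    have : x ∈ Ω ∩ U ↔ x ∈ {x ∈ U | φ x < 0} := by rw [hΩU]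
    simpa [hx] using this
  have hφd : DifferentiableAt ℝ φ q :=
    (hφ.contDiffAt (hU.mem_nhds hqU)).differentiableAt (by simp)
  have hφc : ContinuousAt φ q := hφd.continuousAt
  -- A boundary point lies in the closure of Ω ∩ U = {φ < 0}, whence φ(q) ≤ 0; it is not in the open
  -- set Ω, whence φ(q) ≥ 0.
  have hq0 : φ q = 0 := by
    apply le_antisymm
    · refine closure_minimal (s := {x | x ∈ U ∧ φ x < 0}) (t := {x | x ∈ U → φ x ≤ 0}) ?_ ?_ ?_ hqU
      · exact fun x hx _ => hx.2.le
      · have : {x | x ∈ U → φ x ≤ 0} = (U ∩ φ ⁻¹' Ioi 0)ᶜ := by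
          ext x; simp
        rw [this, isClosed_compl_iff]
        exact hφ.continuousOn.isOpen_inter_preimage hU isOpen_Ioi
      · have h1 : q ∈ closure Ω := frontier_subset_closure hq
        have h2 : q ∈ closure (Ω ∩ U) := by
          rw [inter_comm]
          exact hU.inter_closure ⟨hqU, h1⟩
        rwa [hΩU] at h2
    · by_contra hlt
      push Not at hlt
      rw [hΩ.isOpen.frontier_eq] at hq
      exact hq.2 ((hmem q hqU).2 hlt)
  set ν := outerNormal Ω q
  have hgp : 0 < ‖gradient φ q‖ := norm_pos_iff.2 (hgrad q hqU)
  have hline : HasDerivAt (fun t : ℝ => tubeMap Ω (q, t)) ν 0 := by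
    have := ((hasDerivAt_id (0 : ℝ)).smul_const ν).const_add q
    simpa [tubeMap] using this
  have hline0 : tubeMap Ω (q, 0) = q := by simp [tubeMap]
  have hder : HasDerivAt (fun t : ℝ => φ (tubeMap Ω (q, t))) ‖gradient φ q‖ 0 := by
    have h1 : HasFDerivAt φ (fderiv ℝ φ q) (tubeMap Ω (q, 0)) := by
      rw [hline0]; exact hφd.hasFDerivAt
    have h2 := h1.comp_hasDerivAt 0 hline
    have h3 : fderiv ℝ φ q ν = ‖gradient φ q‖ := by
      have h4 : fderiv ℝ φ q = InnerProductSpace.toDual ℝ (Euc 3) (gradient φ q) := by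
        simp [gradient]
      rw [h4, hν, InnerProductSpace.toDual_apply_apply, inner_smul_right,
        real_inner_self_eq_norm_sq]
      field_simp
    rwa [h3] at h2
  -- Along the normal line φ vanishes at 0 with derivative |∇φ(q)| > 0, so it has the sign of t near
  -- 0.
  have hsign := eventually_nhdsWithin_sign_eq_of_deriv_pos (by rw [hder.deriv]; exact hgp)
    (show φ (tubeMap Ω (q, 0)) = 0 by rw [hline0, hq0])
  have hU' : ∀ᶠ t in 𝓝 (0 : ℝ), tubeMap Ω (q, t) ∈ U :=
    hline.continuousAt.eventually_mem (by rw [hline0]; exact hU.mem_nhds hqU)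
  constructor
  · filter_upwards [nhdsWithin_le_nhds hsign, nhdsWithin_le_nhds hU', self_mem_nhdsWithin]
      with t h1 h2 h3
    rw [sub_zero, sign_neg (show t < 0 from h3)] at h1
    exact (hmem _ h2).2 (sign_eq_neg_one_iff.1 h1)
  · filter_upwards [nhdsWithin_le_nhds hsign, nhdsWithin_le_nhds hU', self_mem_nhdsWithin]
      with t h1 h2 h3
    rw [sub_zero, sign_pos (show 0 < t from h3)] at h1
    rw [hmem _ h2, not_lt]
    exact (sign_eq_one_iff.1 h1).le

/-- A boundary point p is also Λ(p, 0), so injectivity of Λ forces its height to be 0. -/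
lemma tubeMap_notMem_frontier (hκ : 0 < tubeRadius Ω) {q : Euc 3} (hq : q ∈ frontier Ω) {t : ℝ}
    (ht : t ∈ Ioo (-tubeRadius Ω) (tubeRadius Ω)) (ht0 : t ≠ 0) :
    tubeMap Ω (q, t) ∉ frontier Ω := by
  intro hmem
  have h0 : (0 : ℝ) ∈ Ioo (-tubeRadius Ω) (tubeRadius Ω) := ⟨by linarith, hκ⟩
  have h1 : tubeMap Ω (tubeMap Ω (q, t), 0) = tubeMap Ω (q, t) := by simp [tubeMap]
  have h2 := (tubeInv_tubeMap hκ hmem h0).2.2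
  rw [h1, (tubeInv_tubeMap hκ hq ht).2.2] at h2
  exact ht0 h2

/-- Each open half of the normal segment is connected and avoids the boundary, so it lies entirely
in Ω or entirely in the exterior. The behaviour near height 0 decides which. -/
lemma IsC4Domain.tubeMap_mem_iff (hΩ : IsC4Domain Ω) (hκ : 0 < tubeRadius Ω) {q : Euc 3}
    (hq : q ∈ frontier Ω) {t : ℝ} (ht : t ∈ Ioo (-tubeRadius Ω) (tubeRadius Ω)) :
    tubeMap Ω (q, t) ∈ Ω ↔ t < 0 := by
  have hcont : Continuous fun t : ℝ => tubeMap Ω (q, t) := by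
    simp only [tubeMap]; fun_prop
  obtain ⟨hin, hout⟩ := hΩ.eventually_normal hq
  have hsub : ∀ {I : Set ℝ}, IsPreconnected I → I ⊆ Ioo (-tubeRadius Ω) (tubeRadius Ω) →
      (0 : ℝ) ∉ I → (fun t : ℝ => tubeMap Ω (q, t)) '' I ⊆ Ω ∪ (closure Ω)ᶜ := by
    rintro I - hI h0 _ ⟨t, ht, rfl⟩
    by_contra hcon
    rw [mem_union, not_or, notMem_compl_iff] at hcon
    refine tubeMap_notMem_frontier hκ hq (hI ht) (fun h => h0 (h ▸ ht)) ?_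
    rw [hΩ.isOpen.frontier_eq]
    exact ⟨hcon.2, hcon.1⟩
  have hdisj : Disjoint Ω (closure Ω)ᶜ :=
    disjoint_compl_right.mono_right (compl_subset_compl.2 subset_closure)
  have hpre : ∀ a b : ℝ, IsPreconnected ((fun t : ℝ => tubeMap Ω (q, t)) '' Ioo a b) := fun a b =>
    isPreconnected_Ioo.image _ hcont.continuousOn
  rcases lt_trichotomy t 0 with hneg | rfl | hpos
  · refine iff_of_true ?_ hneg
    have hI : Ioo (-tubeRadius Ω) 0 ⊆ Ioo (-tubeRadius Ω) (tubeRadius Ω) :=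
      Ioo_subset_Ioo_right hκ.le
    have hsub' := hsub isPreconnected_Ioo hI (fun h => lt_irrefl _ h.2)
    obtain ⟨s, hs, hs'⟩ := (hin.and (Ioo_mem_nhdsLT (neg_lt_zero.2 hκ))).exists
    exact (hpre _ _).subset_left_of_subset_union hΩ.isOpen isClosed_closure.isOpen_compl hdisj
      hsub' ⟨_, mem_image_of_mem _ hs', hs⟩ (mem_image_of_mem _ (⟨ht.1, hneg⟩ : t ∈ Ioo _ _))
  · refine iff_of_false ?_ (lt_irrefl _)
    have : tubeMap Ω (q, 0) = q := by simp [tubeMap]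
    rw [this]
    rw [hΩ.isOpen.frontier_eq] at hq
    exact hq.2
  · refine iff_of_false ?_ hpos.not_gt
    have hI : Ioo 0 (tubeRadius Ω) ⊆ Ioo (-tubeRadius Ω) (tubeRadius Ω) :=
      Ioo_subset_Ioo_left (by linarith)
    have hsub' := hsub isPreconnected_Ioo hI (fun h => lt_irrefl _ h.1)
    obtain ⟨s, hs, hs'⟩ := (hout.and (Ioo_mem_nhdsGT hκ)).exists
    have h1 := hsub' (mem_image_of_mem _ hs')
    have h2 := (hpre 0 (tubeRadius Ω)).subset_right_of_subset_union hΩ.isOpen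
      isClosed_closure.isOpen_compl hdisj hsub' ⟨_, mem_image_of_mem _ hs', h1.resolve_left hs⟩
      (mem_image_of_mem _ (⟨hpos, ht.2⟩ : t ∈ Ioo _ _))
    exact fun h => h2 (subset_closure h)

/-- On the tube, `Ω` is the set where the height is negative. -/
lemma IsC4Domain.mem_iff_tubeHeight_neg (hΩ : IsC4Domain Ω) (hκ : 0 < tubeRadius Ω) {x : Euc 3}
    (hx : x ∈ tube Ω (tubeRadius Ω)) : x ∈ Ω ↔ tubeHeight Ω x < 0 := by
  obtain ⟨h1, h2, h3⟩ := tubeInv_mem hκ hx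
  rw [← hΩ.tubeMap_mem_iff hκ h1 h2, h3]

/-! ### Charts of the tube -/

/-- The parametrization of a part of the tube induced by a chart of the boundary. -/
noncomputable def tubePar (c : SurfaceChart (frontier Ω)) (z : Euc 2 × ℝ) : Euc 3 :=
  tubeMap Ω (c.par z.1, z.2)

/-- The parameter domain of `tubePar`. -/
def tubeDom (c : SurfaceChart (frontier Ω)) : Set (Euc 2 × ℝ) :=
  c.dom ×ˢ Ioo (-tubeRadius Ω) (tubeRadius Ω)

/-- The part of the tube covered by a chart. -/
def tubePatch (c : SurfaceChart (frontier Ω)) : Set (Euc 3) :=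
  {x ∈ tube Ω (tubeRadius Ω) | foot Ω x ∈ c.par '' c.dom}

/-- The coordinates of the foot point in a chart. -/
noncomputable def footCoord (c : SurfaceChart (frontier Ω)) (x : Euc 3) : Euc 2 :=
  Function.invFunOn c.par c.dom (foot Ω x)

lemma SurfaceChart.par_mem (c : SurfaceChart (frontier Ω)) {z : Euc 2} (hz : z ∈ c.dom) :
    c.par z ∈ frontier Ω := by
  obtain ⟨O, -, hO⟩ := c.isOpenMap c.dom le_rfl c.isOpen_dom
  have : c.par z ∈ frontier Ω ∩ O := hO ▸ mem_image_of_mem _ hz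
  exact this.1

lemma isOpen_tubeDom (c : SurfaceChart (frontier Ω)) : IsOpen (tubeDom c) :=
  c.isOpen_dom.prod isOpen_Ioo

lemma tubePar_coords (hκ : 0 < tubeRadius Ω) (c : SurfaceChart (frontier Ω)) {z : Euc 2 × ℝ}
    (hz : z ∈ tubeDom c) :
    tubePar c z ∈ tubePatch c ∧ foot Ω (tubePar c z) = c.par z.1 ∧
      footCoord c (tubePar c z) = z.1 ∧ tubeHeight Ω (tubePar c z) = z.2 := by
  obtain ⟨h1, h2, h3⟩ := tubeInv_tubeMap hκ (c.par_mem hz.1) hz.2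
  have h2' : foot Ω (tubePar c z) = c.par z.1 := h2
  refine ⟨⟨h1, ?_⟩, h2', ?_, h3⟩
  · rw [h2']; exact mem_image_of_mem _ hz.1
  · rw [footCoord, h2']
    exact c.injOn.leftInvOn_invFunOn hz.1

lemma tubePatch_coords (hκ : 0 < tubeRadius Ω) (c : SurfaceChart (frontier Ω)) {x : Euc 3}
    (hx : x ∈ tubePatch c) :
    (footCoord c x, tubeHeight Ω x) ∈ tubeDom c ∧ c.par (footCoord c x) = foot Ω x ∧
      tubePar c (footCoord c x, tubeHeight Ω x) = x := by
  obtain ⟨-, h2, h3⟩ := tubeInv_mem hκ hx.1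
  have h4 : c.par (footCoord c x) = foot Ω x := Function.invFunOn_eq hx.2
  refine ⟨⟨Function.invFunOn_mem hx.2, h2⟩, h4, ?_⟩
  rw [tubePar, h4, h3]

lemma image_tubePar (hκ : 0 < tubeRadius Ω) (c : SurfaceChart (frontier Ω)) :
    tubePar c '' tubeDom c = tubePatch c := by
  ext x
  constructor
  · rintro ⟨z, hz, rfl⟩
    exact (tubePar_coords hκ c hz).1
  · intro hx
    obtain ⟨h1, -, h3⟩ := tubePatch_coords hκ c hx
    exact ⟨_, h1, h3⟩

lemma contDiffAt_tubePar (hκ : 0 < tubeRadius Ω) (c : SurfaceChart (frontier Ω)) {z : Euc 2 × ℝ}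
    (hz : z ∈ tubeDom c) : ContDiffAt ℝ 1 (tubePar c) z := by
  obtain ⟨α, h1, -, -, h3⟩ := exists_tubular_gt hκ (abs_lt.2 hz.2)
  have hnhds : c.dom ×ˢ Ioo (-α) α ∈ 𝓝 z :=
    (c.isOpen_dom.prod isOpen_Ioo).mem_nhds ⟨hz.1, abs_lt.1 h1⟩
  exact ((h3.2.1 c).contDiffAt hnhds).of_le (by norm_num)

/-- The smooth left inverse g of Λ gives g ∘ `tubePar c` = (par, id), whose differential is
injective because par is an immersion. Hence the differential of `tubePar c` is injective, and
bijective as both spaces have dimension 3. -/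
lemma exists_fderiv_tubePar_equiv (hκ : 0 < tubeRadius Ω) (c : SurfaceChart (frontier Ω))
    {z : Euc 2 × ℝ} (hz : z ∈ tubeDom c) :
    ∃ F' : (Euc 2 × ℝ) ≃L[ℝ] Euc 3,
      HasFDerivAt (tubePar c) (F' : (Euc 2 × ℝ) →L[ℝ] Euc 3) z := by
  obtain ⟨α, h1, h0, -, h3⟩ := exists_tubular_gt hκ (abs_lt.2 hz.2)
  obtain ⟨g, hg, hgl⟩ := h3.2.2
  have hd : HasFDerivAt (tubePar c) (fderiv ℝ (tubePar c) z) z :=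
    ((contDiffAt_tubePar hκ c hz).differentiableAt one_ne_zero).hasFDerivAt
  have hmem : tubePar c z ∈ tube Ω α := h3.1.mapsTo ⟨c.par_mem hz.1, abs_lt.1 h1⟩
  have hgd : HasFDerivAt g (fderiv ℝ g (tubePar c z)) (tubePar c z) :=
    ((hg.contDiffAt ((isOpen_tube α).mem_nhds hmem)).differentiableAt (by simp)).hasFDerivAt
  have hcomp := hgd.comp z hd
  have hpar : HasFDerivAt c.par (fderiv ℝ c.par z.1) z.1 :=
    ((c.contDiffOn.contDiffAt (c.isOpen_dom.mem_nhds hz.1)).differentiableAt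
      (by simp)).hasFDerivAt
  have hprod : HasFDerivAt (fun y : Euc 2 × ℝ => (c.par y.1, y.2))
      ((fderiv ℝ c.par z.1).prodMap (ContinuousLinearMap.id ℝ ℝ)) z :=
    HasFDerivAt.prodMap z hpar (hasFDerivAt_id z.2)
  have heq : (g ∘ tubePar c) =ᶠ[𝓝 z] fun y : Euc 2 × ℝ => (c.par y.1, y.2) := by
    filter_upwards [(c.isOpen_dom.prod isOpen_Ioo).mem_nhds
      (⟨hz.1, abs_lt.1 h1⟩ : z ∈ c.dom ×ˢ Ioo (-α) α)] with y hy
    exact hgl ⟨c.par_mem hy.1, hy.2⟩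
  have huniq := hcomp.unique (hprod.congr_of_eventuallyEq heq)
  have hinj : Function.Injective (fderiv ℝ (tubePar c) z) := by
    rw [injective_iff_map_eq_zero]
    intro u hu
    have h4 : ((fderiv ℝ c.par z.1).prodMap (ContinuousLinearMap.id ℝ ℝ)) u = 0 := by
      rw [← huniq]; simp [hu]
    have h5 : fderiv ℝ c.par z.1 u.1 = 0 := congrArg Prod.fst h4
    have h6 : u.2 = 0 := congrArg Prod.snd h4
    exact Prod.ext ((injective_iff_map_eq_zero _).1 (c.immersion z.1 hz.1) _ h5) h6
  have hfin : Module.finrank ℝ (Euc 2 × ℝ) = Module.finrank ℝ (Euc 3) := by simp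
  let e : (Euc 2 × ℝ) ≃L[ℝ] Euc 3 := (LinearEquiv.ofInjectiveOfFinrankEq
    (fderiv ℝ (tubePar c) z : (Euc 2 × ℝ) →ₗ[ℝ] Euc 3) hinj hfin).toContinuousLinearEquiv
  refine ⟨e, ?_⟩
  have : (e : (Euc 2 × ℝ) →L[ℝ] Euc 3) = fderiv ℝ (tubePar c) z := by
    refine ContinuousLinearMap.ext fun u => rfl
  rw [this]
  exact hd

lemma tubePar_image_mem_nhds (hκ : 0 < tubeRadius Ω) (c : SurfaceChart (frontier Ω))
    {z : Euc 2 × ℝ} (hz : z ∈ tubeDom c) : tubePatch c ∈ 𝓝 (tubePar c z) := by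
  obtain ⟨F', hF'⟩ := exists_fderiv_tubePar_equiv hκ c hz
  have hs := (contDiffAt_tubePar hκ c hz).hasStrictFDerivAt' hF' one_ne_zero
  rw [← hs.map_nhds_eq_of_equiv, ← image_tubePar hκ c]
  exact image_mem_map ((isOpen_tubeDom c).mem_nhds hz)

lemma isOpen_tubePatch (hκ : 0 < tubeRadius Ω) (c : SurfaceChart (frontier Ω)) :
    IsOpen (tubePatch c) := by
  rw [isOpen_iff_mem_nhds]
  intro x hx
  obtain ⟨h1, -, h3⟩ := tubePatch_coords hκ c hx
  rw [← h3]
  exact tubePar_image_mem_nhds hκ c h1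

lemma contDiffOn_tubeCoords (hκ : 0 < tubeRadius Ω) (c : SurfaceChart (frontier Ω)) :
    ContDiffOn ℝ 1 (fun x => (footCoord c x, tubeHeight Ω x)) (tubePatch c) := by
  intro x hx
  obtain ⟨h1, -, h3⟩ := tubePatch_coords hκ c hx
  obtain ⟨F', hF'⟩ := exists_fderiv_tubePar_equiv hκ c h1
  have key : ContDiffAt ℝ 1 (fun x => (footCoord c x, tubeHeight Ω x))
      (tubePar c (footCoord c x, tubeHeight Ω x)) := by
    refine (contDiffAt_tubePar hκ c h1).of_eventually_leftInverse one_ne_zero hF' ?_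
    filter_upwards [(isOpen_tubeDom c).mem_nhds h1] with y hy
    obtain ⟨-, -, h4, h5⟩ := tubePar_coords hκ c hy
    exact Prod.ext h4 h5
  rw [h3] at key
  exact key.contDiffWithinAt

end Tube

/-! ### Regularity of foot point, height and normal, and compactness of closed collars -/

section TubeRegularity

variable {Ω : Set (Euc 3)}

lemma contDiffOn_footCoord (hκ : 0 < tubeRadius Ω) (c : SurfaceChart (frontier Ω)) :
    ContDiffOn ℝ 1 (footCoord c) (tubePatch c) :=
  contDiff_fst.comp_contDiffOn (contDiffOn_tubeCoords hκ c)

lemma contDiffOn_tubeHeight_patch (hκ : 0 < tubeRadius Ω) (c : SurfaceChart (frontier Ω)) :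
    ContDiffOn ℝ 1 (tubeHeight Ω) (tubePatch c) :=
  (contDiffOn_tubeCoords hκ c).snd

lemma contDiffOn_foot_patch (hκ : 0 < tubeRadius Ω) (c : SurfaceChart (frontier Ω)) :
    ContDiffOn ℝ 1 (foot Ω) (tubePatch c) := by
  have h := (c.contDiffOn.of_le (by norm_num : (1 : ℕ∞ω) ≤ 4)).comp (contDiffOn_footCoord hκ c)
    fun x hx => (tubePatch_coords hκ c hx).1.1
  exact h.congr fun x hx => ((tubePatch_coords hκ c hx).2.1).symm

/-- The normal is the difference quotient (Λ(q, κ/2) - q) / (κ/2), and Λ is C¹ in the charts. -/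
lemma contDiffOn_normal_par (hκ : 0 < tubeRadius Ω) (c : SurfaceChart (frontier Ω)) :
    ContDiffOn ℝ 1 (fun z => outerNormal Ω (c.par z)) c.dom := by
  have ht : tubeRadius Ω / 2 ∈ Ioo (-tubeRadius Ω) (tubeRadius Ω) := ⟨by linarith, by linarith⟩
  have h1 : ContDiffOn ℝ 1 (tubePar c) (tubeDom c) := fun z hz =>
    (contDiffAt_tubePar hκ c hz).contDiffWithinAt
  have h2 : ContDiffOn ℝ 1 (fun z => tubePar c (z, tubeRadius Ω / 2)) c.dom :=
    h1.comp (contDiff_id.prodMk contDiff_const).contDiffOn fun z hz => ⟨hz, ht⟩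
  have h3 := (h2.sub (c.contDiffOn.of_le (by norm_num : (1 : ℕ∞ω) ≤ 4))).const_smul
    (tubeRadius Ω / 2)⁻¹
  refine h3.congr fun z _ => ?_
  simp [tubePar, tubeMap, smul_smul, div_self hκ.ne']

lemma contDiffOn_normal_patch (hκ : 0 < tubeRadius Ω) (c : SurfaceChart (frontier Ω)) :
    ContDiffOn ℝ 1 (fun x => outerNormal Ω (foot Ω x)) (tubePatch c) := by
  have h := (contDiffOn_normal_par hκ c).comp (contDiffOn_footCoord hκ c)
    fun x hx => (tubePatch_coords hκ c hx).1.1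
  refine h.congr fun x hx => ?_
  simp only [Function.comp_apply, (tubePatch_coords hκ c hx).2.1]

/-- The support of a weight, in the coordinates of its chart. -/
def chartSupport (A : SurfaceAtlas (frontier Ω)) (k : Fin A.card) : Set (Euc 2) :=
  {z ∈ (A.chart k).dom | (A.chart k).par z ∈ closure {q ∈ frontier Ω | A.weight k q ≠ 0}}

lemma chartSupport_subset (A : SurfaceAtlas (frontier Ω)) (k : Fin A.card) :
    chartSupport A k ⊆ (A.chart k).dom := fun _ h => h.1

/-- The support of the weight is closed in the compact boundary, and `footCoord` is a continuous
inverse of the chart there; the set in question is the image. -/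
lemma isCompact_chartSupport (hΩ : IsC4Domain Ω) (hκ : 0 < tubeRadius Ω)
    (A : SurfaceAtlas (frontier Ω)) (k : Fin A.card) : IsCompact (chartSupport A k) := by
  set Q := closure {q ∈ frontier Ω | A.weight k q ≠ 0}
  have hQΓ : Q ⊆ frontier Ω := closure_minimal (fun q hq => hq.1) isClosed_frontier
  have hQ : IsCompact Q := hΩ.isCompact_frontier.of_isClosed_subset isClosed_closure hQΓ
  have h0 : (0 : ℝ) ∈ Ioo (-tubeRadius Ω) (tubeRadius Ω) := ⟨by linarith, hκ⟩
  have hpar : ∀ z, tubePar (A.chart k) (z, 0) = (A.chart k).par z := fun z => by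
    simp [tubePar, tubeMap]
  have hsub : Q ⊆ tubePatch (A.chart k) := by
    intro q hq
    obtain ⟨z, hz, rfl⟩ := A.weight_support k hq
    have := (tubePar_coords hκ (A.chart k) (z := (z, 0)) ⟨hz, h0⟩).1
    rwa [hpar] at this
  have himg : chartSupport A k = footCoord (A.chart k) '' Q := by
    ext z
    constructor
    · rintro ⟨hz, hzQ⟩
      refine ⟨_, hzQ, ?_⟩
      have := (tubePar_coords hκ (A.chart k) (z := (z, 0)) ⟨hz, h0⟩).2.2.1
      rwa [hpar] at this
    · rintro ⟨q, hq, rfl⟩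
      obtain ⟨z, hz, rfl⟩ := A.weight_support k hq
      have := (tubePar_coords hκ (A.chart k) (z := (z, 0)) ⟨hz, h0⟩).2.2.1
      rw [hpar] at this
      rw [this]
      exact ⟨hz, hq⟩
  rw [himg]
  exact hQ.image_of_continuousOn ((contDiffOn_footCoord hκ _).continuousOn.mono hsub)

lemma exists_chartSupport (A : SurfaceAtlas (frontier Ω)) {q : Euc 3} (hq : q ∈ frontier Ω) :
    ∃ k, ∃ z ∈ chartSupport A k, (A.chart k).par z = q := by
  have h : ∃ k, A.weight k q ≠ 0 := by
    by_contra hcon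
    push Not at hcon
    have := A.weight_sum q hq
    simp [hcon] at this
  obtain ⟨k, hk⟩ := h
  have hmem : q ∈ closure {q ∈ frontier Ω | A.weight k q ≠ 0} := subset_closure ⟨hq, hk⟩
  obtain ⟨z, hz, rfl⟩ := A.weight_support k hmem
  exact ⟨k, z, ⟨hz, hmem⟩, rfl⟩

lemma exists_mem_tubePatch (hκ : 0 < tubeRadius Ω) (A : SurfaceAtlas (frontier Ω)) {x : Euc 3}
    (hx : x ∈ tube Ω (tubeRadius Ω)) : ∃ k, x ∈ tubePatch (A.chart k) := by
  obtain ⟨k, z, hz, h⟩ := exists_chartSupport A (tubeInv_mem hκ hx).1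
  exact ⟨k, hx, z, hz.1, h⟩

lemma contDiffOn_tube_of_patch {E : Type*} [NormedAddCommGroup E] [NormedSpace ℝ E]
    (hκ : 0 < tubeRadius Ω) (A : SurfaceAtlas (frontier Ω)) {f : Euc 3 → E}
    (hf : ∀ k, ContDiffOn ℝ 1 f (tubePatch (A.chart k))) :
    ContDiffOn ℝ 1 f (tube Ω (tubeRadius Ω)) := by
  intro x hx
  obtain ⟨k, hk⟩ := exists_mem_tubePatch hκ A hx
  exact ((hf k).contDiffAt ((isOpen_tubePatch hκ _).mem_nhds hk)).contDiffWithinAt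

lemma contDiffOn_tubeHeight (hκ : 0 < tubeRadius Ω) (A : SurfaceAtlas (frontier Ω)) :
    ContDiffOn ℝ 1 (tubeHeight Ω) (tube Ω (tubeRadius Ω)) :=
  contDiffOn_tube_of_patch hκ A fun k => contDiffOn_tubeHeight_patch hκ (A.chart k)

lemma contDiffOn_foot (hκ : 0 < tubeRadius Ω) (A : SurfaceAtlas (frontier Ω)) :
    ContDiffOn ℝ 1 (foot Ω) (tube Ω (tubeRadius Ω)) :=
  contDiffOn_tube_of_patch hκ A fun k => contDiffOn_foot_patch hκ (A.chart k)

lemma contDiffOn_normal (hκ : 0 < tubeRadius Ω) (A : SurfaceAtlas (frontier Ω)) :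
    ContDiffOn ℝ 1 (fun x => outerNormal Ω (foot Ω x)) (tube Ω (tubeRadius Ω)) :=
  contDiffOn_tube_of_patch hκ A fun k => contDiffOn_normal_patch hκ (A.chart k)

/-- The closed collar of half-width `α` about the boundary. -/
def collar (Ω : Set (Euc 3)) (α : ℝ) : Set (Euc 3) :=
  {x ∈ tube Ω (tubeRadius Ω) | |tubeHeight Ω x| ≤ α}

/-- The part of the collar over the support of a weight. -/
def collarPiece (A : SurfaceAtlas (frontier Ω)) (α : ℝ) (k : Fin A.card) : Set (Euc 2 × ℝ) :=
  chartSupport A k ×ˢ Icc (-α) α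

lemma collarPiece_subset (A : SurfaceAtlas (frontier Ω)) {α : ℝ} (hα : α < tubeRadius Ω)
    (k : Fin A.card) : collarPiece A α k ⊆ tubeDom (A.chart k) :=
  prod_mono (chartSupport_subset A k) fun _ ht =>
    ⟨(neg_lt_neg hα).trans_le ht.1, ht.2.trans_lt hα⟩

lemma isCompact_collarPiece (hΩ : IsC4Domain Ω) (hκ : 0 < tubeRadius Ω)
    (A : SurfaceAtlas (frontier Ω)) (α : ℝ) (k : Fin A.card) : IsCompact (collarPiece A α k) :=
  (isCompact_chartSupport hΩ hκ A k).prod isCompact_Icc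

lemma continuousOn_tubePar (hκ : 0 < tubeRadius Ω) (c : SurfaceChart (frontier Ω)) :
    ContinuousOn (tubePar c) (tubeDom c) := fun _ hz =>
  (contDiffAt_tubePar hκ c hz).continuousAt.continuousWithinAt

lemma collar_eq_iUnion (hκ : 0 < tubeRadius Ω) (A : SurfaceAtlas (frontier Ω)) {α : ℝ}
    (hα : α < tubeRadius Ω) :
    collar Ω α = ⋃ k, tubePar (A.chart k) '' collarPiece A α k := by
  ext x
  rw [mem_iUnion]
  constructor
  · rintro ⟨hx, hxα⟩
    obtain ⟨h1, h2, h3⟩ := tubeInv_mem hκ hx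
    obtain ⟨k, z, hz, hzq⟩ := exists_chartSupport A h1
    refine ⟨k, (z, tubeHeight Ω x), ⟨hz, abs_le.1 hxα⟩, ?_⟩
    rw [tubePar, hzq, h3]
  · rintro ⟨k, z, hz, rfl⟩
    obtain ⟨h1, -, -, h4⟩ := tubePar_coords hκ (A.chart k) (collarPiece_subset A hα k hz)
    refine ⟨h1.1, ?_⟩
    rw [h4]
    exact abs_le.2 hz.2

lemma isCompact_collar (hΩ : IsC4Domain Ω) (hκ : 0 < tubeRadius Ω)
    (A : SurfaceAtlas (frontier Ω)) {α : ℝ} (hα : α < tubeRadius Ω) :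
    IsCompact (collar Ω α) := by
  rw [collar_eq_iUnion hκ A hα]
  exact isCompact_iUnion fun k => (isCompact_collarPiece hΩ hκ A α k).image_of_continuousOn
    ((continuousOn_tubePar hκ _).mono (collarPiece_subset A hα k))

end TubeRegularity

/-! ### Distortion of volume -/

section Volume

/-- A map that is `C¹` near a compact set between spaces of equal dimension distorts volume there
at most by a constant factor. -/
lemma exists_measure_image_le {E F : Type*} [NormedAddCommGroup E] [NormedSpace ℝ E]
    [FiniteDimensional ℝ E] [MeasurableSpace E] [BorelSpace E] [NormedAddCommGroup F]
    [NormedSpace ℝ F] [FiniteDimensional ℝ F] [MeasurableSpace F] [BorelSpace F]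
    (hdim : Module.finrank ℝ E = Module.finrank ℝ F) (μ : Measure E) [μ.IsAddHaarMeasure]
    (ν : Measure F) [ν.IsAddHaarMeasure] {f : E → F} {K : Set E} (hK : IsCompact K)
    (hf : ∀ x ∈ K, ContDiffAt ℝ 1 f x) :
    ∃ C : ℝ≥0, ∀ s ⊆ K, ν (f '' s) ≤ C * μ s := by
  set n := Module.finrank ℝ E
  have : (μH[n] : Measure E).IsAddHaarMeasure := inferInstance
  have hF : (μH[n] : Measure F).IsAddHaarMeasure := by rw [hdim]; infer_instance
  -- Both Haar measures are multiples of the n-dimensional Hausdorff measure, which a Lipschitz map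
  -- with constant L increases at most by L^n. A C¹ map is Lipschitz near each point, and
  -- compactness patches the local constants.
  have hν : ν = Measure.addHaarScalarFactor ν (μH[n] : Measure F) • (μH[n] : Measure F) :=
    Measure.isAddLeftInvariant_eq_smul _ _
  have hμ : (μH[n] : Measure E) = Measure.addHaarScalarFactor (μH[n] : Measure E) μ • μ :=
    Measure.isAddLeftInvariant_eq_smul _ _
  set a := Measure.addHaarScalarFactor ν (μH[n] : Measure F)
  set b := Measure.addHaarScalarFactor (μH[n] : Measure E) μ
  refine hK.induction_on (p := fun K => ∃ C : ℝ≥0, ∀ s ⊆ K, ν (f '' s) ≤ C * μ s) ?_ ?_ ?_ ?_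
  · exact ⟨0, fun s hs => by simp [subset_empty_iff.1 hs]⟩
  · rintro s t hst ⟨C, hC⟩
    exact ⟨C, fun u hu => hC u (hu.trans hst)⟩
  · rintro s t ⟨C, hC⟩ ⟨C', hC'⟩
    refine ⟨C + C', fun u hu => ?_⟩
    have hu' : u = (u ∩ s) ∪ (u ∩ t) := by
      rw [← inter_union_distrib_left, inter_eq_left.2 hu]
    calc ν (f '' u) ≤ ν (f '' (u ∩ s)) + ν (f '' (u ∩ t)) := by
          conv_lhs => rw [hu', image_union]
          exact measure_union_le _ _
      _ ≤ C * μ u + C' * μ u := by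
          gcongr
          · exact (hC _ inter_subset_right).trans (by gcongr; exact inter_subset_left)
          · exact (hC' _ inter_subset_right).trans (by gcongr; exact inter_subset_left)
      _ = _ := by rw [ENNReal.coe_add, add_mul]
  · intro x hx
    obtain ⟨L, t, ht, hL⟩ := (hf x hx).exists_lipschitzOnWith
    refine ⟨t, nhdsWithin_le_nhds ht, a * (L ^ n * b), fun s hs => ?_⟩
    have h1 := (hL.mono hs).hausdorffMeasure_image_le (d := n) (by positivity)
    rw [hν, Measure.smul_apply]
    calc a • (μH[n] : Measure F) (f '' s) ≤ a * (L ^ (n : ℝ) * (μH[n] : Measure E) s) := by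
          rw [ENNReal.smul_def, smul_eq_mul]; gcongr
      _ = _ := by
          rw [hμ, Measure.smul_apply, ENNReal.smul_def, smul_eq_mul]
          push_cast
          rw [ENNReal.rpow_natCast]
          ring

/-- Maps preserving the fibres of `E × ℝ` and expanding them at most shrink volumes by a constant
factor. -/
lemma measure_fiber_preimage_le {E : Type*} [MeasurableSpace E] (μ : Measure E) [SFinite μ]
    {P S : Set (E × ℝ)} {ρ : E → ℝ → ℝ} (hS : MeasurableSet S)
    (hP : MeasurableSet {z ∈ P | (z.1, ρ z.1 z.2) ∈ S}) {L : ℝ≥0}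
    (hρ : ∀ z ∈ P, AntilipschitzWith L (ρ z.1)) :
    (μ.prod volume) {z ∈ P | (z.1, ρ z.1 z.2) ∈ S} ≤ L * (μ.prod volume) S := by
  rw [Measure.prod_apply hP, Measure.prod_apply hS,
    ← lintegral_const_mul _ (measurable_measure_prodMk_left hS)]
  refine lintegral_mono fun x => ?_
  by_cases hx : ∃ t, (x, t) ∈ P
  · obtain ⟨t, ht⟩ := hx
    -- On the line, Lebesgue measure is the one-dimensional Hausdorff measure, and preimages under
    -- an antilipschitz map grow at most by its constant. No regularity of ρ in the base variable is
    -- used beyond measurability.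
    have h1 := (hρ _ ht).hausdorffMeasure_preimage_le (d := 1) zero_le_one (Prod.mk x ⁻¹' S)
    rw [hausdorffMeasure_real, ENNReal.rpow_one] at h1
    refine (measure_mono ?_).trans h1
    exact fun s hs => hs.2
  · push Not at hx
    have : Prod.mk x ⁻¹' {z ∈ P | (z.1, ρ z.1 z.2) ∈ S} = ∅ := by
      ext t; simp [hx t]
    rw [this, measure_empty]
    exact zero_le

end Volume

/-! ### Maps displacing the points of the tube along the normal lines -/

/-- `m (e, t)` is a `C¹` displacement of the height `t`, depending on a parameter `|e| < a`, that
vanishes for `t ≤ -α` and for which `t ↦ t + m (e, t)` is expanding up to the factor `L`. -/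
structure IsDisplacement (α a : ℝ) (L : ℝ≥0) (m : ℝ × ℝ → ℝ) : Prop where
  contDiffOn : ContDiffOn ℝ 1 m (Ioo (-a) a ×ˢ univ)
  eq_zero : ∀ e ∈ Ioo (-a) a, ∀ t ≤ -α, m (e, t) = 0
  antilipschitz : ∀ e ∈ Ioo (-a) a, AntilipschitzWith L fun t => t + m (e, t)

/-- `Φ : V → U` displaces the points of the tube along the normal lines according to `m` and the
boundary function `η`, and fixes the other points. -/
structure IsTubeMap (Ω : Set (Euc 3)) (α : ℝ) (m : ℝ × ℝ → ℝ) (η : Euc 3 → ℝ)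
    (U V : Set (Euc 3)) (Φ : Euc 3 → Euc 3) : Prop where
  isOpen_target : IsOpen U
  isOpen_source : IsOpen V
  mapsTo : MapsTo Φ V U
  eq_on_tube : ∀ x ∈ V, x ∈ tube Ω (tubeRadius Ω) →
    Φ x = tubeMap Ω (foot Ω x, tubeHeight Ω x + m (η (foot Ω x), tubeHeight Ω x))
  eq_off_tube : ∀ x ∈ V, x ∉ tube Ω (tubeRadius Ω) → Φ x = x
  height_le : ∀ x ∈ V, x ∈ tube Ω (tubeRadius Ω) → tubeHeight Ω x ≤ α
  displaced_le : ∀ x ∈ V, x ∈ collar Ω α →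
    |tubeHeight Ω x + m (η (foot Ω x), tubeHeight Ω x)| ≤ α

lemma measurableSet_inter_preimage {X Y : Type*} [TopologicalSpace X] [MeasurableSpace X]
    [OpensMeasurableSpace X] [TopologicalSpace Y] [MeasurableSpace Y] [BorelSpace Y]
    {f : X → Y} {K : Set X} {E : Set Y} (hf : ContinuousOn f K) (hK : MeasurableSet K)
    (hE : MeasurableSet E) : MeasurableSet {x ∈ K | f x ∈ E} := by
  have h1 : Measurable (K.domRestrict f) :=
    (continuousOn_iff_continuous_domRestrict.1 hf).measurable
  have h2 : {x ∈ K | f x ∈ E} = Subtype.val '' (K.domRestrict f ⁻¹' E) := by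
    ext x
    exact ⟨fun h => ⟨⟨x, h.1⟩, h.2, rfl⟩, fun ⟨y, h, hy⟩ => hy ▸ ⟨y.2, h⟩⟩
  rw [h2]
  exact hK.subtype_image (h1 hE)

section TubeMap

variable {Ω : Set (Euc 3)} {α a : ℝ} {L : ℝ≥0} {m : ℝ × ℝ → ℝ} {η : Euc 3 → ℝ}
  {U V : Set (Euc 3)} {Φ : Euc 3 → Euc 3}

lemma IsTubeMap.eq_add (hΦ : IsTubeMap Ω α m η U V Φ) (hκ : 0 < tubeRadius Ω) {x : Euc 3}
    (hxV : x ∈ V) (hx : x ∈ tube Ω (tubeRadius Ω)) :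
    Φ x = x + m (η (foot Ω x), tubeHeight Ω x) • outerNormal Ω (foot Ω x) := by
  rw [hΦ.eq_on_tube x hxV hx, tubeMap, add_smul, ← add_assoc]
  simp only []
  rw [← eq_foot_add hκ hx]

lemma IsTubeMap.eq_self (hΦ : IsTubeMap Ω α m η U V Φ) (hκ : 0 < tubeRadius Ω)
    (hm : IsDisplacement α a L m) (hη : ∀ q ∈ frontier Ω, η q ∈ Ioo (-a) a) {x : Euc 3}
    (hxV : x ∈ V) (hx : x ∉ collar Ω α) : Φ x = x := by
  by_cases hxS : x ∈ tube Ω (tubeRadius Ω)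
  · have h1 := hΦ.height_le x hxV hxS
    have h2 : tubeHeight Ω x ≤ -α := by
      by_contra hcon
      push Not at hcon
      exact hx ⟨hxS, abs_le.2 ⟨hcon.le, h1⟩⟩
    rw [hΦ.eq_add hκ hxV hxS, hm.eq_zero _ (hη _ (tubeInv_mem hκ hxS).1) _ h2, zero_smul, add_zero]
  · exact hΦ.eq_off_tube x hxV hxS

lemma IsTubeMap.continuousOn (hΩ : IsC4Domain Ω) (hΦ : IsTubeMap Ω α m η U V Φ)
    (hκ : 0 < tubeRadius Ω) (A : SurfaceAtlas (frontier Ω)) (hα : α < tubeRadius Ω)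
    (hm : IsDisplacement α a L m) (hηc : ContinuousOn η (frontier Ω))
    (hη : ∀ q ∈ frontier Ω, η q ∈ Ioo (-a) a) : ContinuousOn Φ V := by
  intro x hx
  by_cases hxS : x ∈ tube Ω (tubeRadius Ω)
  · have hfoot := (contDiffOn_foot hκ A).continuousOn
    have hh : ContinuousOn (fun x => (η (foot Ω x), tubeHeight Ω x)) (tube Ω (tubeRadius Ω)) :=
      (hηc.comp hfoot fun y hy => (tubeInv_mem hκ hy).1).prodMk
        (contDiffOn_tubeHeight hκ A).continuousOn
    have h1 : ContinuousOn (fun x => x + m (η (foot Ω x), tubeHeight Ω x) •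
        outerNormal Ω (foot Ω x)) (tube Ω (tubeRadius Ω)) :=
      continuousOn_id.add ((hm.contDiffOn.continuousOn.comp hh fun y hy =>
        ⟨hη _ (tubeInv_mem hκ hy).1, mem_univ _⟩).smul (contDiffOn_normal hκ A).continuousOn)
    refine ContinuousAt.continuousWithinAt ?_
    refine (h1.continuousAt ((isOpen_tube _).mem_nhds hxS)).congr ?_
    filter_upwards [hΦ.isOpen_source.mem_nhds hx, (isOpen_tube _).mem_nhds hxS] with y hy hyS
    exact (hΦ.eq_add hκ hy hyS).symm
  · refine ContinuousAt.continuousWithinAt ?_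
    refine continuousAt_id.congr ?_
    have hcl : IsOpen (collar Ω α)ᶜ := (isCompact_collar hΩ hκ A hα).isClosed.isOpen_compl
    filter_upwards [hΦ.isOpen_source.mem_nhds hx,
      hcl.mem_nhds (show x ∈ (collar Ω α)ᶜ from fun h => hxS h.1)] with y hy hyS
    exact (hΦ.eq_self hκ hm hη hy hyS).symm

/-- Maps displacing along the normal lines distort volume by a factor depending on the tube and on
the expansion constant only. -/
theorem exists_map_volume_le (hΩ : IsC4Domain Ω) (hκ : 0 < tubeRadius Ω)
    (A : SurfaceAtlas (frontier Ω)) (hα : α < tubeRadius Ω) (a : ℝ) (L : ℝ≥0) :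
    ∃ C : ℝ≥0, 1 ≤ C ∧ ∀ (m : ℝ × ℝ → ℝ) (η : Euc 3 → ℝ) (U V : Set (Euc 3)) (Φ : Euc 3 → Euc 3),
      IsDisplacement α a L m → ContinuousOn η (frontier Ω) →
      (∀ q ∈ frontier Ω, η q ∈ Ioo (-a) a) → IsTubeMap Ω α m η U V Φ →
      (volume.restrict V).map Φ ≤ (C : ℝ≥0∞) • volume.restrict U := by
  have hdim : Module.finrank ℝ (Euc 2 × ℝ) = Module.finrank ℝ (Euc 3) := by simp
  have : (volume : Measure (Euc 2 × ℝ)).IsAddHaarMeasure := by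
    rw [Measure.volume_eq_prod]; infer_instance
  have h1 : ∀ k, ∃ C : ℝ≥0, ∀ s ⊆ collarPiece A α k,
      volume (tubePar (A.chart k) '' s) ≤ C * volume s := fun k =>
    exists_measure_image_le hdim volume volume (isCompact_collarPiece hΩ hκ A α k) fun y hy =>
      contDiffAt_tubePar hκ _ (collarPiece_subset A hα k hy)
  have h2 : ∀ k, ∃ C : ℝ≥0, ∀ s ⊆ tubePar (A.chart k) '' collarPiece A α k,
      volume ((fun x => (footCoord (A.chart k) x, tubeHeight Ω x)) '' s) ≤ C * volume s := by
    intro k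
    refine exists_measure_image_le hdim.symm volume volume
      ((isCompact_collarPiece hΩ hκ A α k).image_of_continuousOn
        ((continuousOn_tubePar hκ _).mono (collarPiece_subset A hα k))) ?_
    rintro _ ⟨y, hy, rfl⟩
    exact (contDiffOn_tubeCoords hκ _).contDiffAt ((isOpen_tubePatch hκ _).mem_nhds
      (tubePar_coords hκ _ (collarPiece_subset A hα k hy)).1)
  choose C₁ hC₁ using h1
  choose C₂ hC₂ using h2
  -- The summand 1 accounts for the points that Φ fixes. In each chart, C₂ is the cost of
  -- straightening the collar, L that of the displacement along the fibres, and C₁ that of returning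
  -- to the tube.
  refine ⟨1 + ∑ k, C₁ k * (L * C₂ k), le_self_add, fun m η U V Φ hm hηc hη hΦ => ?_⟩
  have hVm := hΦ.isOpen_source.measurableSet
  have hUm := hΦ.isOpen_target.measurableSet
  have hΦm : AEMeasurable Φ (volume.restrict V) :=
    (hΦ.continuousOn hΩ hκ A hα hm hηc hη).aemeasurable hVm
  refine Measure.le_iff.2 fun E hE => ?_
  rw [Measure.map_apply_of_aemeasurable hΦm hE, Measure.restrict_apply' hVm, Measure.smul_apply,
    Measure.restrict_apply hE, smul_eq_mul]
  have hEU : MeasurableSet (E ∩ U) := hE.inter hUm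
  let ρ : Fin A.card → Euc 2 → ℝ → ℝ := fun k z t => t + m (η ((A.chart k).par z), t)
  let S : Fin A.card → Set (Euc 2 × ℝ) := fun k =>
    {y ∈ collarPiece A α k | tubePar (A.chart k) y ∈ E ∩ U}
  let P : Fin A.card → Set (Euc 2 × ℝ) := fun k =>
    {y ∈ collarPiece A α k | (y.1, ρ k y.1 y.2) ∈ S k}
  have hKm : ∀ k, MeasurableSet (collarPiece A α k) := fun k =>
    (isCompact_collarPiece hΩ hκ A α k).measurableSet
  have hSm : ∀ k, MeasurableSet (S k) := fun k =>
    measurableSet_inter_preimage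
      ((continuousOn_tubePar hκ _).mono (collarPiece_subset A hα k)) (hKm k) hEU
  have hηpar : ∀ k, ∀ y ∈ collarPiece A α k, η ((A.chart k).par y.1) ∈ Ioo (-a) a := fun k y hy =>
    hη _ ((A.chart k).par_mem (collarPiece_subset A hα k hy).1)
  have hPm : ∀ k, MeasurableSet (P k) := by
    intro k
    refine measurableSet_inter_preimage (f := fun y : Euc 2 × ℝ => (y.1, ρ k y.1 y.2)) ?_
      (hKm k) (hSm k)
    have h3 : ContinuousOn (fun y : Euc 2 × ℝ => (η ((A.chart k).par y.1), y.2))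
        (collarPiece A α k) := by
      refine ContinuousOn.prodMk ?_ continuousOn_snd
      refine (hηc.comp (A.chart k).contDiffOn.continuousOn
        fun z hz => (A.chart k).par_mem hz).comp continuousOn_fst fun y hy => ?_
      exact (collarPiece_subset A hα k hy).1
    exact continuousOn_fst.prodMk (continuousOn_snd.add
      (hm.contDiffOn.continuousOn.comp h3 fun y hy => ⟨hηpar k y hy, mem_univ _⟩))
  -- A point of the collar keeps its foot point and its displaced height stays in [-α, α], so its
  -- image is described in the same chart piece as the point itself.
  have hcover : Φ ⁻¹' E ∩ V ⊆ (E ∩ U) ∪ ⋃ k, tubePar (A.chart k) '' P k := by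
    rintro x ⟨hxE, hxV⟩
    have hxU : Φ x ∈ E ∩ U := ⟨hxE, hΦ.mapsTo hxV⟩
    by_cases hx : x ∈ collar Ω α
    · right
      have hx' := hx
      rw [collar_eq_iUnion hκ A hα, mem_iUnion] at hx'
      obtain ⟨k, y, hy, rfl⟩ := hx'
      rw [mem_iUnion]
      refine ⟨k, y, ⟨hy, ?_⟩, rfl⟩
      obtain ⟨-, c2, -, c4⟩ := tubePar_coords hκ _ (collarPiece_subset A hα k hy)
      have h4 := hΦ.eq_on_tube _ hxV hx.1
      have h5 := hΦ.displaced_le _ hxV hx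
      rw [c2, c4] at h4 h5
      refine ⟨⟨hy.1, abs_le.1 h5⟩, ?_⟩
      rwa [h4] at hxU
    · left
      rwa [hΦ.eq_self hκ hm hη hxV hx] at hxU
  have hpiece : ∀ k, volume (tubePar (A.chart k) '' P k) ≤
      (C₁ k * (L * C₂ k) : ℝ≥0) * volume (E ∩ U) := by
    intro k
    have e1 : volume (tubePar (A.chart k) '' P k) ≤ C₁ k * volume (P k) := hC₁ k _ fun y hy => hy.1
    have e2 : volume (P k) ≤ L * volume (S k) :=
      measure_fiber_preimage_le (volume : Measure (Euc 2)) (hSm k) (hPm k)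
        fun y hy => hm.antilipschitz _ (hηpar k y hy)
    have e3 : volume (S k) ≤ C₂ k * volume (E ∩ U) := by
      have h6 : S k ⊆ (fun x => (footCoord (A.chart k) x, tubeHeight Ω x)) ''
          (tubePar (A.chart k) '' S k) := by
        intro y hy
        obtain ⟨-, -, c3, c4⟩ := tubePar_coords hκ _ (collarPiece_subset A hα k hy.1)
        exact ⟨_, mem_image_of_mem _ hy, Prod.ext c3 c4⟩
      refine (measure_mono h6).trans ((hC₂ k _ (image_mono fun y hy => hy.1)).trans ?_)
      gcongr
      rintro _ ⟨y, hy, rfl⟩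
      exact hy.2
    calc _ ≤ C₁ k * (L * (C₂ k * volume (E ∩ U))) := by
          refine e1.trans ?_
          gcongr
          refine e2.trans ?_
          gcongr
      _ = _ := by push_cast; ring
  calc volume (Φ ⁻¹' E ∩ V) ≤ volume (E ∩ U) + ∑ k, volume (tubePar (A.chart k) '' P k) := by
        refine (measure_mono hcover).trans ((measure_union_le _ _).trans ?_)
        gcongr
        exact measure_iUnion_fintype_le _ _
    _ ≤ volume (E ∩ U) + ∑ k, (C₁ k * (L * C₂ k) : ℝ≥0) * volume (E ∩ U) := by
        gcongr with k
        exact hpiece k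
    _ = _ := by
        rw [← Finset.sum_mul]
        push_cast
        ring

end TubeMap

/-! ### Approximation of functions constant along the normal lines -/

lemma eLpNorm_fun_sum_le {X E ι : Type*} [MeasurableSpace X] [NormedAddCommGroup E] [Fintype ι]
    {μ : Measure X} {f : ι → X → E} (hf : ∀ i, AEStronglyMeasurable (f i) μ) {p : ℝ≥0∞}
    (hp : 1 ≤ p) : eLpNorm (fun x => ∑ i, f i x) p μ ≤ ∑ i, eLpNorm (f i) p μ := by
  have := eLpNorm_sum_le (s := Finset.univ) (fun i _ => hf i) hp
  rwa [show ∑ i, f i = fun x => ∑ i, f i x by ext1 x; rw [Finset.sum_apply]] at this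

section FootLift

variable {Ω : Set (Euc 3)}

/-- The differential on the tube induced by a differential `H` in the coordinates of a chart. -/
noncomputable def footPullback (c : SurfaceChart (frontier Ω)) (H : Euc 2 → Euc 2 →L[ℝ] ℝ) :
    Euc 3 → Euc 3 →L[ℝ] ℝ :=
  (tubePatch c).indicator fun x => (H (footCoord c x)).comp (fderiv ℝ (footCoord c) x)

lemma footPullback_sub (c : SurfaceChart (frontier Ω)) (H H' : Euc 2 → Euc 2 →L[ℝ] ℝ) :
    footPullback c (fun z => H z - H' z) = fun x => footPullback c H x - footPullback c H' x := by
  funext x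
  by_cases hx : x ∈ tubePatch c
  · simp [footPullback, indicator_of_mem hx]
  · simp [footPullback, indicator_of_notMem hx]

/-- Functions of the foot point that are `C¹` and compactly supported in a chart. -/
lemma contDiffOn_indicator_footCoord (hκ : 0 < tubeRadius Ω) (A : SurfaceAtlas (frontier Ω))
    (c : SurfaceChart (frontier Ω)) {K : Set (Euc 2)} (hK : IsCompact K) (hKc : K ⊆ c.dom)
    {f : Euc 2 → ℝ} (hf : ContDiff ℝ ∞ f) (hf0 : ∀ z ∉ K, f z = 0) :
    ContDiffOn ℝ 1 ((tubePatch c).indicator (f ∘ footCoord c)) (tube Ω (tubeRadius Ω)) ∧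
      ∀ x ∈ tube Ω (tubeRadius Ω), fderiv ℝ ((tubePatch c).indicator (f ∘ footCoord c)) x =
        footPullback c (fderiv ℝ f) x := by
  have hpatch : ∀ x ∈ tubePatch c, (tubePatch c).indicator (f ∘ footCoord c) =ᶠ[𝓝 x]
      f ∘ footCoord c := fun x hx => by
    filter_upwards [(isOpen_tubePatch hκ c).mem_nhds hx] with y hy
    exact indicator_of_mem hy _
  have hfc : ∀ x ∈ tubePatch c, ContDiffAt ℝ 1 (footCoord c) x := fun x hx =>
    (contDiffOn_footCoord hκ c).contDiffAt ((isOpen_tubePatch hκ c).mem_nhds hx)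
  have hoff : ∀ x ∈ tube Ω (tubeRadius Ω), x ∉ tubePatch c →
      (tubePatch c).indicator (f ∘ footCoord c) =ᶠ[𝓝 x] fun _ => 0 := by
    intro x hx hxc
    have hfoot := (contDiffOn_foot hκ A).continuousOn.continuousAt ((isOpen_tube _).mem_nhds hx)
    have hcl : IsClosed (c.par '' K) :=
      (hK.image_of_continuousOn (c.contDiffOn.continuousOn.mono hKc)).isClosed
    have hx' : foot Ω x ∈ (c.par '' K)ᶜ := fun h => hxc ⟨hx, image_mono hKc h⟩
    filter_upwards [hfoot.eventually_mem (hcl.isOpen_compl.mem_nhds hx')] with y hy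
    by_cases hyc : y ∈ tubePatch c
    · rw [indicator_of_mem hyc]
      refine hf0 _ fun hyK => hy ?_
      rw [← (tubePatch_coords hκ c hyc).2.1]
      exact mem_image_of_mem _ hyK
    · exact indicator_of_notMem hyc _
  refine ⟨fun x hx => ContDiffAt.contDiffWithinAt ?_, fun x hx => ?_⟩
  · by_cases hxc : x ∈ tubePatch c
    · exact ((hf.of_le (by simp)).contDiffAt.comp x (hfc x hxc)).congr_of_eventuallyEq
        (hpatch x hxc)
    · exact contDiffAt_const.congr_of_eventuallyEq (hoff x hx hxc)
  · by_cases hxc : x ∈ tubePatch c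
    · rw [(hpatch x hxc).fderiv_eq, footPullback, indicator_of_mem hxc]
      exact fderiv_comp x ((hf.differentiable (by simp)) _)
        ((hfc x hxc).differentiableAt one_ne_zero)
    · rw [(hoff x hx hxc).fderiv_eq, footPullback, indicator_of_notMem hxc]
      simp

/-- The collar over K is, up to bounded distortion, K times an interval of length 2α. Hence
`footCoord` maps its volume to at most a multiple of planar Lebesgue measure, while the differential
of `footCoord` is bounded there by compactness. The constant serves all finite exponents. -/
lemma exists_eLpNorm_footPullback_le (hΩ : IsC4Domain Ω) (hκ : 0 < tubeRadius Ω)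
    (A : SurfaceAtlas (frontier Ω)) (c : SurfaceChart (frontier Ω))
    {K : Set (Euc 2)} (hK : IsCompact K) (hKc : K ⊆ c.dom) {α : ℝ} (hα : α < tubeRadius Ω) :
    ∃ C : ℝ≥0, ∀ H : Euc 2 → Euc 2 →L[ℝ] ℝ, AEStronglyMeasurable H volume → (∀ z ∉ K, H z = 0) →
      AEStronglyMeasurable (footPullback c H) (volume.restrict (collar Ω α)) ∧
      ∀ q : ℝ≥0, 1 ≤ q → eLpNorm (footPullback c H) q (volume.restrict (collar Ω α)) ≤
        C * eLpNorm H q volume := by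
  have hdim : Module.finrank ℝ (Euc 2 × ℝ) = Module.finrank ℝ (Euc 3) := by simp
  have : (volume : Measure (Euc 2 × ℝ)).IsAddHaarMeasure := by
    rw [Measure.volume_eq_prod]; infer_instance
  have hQ : IsCompact (K ×ˢ Icc (-α) α) := hK.prod isCompact_Icc
  have hQd : K ×ˢ Icc (-α) α ⊆ tubeDom c := prod_mono hKc fun _ ht =>
    ⟨(neg_lt_neg hα).trans_le ht.1, ht.2.trans_lt hα⟩
  obtain ⟨C₁, hC₁⟩ := exists_measure_image_le hdim volume volume hQ fun y hy =>
    contDiffAt_tubePar hκ c (hQd hy)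
  set W := tubePar c '' (K ×ˢ Icc (-α) α)
  have hW : IsCompact W := hQ.image_of_continuousOn ((continuousOn_tubePar hκ c).mono hQd)
  have hWp : W ⊆ tubePatch c := by
    rintro _ ⟨y, hy, rfl⟩
    exact (tubePar_coords hκ c (hQd hy)).1
  have hWc : W ⊆ collar Ω α := by
    rintro _ ⟨y, hy, rfl⟩
    obtain ⟨h1, -, -, h4⟩ := tubePar_coords hκ c (hQd hy)
    exact ⟨h1.1, by rw [h4]; exact abs_le.2 hy.2⟩
  have hfoot : ContinuousOn (footCoord c) W := (contDiffOn_footCoord hκ c).continuousOn.mono hWp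
  have hfm : AEMeasurable (footCoord c) (volume.restrict W) := hfoot.aemeasurable hW.measurableSet
  have hdfoot : ContinuousOn (fderiv ℝ (footCoord c)) W :=
    ((contDiffOn_footCoord hκ c).continuousOn_fderiv_of_isOpen (isOpen_tubePatch hκ c)
      le_rfl).mono hWp
  obtain ⟨B, hB⟩ := hW.exists_bound_of_continuousOn hdfoot
  set C₂ : ℝ≥0 := 1 + C₁ * (2 * α).toNNReal
  have hmap : (volume.restrict W).map (footCoord c) ≤ (C₂ : ℝ≥0∞) • volume := by
    refine Measure.le_iff.2 fun E hE => ?_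
    rw [Measure.map_apply_of_aemeasurable hfm hE, Measure.restrict_apply' hW.measurableSet,
      Measure.smul_apply, smul_eq_mul]
    have hsub : footCoord c ⁻¹' E ∩ W ⊆ tubePar c '' ((E ∩ K) ×ˢ Icc (-α) α) := by
      rintro _ ⟨hxE, ⟨y, hy, rfl⟩⟩
      refine mem_image_of_mem _ ⟨⟨?_, hy.1⟩, hy.2⟩
      rwa [mem_preimage, (tubePar_coords hκ c (hQd hy)).2.2.1] at hxE
    calc _ ≤ C₁ * volume ((E ∩ K) ×ˢ Icc (-α) α) := (measure_mono hsub).trans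
          (hC₁ _ (prod_mono inter_subset_right le_rfl))
      _ = (C₁ * (2 * α).toNNReal : ℝ≥0) * volume (E ∩ K) := by
          rw [Measure.volume_eq_prod, Measure.prod_prod, Real.volume_Icc, ENNReal.ofReal,
            show α - -α = 2 * α by ring]
          push_cast
          ring
      _ ≤ C₂ * volume E := by
          gcongr
          · exact le_add_self
          · exact inter_subset_left
  refine ⟨B.toNNReal * C₂, fun H hH hH0 => ?_⟩
  have hind : EqOn (footPullback c H)
      (W.indicator fun x => (H (footCoord c x)).comp (fderiv ℝ (footCoord c) x))
      (collar Ω α) := by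
    intro x hx
    by_cases hxW : x ∈ W
    · rw [indicator_of_mem hxW, footPullback, indicator_of_mem (hWp hxW)]
    rw [indicator_of_notMem hxW]
    by_cases hxc : x ∈ tubePatch c
    · rw [footPullback, indicator_of_mem hxc, hH0, ContinuousLinearMap.zero_comp]
      intro hxK
      obtain ⟨-, -, h3⟩ := tubePatch_coords hκ c hxc
      exact hxW ⟨_, ⟨hxK, abs_le.1 hx.2⟩, h3⟩
    · exact indicator_of_notMem hxc _
  have hmeas : AEStronglyMeasurable
      (fun x => (H (footCoord c x)).comp (fderiv ℝ (footCoord c) x)) (volume.restrict W) := by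
    have h1 : AEStronglyMeasurable (H ∘ footCoord c) (volume.restrict W) :=
      (hH.mono_ac (Measure.absolutelyContinuous_of_le_smul hmap)).comp_aemeasurable hfm
    exact (isBoundedBilinearMap_comp (𝕜 := ℝ)).continuous.comp_aestronglyMeasurable
      (h1.prodMk (hdfoot.aestronglyMeasurable_of_isCompact hW hW.measurableSet))
  have hrestr : (volume.restrict (collar Ω α)).restrict W = volume.restrict W := by
    rw [Measure.restrict_restrict hW.measurableSet, inter_eq_left.2 hWc]
  have hae : footPullback c H =ᵐ[volume.restrict (collar Ω α)]
      W.indicator fun x => (H (footCoord c x)).comp (fderiv ℝ (footCoord c) x) :=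
    (ae_restrict_mem (isCompact_collar hΩ hκ A hα).measurableSet).mono hind
  refine ⟨?_, fun q hq => ?_⟩
  · refine AEStronglyMeasurable.congr ?_ hae.symm
    rw [aestronglyMeasurable_indicator_iff hW.measurableSet, hrestr]
    exact hmeas
  · rw [eLpNorm_congr_ae hae]
    rw [← eLpNorm_restrict_of_eq_zero (s := W) fun x hx => indicator_of_notMem hx _, hrestr]
    have h1 : eLpNorm (W.indicator fun x =>
        (H (footCoord c x)).comp (fderiv ℝ (footCoord c) x)) q (volume.restrict W) ≤
        B.toNNReal * eLpNorm ((fun z => ‖H z‖) ∘ footCoord c) q (volume.restrict W) := by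
      refine eLpNorm_le_nnreal_smul_eLpNorm_of_ae_le_mul (c := B.toNNReal) ?_ q
      filter_upwards [ae_restrict_mem hW.measurableSet] with x hx
      rw [← NNReal.coe_le_coe, indicator_of_mem hx]
      push_cast
      rw [Function.comp_apply, norm_norm, mul_comm]
      refine (ContinuousLinearMap.opNorm_comp_le _ _).trans ?_
      gcongr
      exact (hB x hx).trans (Real.le_coe_toNNReal _)
    refine h1.trans ?_
    have h2 := eLpNorm_comp_le_of_map_le (f := fun z => ‖H z‖) hfm le_self_add hmap hq hH.norm
    rw [eLpNorm_norm] at h2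
    rw [ENNReal.coe_mul, mul_assoc]
    gcongr

/-- Functions of class `H²` on the boundary, extended constantly along the normal lines, are uniform
limits of `C¹` functions, with convergence of the differentials to an `L^q` limit. -/
theorem exists_height_approx (hΩ : IsC4Domain Ω) (hκ : 0 < tubeRadius Ω)
    (A : SurfaceAtlas (frontier Ω)) {α : ℝ} (hα : α < tubeRadius Ω) {q : ℝ≥0} (hq : 2 ≤ q) :
    ∃ C : ℝ≥0, ∀ (M : ℝ≥0) (η : Euc 3 → ℝ), ContinuousOn η (frontier Ω) → h2Norm A η ≤ M →
      ∃ (hn : ℕ → Euc 3 → ℝ) (G : Euc 3 → Euc 3 →L[ℝ] ℝ),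
        (∀ n, ContDiffOn ℝ 1 (hn n) (tube Ω (tubeRadius Ω))) ∧
        TendstoUniformlyOn hn (fun x => η (foot Ω x)) atTop (tube Ω (tubeRadius Ω)) ∧
        AEStronglyMeasurable G (volume.restrict (collar Ω α)) ∧
        eLpNorm G q (volume.restrict (collar Ω α)) ≤ C * (M + 1) ∧
        Tendsto (fun n => eLpNorm (fun x => fderiv ℝ (hn n) x - G x) 2
          (volume.restrict (collar Ω α))) atTop (𝓝 0) := by
  have h1 := fun k => exists_planar_approx (A.chart k).isOpen_dom
    (isCompact_chartSupport hΩ hκ A k) (chartSupport_subset A k) hq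
  choose C₁ K' hK' hK'd happ using h1
  have h2 := fun k => exists_eLpNorm_footPullback_le hΩ hκ A (A.chart k) (hK' k) (hK'd k) hα
  choose C₂ hC₂ using h2
  refine ⟨∑ k, C₂ k * C₁ k, fun M η hη hM => ?_⟩
  let v : Fin A.card → Euc 2 → ℝ := fun k z =>
    η ((A.chart k).par z) * A.weight k ((A.chart k).par z)
  have hvc : ∀ k, ContinuousOn (v k) (A.chart k).dom := fun k =>
    (hη.comp (A.chart k).contDiffOn.continuousOn fun z hz => (A.chart k).par_mem hz).mul
      (A.weight_contDiffOn k).continuousOn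
  have hv0 : ∀ k, ∀ z ∈ (A.chart k).dom \ chartSupport A k, v k z = 0 := by
    rintro k z ⟨hz, hzs⟩
    have : A.weight k ((A.chart k).par z) = 0 := by
      by_contra hne
      exact hzs ⟨hz, subset_closure ⟨(A.chart k).par_mem hz, hne⟩⟩
    simp only [v, this, mul_zero]
  have hvM : ∀ k, sobolevNorm (A.chart k).dom 2 2 (v k) ≤ M := fun k =>
    (Finset.single_le_sum (f := fun k => sobolevNorm (A.chart k).dom 2 2 (v k))
      (fun _ _ => zero_le) (Finset.mem_univ k)).trans hM
  choose fn G hfn hfn0 hunif hGm hG0 hGq hGlim using fun k =>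
    happ k (v k) (hvc k) (hv0 k) M (hvM k)
  have hlift := fun k n => contDiffOn_indicator_footCoord hκ A (A.chart k) (hK' k) (hK'd k)
    (hfn k n) (hfn0 k n)
  have hfd0 : ∀ k n, ∀ z ∉ K' k, fderiv ℝ (fn k n) z = 0 := by
    intro k n z hz
    have : fn k n =ᶠ[𝓝 z] fun _ => 0 := by
      filter_upwards [(hK' k).isClosed.isOpen_compl.mem_nhds hz] with y hy using hfn0 k n y hy
    rw [this.fderiv_eq]
    simp
  have hcm : MeasurableSet (collar Ω α) := (isCompact_collar hΩ hκ A hα).measurableSet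
  have hq1 : 1 ≤ q := one_le_two.trans hq
  -- Each localized piece of η is approximated in its own chart and lifted to the tube by the foot
  -- coordinate; the partition of unity reassembles η.
  refine ⟨fun n x => ∑ k, (tubePatch (A.chart k)).indicator (fn k n ∘ footCoord (A.chart k)) x,
    fun x => ∑ k, footPullback (A.chart k) (G k) x, ?_, ?_, ?_, ?_, ?_⟩
  · exact fun n => ContDiffOn.sum fun k _ => (hlift k n).1
  · have heq : ∀ x ∈ tube Ω (tubeRadius Ω), η (foot Ω x) =
        ∑ k, (tubePatch (A.chart k)).indicator (v k ∘ footCoord (A.chart k)) x := by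
      intro x hx
      have h3 : ∀ k, (tubePatch (A.chart k)).indicator (v k ∘ footCoord (A.chart k)) x =
          η (foot Ω x) * A.weight k (foot Ω x) := by
        intro k
        by_cases hxk : x ∈ tubePatch (A.chart k)
        · rw [indicator_of_mem hxk]
          simp only [v, Function.comp_apply, (tubePatch_coords hκ _ hxk).2.1]
        · rw [indicator_of_notMem hxk]
          have : A.weight k (foot Ω x) = 0 := by
            by_contra hne
            exact hxk ⟨hx, A.weight_support k (subset_closure ⟨(tubeInv_mem hκ hx).1, hne⟩)⟩
          rw [this, mul_zero]
      simp only [h3]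
      rw [← Finset.mul_sum, A.weight_sum _ (tubeInv_mem hκ hx).1, mul_one]
    rw [Metric.tendstoUniformlyOn_iff]
    intro ε hε
    -- One more than the number of charts, so that the sum of the errors is strictly below ε.
    have hδ : 0 < ε / (A.card + 1) := by positivity
    filter_upwards [eventually_all.2 fun k => Metric.tendstoUniformly_iff.1 (hunif k) _ hδ]
      with n hn x hx
    rw [heq x hx]
    calc _ ≤ ∑ k : Fin A.card, ε / (A.card + 1) := by
          refine (dist_sum_sum_le _ _ _).trans (Finset.sum_le_sum fun k _ => ?_)
          by_cases hxk : x ∈ tubePatch (A.chart k)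
          · rw [indicator_of_mem hxk, indicator_of_mem hxk]
            have h4 := hn k (footCoord (A.chart k) x)
            rw [indicator_of_mem (tubePatch_coords hκ _ hxk).1.1] at h4
            exact h4.le
          · rw [indicator_of_notMem hxk, indicator_of_notMem hxk, dist_self]
            exact hδ.le
      _ < ε := by
          rw [Finset.sum_const, Finset.card_univ, Fintype.card_fin, nsmul_eq_mul, ← mul_div_assoc,
            div_lt_iff₀ (by positivity)]
          linarith
  · exact Finset.aestronglyMeasurable_fun_sum _ fun k _ => (hC₂ k (G k) (hGm k) (hG0 k)).1
  · calc _ ≤ ∑ k, eLpNorm (footPullback (A.chart k) (G k)) q (volume.restrict (collar Ω α)) :=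
          eLpNorm_fun_sum_le (fun k => (hC₂ k (G k) (hGm k) (hG0 k)).1) (by exact_mod_cast hq1)
      _ ≤ ∑ k, (C₂ k * C₁ k : ℝ≥0) * (M + 1 : ℝ≥0∞) := by
          refine Finset.sum_le_sum fun k _ => ((hC₂ k (G k) (hGm k) (hG0 k)).2 q hq1).trans ?_
          rw [ENNReal.coe_mul, mul_assoc]
          gcongr
          exact hGq k
      _ = _ := by
          rw [← Finset.sum_mul]
          push_cast
          ring
  · have hdm : ∀ k n, AEStronglyMeasurable (fun z => fderiv ℝ (fn k n) z - G k z) volume :=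
      fun k n => ((hfn k n).continuous_fderiv (by simp)).aestronglyMeasurable.sub (hGm k)
    have hd := fun k n => hC₂ k (fun z => fderiv ℝ (fn k n) z - G k z) (hdm k n)
      fun z hz => by rw [hfd0 k n z hz, hG0 k z hz, sub_zero]
    refine tendsto_of_tendsto_of_tendsto_of_le_of_le (g := fun _ => (0 : ℝ≥0∞))
      (h := fun n => ∑ k, C₂ k * eLpNorm (fun z => fderiv ℝ (fn k n) z - G k z) 2 volume)
      tendsto_const_nhds ?_ (fun _ => zero_le) fun n => ?_
    · have h5 := tendsto_finsetSum (Finset.univ : Finset (Fin A.card)) fun k _ =>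
        ENNReal.Tendsto.const_mul (a := (C₂ k : ℝ≥0∞)) (hGlim k) (Or.inr ENNReal.coe_ne_top)
      simpa using h5
    · have h6 : (fun x => fderiv ℝ (fun x => ∑ k, (tubePatch (A.chart k)).indicator
          (fn k n ∘ footCoord (A.chart k)) x) x - ∑ k, footPullback (A.chart k) (G k) x)
          =ᵐ[volume.restrict (collar Ω α)]
          fun x => ∑ k, footPullback (A.chart k) (fun z => fderiv ℝ (fn k n) z - G k z) x := by
        filter_upwards [ae_restrict_mem hcm] with x hx
        rw [fderiv_fun_sum fun k _ => ((hlift k n).1.contDiffAt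
          ((isOpen_tube _).mem_nhds hx.1)).differentiableAt one_ne_zero, ← Finset.sum_sub_distrib]
        refine Finset.sum_congr rfl fun k _ => ?_
        rw [(hlift k n).2 x hx.1, footPullback_sub]
      rw [eLpNorm_congr_ae h6]
      refine (eLpNorm_fun_sum_le (fun k => (hd k n).1) one_le_two).trans ?_
      exact Finset.sum_le_sum fun k _ => (hd k n).2 2 one_le_two

end FootLift

/-! ### Cut-off functions and the displacements they induce -/

/-- Take the primitive of a normalized bump centred at -1/2 with support inside (-1, 0). With θ =
1/T its height is at most 1 / (2 rIn) = 1 / (1 - θ/2), and (1 - θ) / (1 - θ/2) < 1. The outer radius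
stays below 1/2, so β is locally constant near -1 and 0. -/
theorem exists_isCutoff {T : ℝ≥0} (hT : 1 ≤ T) : ∃ β : ℝ → ℝ, IsCutoff T β := by
  have hT' : (1 : ℝ) ≤ T := by exact_mod_cast hT
  have hTinv : 0 < (T : ℝ)⁻¹ ∧ (T : ℝ)⁻¹ ≤ 1 := ⟨by positivity, inv_le_one_of_one_le₀ hT'⟩
  set θ := (T : ℝ)⁻¹
  let f : ContDiffBump (-1 / 2 : ℝ) :=
    { rIn := 1 / 2 * (1 - θ / 2), rOut := 1 / 2 * (1 - θ / 4),
      rIn_pos := by linarith, rIn_lt_rOut := by linarith }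
  have hIn : f.rIn = 1 / 2 * (1 - θ / 2) := rfl
  have hOut : f.rOut = 1 / 2 * (1 - θ / 4) := rfl
  set g := f.normed volume
  have hg : Continuous g := f.continuous_normed
  have hsupp : ∀ x, g x ≠ 0 → |x + 1 / 2| < 1 / 2 * (1 - θ / 4) := by
    intro x hx
    have : x ∈ Function.support g := hx
    rw [f.support_normed_eq, Metric.mem_ball, Real.dist_eq, hOut] at this
    rwa [show x - -1 / 2 = x + 1 / 2 by ring] at this
  have hderiv : ∀ s, HasDerivAt (fun s => ∫ x in (-2 : ℝ)..s, g x) (g s) s := fun s =>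
    intervalIntegral.integral_hasDerivAt_right (hg.intervalIntegrable _ _)
      hg.stronglyMeasurable.stronglyMeasurableAtFilter hg.continuousAt
  have hderiv' : deriv (fun s => ∫ x in (-2 : ℝ)..s, g x) = g := funext fun s => (hderiv s).deriv
  refine ⟨fun s => ∫ x in (-2 : ℝ)..s, g x, ?_, ?_, ?_, ?_⟩
  · rw [contDiff_infty_iff_deriv, hderiv']
    exact ⟨fun s => (hderiv s).differentiableAt, f.contDiff_normed⟩
  · have h1 : Ioo (-2 : ℝ) (-1 + θ / 8) ∈ 𝓝 (-1 : ℝ) :=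
      Ioo_mem_nhds (by norm_num) (by linarith)
    filter_upwards [h1] with s hs
    refine intervalIntegral.integral_zero_ae (Eventually.of_forall fun x hx => ?_)
    rw [uIoc_of_le hs.1.le] at hx
    by_contra hne
    have := abs_lt.1 (hsupp x hne)
    linarith [hx.2, hs.2]
  · have h1 : Ioi (-θ / 8) ∈ 𝓝 (0 : ℝ) := Ioi_mem_nhds (by linarith)
    filter_upwards [h1] with s hs
    rw [intervalIntegral.integral_eq_integral_of_support_subset, f.integral_normed]
    intro x hx
    have := abs_lt.1 (hsupp x hx)
    rw [mem_Ioi] at hs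
    exact ⟨by linarith, by linarith⟩
  · intro s _
    rw [hderiv', abs_of_nonneg (f.nonneg_normed s)]
    have h1 : g s ≤ 1 / (1 - θ / 2) := by
      refine (f.normed_le_div_measure_closedBall_rIn volume s).trans_eq ?_
      rw [Real.volume_real_closedBall f.rIn_pos.le, hIn]
      ring_nf
    calc g s * (1 - θ) ≤ 1 / (1 - θ / 2) * (1 - θ) := by
          gcongr
          linarith
      _ < 1 := by
          rw [div_mul_eq_mul_div, one_mul, div_lt_one (by linarith)]
          linarith

/-- `γ` is a transition from `0` on `(-∞, -α]` to `1` on `[0, ∞)`, of slope less than `1 / a`. -/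
structure IsTransition (α a : ℝ) (K : ℝ≥0) (γ : ℝ → ℝ) : Prop where
  contDiff : ContDiff ℝ 1 γ
  eq_zero : ∀ t ≤ -α, γ t = 0
  eq_one : ∀ t, 0 ≤ t → γ t = 1
  abs_deriv_le : ∀ t, |deriv γ t| ≤ K
  mul_lt_one : a * K < 1
  pos : 0 < a
  le : a ≤ α

theorem IsCutoff.exists_transition {T : ℝ≥0} (hT : 1 ≤ T) {β : ℝ → ℝ} (hβ : IsCutoff T β) {κ : ℝ}
    (hκ : 0 < κ) : ∃ (γ : ℝ → ℝ) (α a : ℝ) (K : ℝ≥0), IsTransition α a K γ ∧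
      (1 - (T : ℝ)⁻¹) * κ < a ∧ α < κ ∧ ∀ t ∈ Icc (-κ) 0, γ t = β (t / κ) := by
  classical
  have hT' : (1 : ℝ) ≤ T := by exact_mod_cast hT
  have hTinv : 0 < (T : ℝ)⁻¹ ∧ (T : ℝ)⁻¹ ≤ 1 := ⟨by positivity, inv_le_one_of_one_le₀ hT'⟩
  have hβ1 : ContDiff ℝ 1 β := hβ.contDiff.of_le (by simp)
  obtain ⟨s₀, hs₀, hmax⟩ := isCompact_Icc.exists_isMaxOn (nonempty_Icc.2 (by norm_num))
    ((hβ1.continuous_deriv le_rfl).abs.continuousOn (s := Icc (-1 : ℝ) 0))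
  set B := |deriv β s₀|
  have hB : ∀ s ∈ Icc (-1 : ℝ) 0, |deriv β s| ≤ B := fun s hs => hmax hs
  have hB0 : 0 ≤ B := abs_nonneg _
  -- The maximum B of |β'| is attained, so B (1 - 1/T) < 1 is strict and persists for some θ
  -- slightly above 1 - 1/T. This is the room that makes all constants uniform in η.
  obtain ⟨θ, ⟨hθ1, hθB⟩, hθ⟩ : ∃ θ : ℝ, (θ < 1 ∧ B * θ < 1) ∧ 1 - (T : ℝ)⁻¹ < θ := by
    have h1 : ∀ᶠ θ in 𝓝 (1 - (T : ℝ)⁻¹), θ < 1 ∧ B * θ < 1 :=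
      (gt_mem_nhds (by linarith)).and
        ((continuous_const.mul continuous_id).tendsto _ |>.eventually
          (gt_mem_nhds (hβ.deriv_lt s₀ hs₀)))
    exact ((h1.filter_mono nhdsWithin_le_nhds).and self_mem_nhdsWithin).exists (f := 𝓝[>] _)
  have hθ0 : 0 < θ := by linarith
  obtain ⟨δ, hδ, hδ0⟩ := Metric.eventually_nhds_iff.1 hβ.eq_zero
  let γ : ℝ → ℝ := fun t => if t < -κ then 0 else if 0 ≤ t then 1 else β (t / κ)
  have hβ0 : β 0 = 1 := hβ.eq_one.self_of_nhds
  have hmid : ∀ t ∈ Icc (-κ) 0, γ t = β (t / κ) := by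
    intro t ht
    simp only [γ, if_neg ht.1.not_gt]
    split_ifs with h
    · rw [le_antisymm ht.2 h, zero_div, hβ0]
    · rfl
  have hdiv : Continuous fun t : ℝ => t / κ := by fun_prop
  have hleft : ∀ t ≤ -κ, γ =ᶠ[𝓝 t] fun _ => 0 := by
    intro t ht
    have h1 : ∀ᶠ u in 𝓝 t, u < 0 := gt_mem_nhds (by linarith)
    rcases ht.lt_or_eq with ht | rfl
    · filter_upwards [gt_mem_nhds ht] with u hu
      simp [γ, hu]
    · have h2 : ∀ᶠ u in 𝓝 (-κ), β (u / κ) = 0 := by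
        have := hdiv.tendsto (-κ)
        rw [neg_div, div_self hκ.ne'] at this
        exact this.eventually hβ.eq_zero
      filter_upwards [h1, h2] with u h3 h4
      simp only [γ, if_neg h3.not_ge, h4, ite_self]
  have hright : ∀ t, 0 ≤ t → γ =ᶠ[𝓝 t] fun _ => 1 := by
    intro t ht
    have h1 : ∀ᶠ u in 𝓝 t, -κ < u := lt_mem_nhds (by linarith)
    rcases ht.lt_or_eq with ht | rfl
    · filter_upwards [h1, lt_mem_nhds ht] with u h2 h3
      simp only [γ, if_neg h2.not_gt, if_pos h3.le]
    · have h2 : ∀ᶠ u in 𝓝 (0 : ℝ), β (u / κ) = 1 := by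
        have := hdiv.tendsto 0
        rw [zero_div] at this
        exact this.eventually hβ.eq_one
      filter_upwards [h1, h2] with u h3 h4
      simp only [γ, if_neg h3.not_gt, h4, ite_self]
  have hmid' : ∀ t ∈ Ioo (-κ) 0, γ =ᶠ[𝓝 t] fun u => β (u / κ) := fun t ht => by
    filter_upwards [Ioo_mem_nhds ht.1 ht.2] with u hu
    exact hmid u (Ioo_subset_Icc_self hu)
  have hβd : ∀ t, HasDerivAt (fun u => β (u / κ)) (deriv β (t / κ) * (1 / κ)) t := fun t =>
    HasDerivAt.comp t ((hβ1.differentiable one_ne_zero) _).hasDerivAt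
      ((hasDerivAt_id t).div_const κ)
  -- Here a = θκ and K = B/κ, so a K = θB < 1. The width α < κ is large enough to contain a and all
  -- heights where γ is in transition, as β vanishes within δ of -1.
  refine ⟨γ, max (θ * κ) ((1 - δ / 2) * κ), θ * κ, (B / κ).toNNReal, ?_, by gcongr, ?_, hmid⟩
  · refine ⟨?_, ?_, fun t ht => (hright t ht).self_of_nhds, ?_, ?_, by positivity, le_max_left _ _⟩
    · rw [contDiff_iff_contDiffAt]
      intro t
      rcases le_or_gt t (-κ) with h1 | h1
      · exact contDiffAt_const.congr_of_eventuallyEq (hleft t h1)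
      rcases le_or_gt 0 t with h2 | h2
      · exact contDiffAt_const.congr_of_eventuallyEq (hright t h2)
      · exact (hβ1.comp (contDiff_id.div_const κ)).contDiffAt.congr_of_eventuallyEq
          (hmid' t ⟨h1, h2⟩)
    · intro t ht
      rcases le_or_gt t (-κ) with h1 | h1
      · exact (hleft t h1).self_of_nhds
      have h2 : t ≤ -((1 - δ / 2) * κ) := ht.trans (neg_le_neg (le_max_right _ _))
      have h3 : t ≤ -(θ * κ) := ht.trans (neg_le_neg (le_max_left _ _))
      have h4 : 0 < θ * κ := by positivity
      rw [hmid t ⟨h1.le, by linarith⟩]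
      apply hδ0
      rw [Real.dist_eq, abs_lt, sub_neg_eq_add]
      have h5 : t / κ ≤ -(1 - δ / 2) := by
        rw [div_le_iff₀ hκ]; linarith
      have h6 : -1 < t / κ := by
        rw [lt_div_iff₀ hκ]; linarith
      constructor <;> linarith
    · intro t
      rcases le_or_gt t (-κ) with h1 | h1
      · rw [(hleft t h1).deriv_eq]; simp
      rcases le_or_gt 0 t with h2 | h2
      · rw [(hright t h2).deriv_eq]; simp
      · rw [(hmid' t ⟨h1, h2⟩).deriv_eq, (hβd t).deriv, abs_mul, Real.coe_toNNReal _ (by positivity),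
          abs_of_pos (by positivity : 0 < 1 / κ), mul_one_div]
        gcongr
        refine hB _ ⟨?_, ?_⟩
        · rw [le_div_iff₀ hκ]; linarith
        · exact div_nonpos_of_nonpos_of_nonneg h2.le hκ.le
    · rw [Real.coe_toNNReal _ (by positivity)]
      field_simp
      linarith
  · refine max_lt ?_ ?_
    · exact mul_lt_of_lt_one_left hκ hθ1
    · exact mul_lt_of_lt_one_left hκ (by linarith)

/-- The shift of the height induced by the transition `γ` and a displacement `e` of the boundary. -/
def heightShift (γ : ℝ → ℝ) (e t : ℝ) : ℝ := t + e * γ t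

/-- The inverse of `heightShift γ e`. -/
noncomputable def heightShiftInv (γ : ℝ → ℝ) (e : ℝ) : ℝ → ℝ := Function.invFun (heightShift γ e)

/-! ### Monotonicity, inversion and regularity of the height shift -/

namespace IsTransition

variable {α a : ℝ} {K : ℝ≥0} {γ : ℝ → ℝ}

lemma abs_sub_le (hγ : IsTransition α a K γ) (t t' : ℝ) : |γ t - γ t'| ≤ K * |t - t'| := by
  have h := lipschitzWith_of_nnnorm_deriv_le (C := K) (hγ.contDiff.differentiable one_ne_zero)
    fun t => by
      rw [← NNReal.coe_le_coe, coe_nnnorm, Real.norm_eq_abs]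
      exact hγ.abs_deriv_le t
  exact h.dist_le_mul t t'

lemma abs_mul_le (hγ : IsTransition α a K γ) {e : ℝ} (he : e ∈ Ioo (-a) a) (t t' : ℝ) :
    |e * γ t - e * γ t'| ≤ a * K * |t - t'| := by
  rw [← mul_sub, abs_mul, mul_assoc]
  exact mul_le_mul (abs_lt.2 he).le (hγ.abs_sub_le t t') (abs_nonneg _) hγ.pos.le

lemma le_abs_heightShift_sub (hγ : IsTransition α a K γ) {e : ℝ} (he : e ∈ Ioo (-a) a) (t t' : ℝ) :
    (1 - a * K) * |t - t'| ≤ |heightShift γ e t - heightShift γ e t'| := by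
  have h1 := hγ.abs_mul_le he t t'
  have h2 : |t - t'| ≤ |heightShift γ e t - heightShift γ e t'| + |e * γ t - e * γ t'| := by
    have h3 : t - t' = (heightShift γ e t - heightShift γ e t') - (e * γ t - e * γ t') := by
      simp only [heightShift]; ring
    calc |t - t'| = _ := by rw [h3]
      _ ≤ _ := abs_sub _ _
  linarith

lemma abs_heightShift_sub_le (hγ : IsTransition α a K γ) {e : ℝ} (he : e ∈ Ioo (-a) a) (t t' : ℝ) :
    |heightShift γ e t - heightShift γ e t'| ≤ 2 * |t - t'| := by
  have h1 := hγ.abs_mul_le he t t'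
  have h2 : heightShift γ e t - heightShift γ e t' = (t - t') + (e * γ t - e * γ t') := by
    simp only [heightShift]; ring
  rw [h2]
  have h3 : a * K * |t - t'| ≤ 1 * |t - t'| := by
    gcongr; exact hγ.mul_lt_one.le
  linarith [abs_add_le (t - t') (e * γ t - e * γ t')]

lemma strictMono_heightShift (hγ : IsTransition α a K γ) {e : ℝ} (he : e ∈ Ioo (-a) a) :
    StrictMono (heightShift γ e) := by
  intro t t' htt'
  have h1 := (abs_le.1 (hγ.abs_mul_le he t t')).2
  rw [abs_of_neg (sub_neg.2 htt')] at h1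
  have h2 : 0 < (1 - a * K) * (t' - t) :=
    mul_pos (by linarith [hγ.mul_lt_one]) (by linarith)
  simp only [heightShift]
  linarith

lemma heightShift_of_le (hγ : IsTransition α a K γ) (e : ℝ) {t : ℝ} (ht : t ≤ -α) :
    heightShift γ e t = t := by
  simp [heightShift, hγ.eq_zero t ht]

lemma heightShift_of_nonneg (hγ : IsTransition α a K γ) (e : ℝ) {t : ℝ} (ht : 0 ≤ t) :
    heightShift γ e t = t + e := by
  simp [heightShift, hγ.eq_one t ht]

/-- Surjectivity follows from the intermediate value theorem: the shift is the identity far to the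
left and a translation far to the right. -/
lemma heightShift_heightShiftInv (hγ : IsTransition α a K γ) (e s : ℝ) :
    heightShift γ e (heightShiftInv γ e s) = s := by
  apply Function.invFun_eq
  have hcont : Continuous (heightShift γ e) :=
    continuous_id.add (continuous_const.mul hγ.contDiff.continuous)
  refine mem_range_of_exists_le_of_exists_ge hcont ⟨min s (-α), ?_⟩ ⟨max 0 (s - e), ?_⟩
  · rw [hγ.heightShift_of_le e (min_le_right _ _)]
    exact min_le_left _ _
  · rw [hγ.heightShift_of_nonneg e (le_max_left _ _)]
    linarith [le_max_right 0 (s - e)]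

lemma heightShiftInv_heightShift (hγ : IsTransition α a K γ) {e : ℝ} (he : e ∈ Ioo (-a) a)
    (t : ℝ) : heightShiftInv γ e (heightShift γ e t) = t :=
  (hγ.strictMono_heightShift he).injective (hγ.heightShift_heightShiftInv e _)

/-- Inverse function theorem for (e, t) ↦ (e, t + eγ(t)). Its differential is triangular with entry
1 + eγ'(t) > 0, since |eγ'| ≤ a K < 1. Joint regularity in e is what lets the inverse be treated as
a displacement. -/
lemma contDiffAt_heightShiftInv (hγ : IsTransition α a K γ) {z : ℝ × ℝ}
    (hz : z ∈ Ioo (-a) a ×ˢ (univ : Set ℝ)) :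
    ContDiffAt ℝ 1 (fun z : ℝ × ℝ => (z.1, heightShiftInv γ z.1 z.2)) z := by
  set t := heightShiftInv γ z.1 z.2
  let F : ℝ × ℝ → ℝ × ℝ := fun y => (y.1, heightShift γ y.1 y.2)
  have hFz : F (z.1, t) = z := Prod.ext rfl (hγ.heightShift_heightShiftInv _ _)
  have hF : ContDiff ℝ 1 F := contDiff_fst.prodMk
    (contDiff_snd.add (contDiff_fst.mul (hγ.contDiff.comp contDiff_snd)))
  have hFd : HasFDerivAt F (fderiv ℝ F (z.1, t)) (z.1, t) :=
    (hF.differentiable one_ne_zero _).hasFDerivAt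
  have hγd : HasDerivAt γ (deriv γ t) t :=
    (hγ.contDiff.differentiable one_ne_zero t).hasDerivAt
  have hγ' : HasFDerivAt (fun y : ℝ × ℝ => γ y.2)
      (deriv γ t • ContinuousLinearMap.snd ℝ ℝ ℝ) (z.1, t) :=
    HasDerivAt.comp_hasFDerivAt (z.1, t) hγd hasFDerivAt_snd
  have hF' : HasFDerivAt F ((ContinuousLinearMap.fst ℝ ℝ ℝ).prod
      (ContinuousLinearMap.snd ℝ ℝ ℝ + (z.1 • deriv γ t • ContinuousLinearMap.snd ℝ ℝ ℝ +
        γ t • ContinuousLinearMap.fst ℝ ℝ ℝ))) (z.1, t) :=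
    hasFDerivAt_fst.prodMk (hasFDerivAt_snd.add (hasFDerivAt_fst.mul hγ'))
  have hpos : 0 < 1 + z.1 * deriv γ t := by
    have h1 : |z.1 * deriv γ t| ≤ a * K := by
      rw [abs_mul]
      exact mul_le_mul (abs_lt.2 hz.1).le (hγ.abs_deriv_le t) (abs_nonneg _) hγ.pos.le
    linarith [(abs_le.1 h1).1, hγ.mul_lt_one]
  have hinj : Function.Injective (fderiv ℝ F (z.1, t)) := by
    rw [injective_iff_map_eq_zero]
    intro u hu
    rw [hFd.unique hF'] at hu
    have h1 : u.1 = 0 := congrArg Prod.fst hu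
    have h2 : u.2 + (z.1 * (deriv γ t * u.2) + γ t * u.1) = 0 := congrArg Prod.snd hu
    rw [h1] at h2
    have h3 : (1 + z.1 * deriv γ t) * u.2 = 0 := by linarith
    exact Prod.ext h1 ((mul_eq_zero.1 h3).resolve_left hpos.ne')
  let e : (ℝ × ℝ) ≃L[ℝ] ℝ × ℝ := (LinearEquiv.ofInjectiveEndo
    (fderiv ℝ F (z.1, t) : ℝ × ℝ →ₗ[ℝ] ℝ × ℝ) hinj).toContinuousLinearEquiv
  have he : HasFDerivAt F (e : ℝ × ℝ →L[ℝ] ℝ × ℝ) (z.1, t) := by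
    have : (e : ℝ × ℝ →L[ℝ] ℝ × ℝ) = fderiv ℝ F (z.1, t) := ContinuousLinearMap.ext fun u => rfl
    rwa [this]
  have key := ContDiffAt.of_eventually_leftInverse (g := fun z : ℝ × ℝ =>
    (z.1, heightShiftInv γ z.1 z.2)) one_ne_zero hF.contDiffAt he ?_
  · rwa [hFz] at key
  · filter_upwards [(isOpen_Ioo.prod isOpen_univ).mem_nhds
      (show (z.1, t) ∈ Ioo (-a) a ×ˢ (univ : Set ℝ) from ⟨hz.1, mem_univ _⟩)] with y hy
    exact Prod.ext rfl (hγ.heightShiftInv_heightShift hy.1 _)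

lemma isDisplacement (hγ : IsTransition α a K γ) :
    IsDisplacement α a (1 - a * K).toNNReal⁻¹ fun z => z.1 * γ z.2 where
  contDiffOn := (contDiff_fst.mul (hγ.contDiff.comp contDiff_snd)).contDiffOn
  eq_zero := fun e _ t ht => by simp [hγ.eq_zero t ht]
  antilipschitz := fun e he => AntilipschitzWith.of_le_mul_dist fun t t' => by
    have h1 := hγ.le_abs_heightShift_sub he t t'
    have h2 : 0 < 1 - a * K := by linarith [hγ.mul_lt_one]
    rw [NNReal.coe_inv, Real.coe_toNNReal _ h2.le, Real.dist_eq, Real.dist_eq, inv_mul_eq_div,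
      le_div_iff₀ h2, mul_comm]
    exact h1

/-- The constant 2 is the Lipschitz constant of the shift itself, coming from 1 + a K < 2. -/
lemma isDisplacement_inv (hγ : IsTransition α a K γ) :
    IsDisplacement α a 2 fun z => heightShiftInv γ z.1 z.2 - z.2 where
  contDiffOn := fun z hz =>
    ((contDiff_snd.contDiffAt.comp z (hγ.contDiffAt_heightShiftInv hz)).sub
      contDiff_snd.contDiffAt).contDiffWithinAt
  eq_zero := fun e he t ht => by
    have h1 := hγ.heightShiftInv_heightShift he t
    rw [hγ.heightShift_of_le e ht] at h1
    simp [h1]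
  antilipschitz := fun e he => AntilipschitzWith.of_le_mul_dist fun t t' => by
    have h1 := hγ.abs_heightShift_sub_le he (heightShiftInv γ e t) (heightShiftInv γ e t')
    rw [hγ.heightShift_heightShiftInv, hγ.heightShift_heightShiftInv] at h1
    simpa [Real.dist_eq] using h1

end IsTransition

/-! ### The differential of a displacement -/

lemma tendsto_zero_of_forall_eventually_le {X Y : ℝ≥0∞} (hX : X ≠ ⊤) (hY : Y ≠ ⊤) {f g : ℕ → ℝ≥0∞}
    (hg : Tendsto g atTop (𝓝 0))
    (h : ∀ δ : ℝ≥0, 0 < δ → ∀ᶠ n in atTop, f n ≤ δ * X + Y * g n) : Tendsto f atTop (𝓝 0) := by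
  rw [ENNReal.tendsto_nhds_zero]
  intro ε hε
  have hε2 : 0 < ε / 2 := ENNReal.half_pos hε.ne'
  have h1 : Tendsto (fun δ : ℝ≥0 => (δ : ℝ≥0∞) * X) (𝓝 0) (𝓝 0) := by
    have := ENNReal.Tendsto.mul_const (b := X) (ENNReal.tendsto_coe.2 (tendsto_id (x := 𝓝 (0 : ℝ≥0))))
      (Or.inr hX)
    simpa using this
  obtain ⟨δ, h2, h3⟩ : ∃ δ : ℝ≥0, (δ : ℝ≥0∞) * X ≤ ε / 2 ∧ 0 < δ :=
    (((ENNReal.tendsto_nhds_zero.1 h1 _ hε2).filter_mono nhdsWithin_le_nhds).and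
      self_mem_nhdsWithin).exists (f := 𝓝[>] 0)
  have h4 : Tendsto (fun n => Y * g n) atTop (𝓝 0) := by
    simpa using ENNReal.Tendsto.const_mul hg (Or.inr hY)
  filter_upwards [h δ h3, ENNReal.tendsto_nhds_zero.1 h4 _ hε2] with n h5 h6
  exact h5.trans ((add_le_add h2 h6).trans_eq (ENNReal.add_halves ε))

section Displacement

variable {Ω : Set (Euc 3)} {α a a₀ : ℝ} {L : ℝ≥0} {m : ℝ × ℝ → ℝ}

/-- The differential of `x ↦ m (h x, s x) • ν (q x)`, where `G` is the differential of `h`. -/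
noncomputable def displacementDeriv (Ω : Set (Euc 3)) (m : ℝ × ℝ → ℝ) (h : Euc 3 → ℝ)
    (G : Euc 3 → Euc 3 →L[ℝ] ℝ) (x : Euc 3) : Euc 3 →L[ℝ] Euc 3 :=
  m (h x, tubeHeight Ω x) • fderiv ℝ (fun x => outerNormal Ω (foot Ω x)) x +
    (fderiv ℝ m (h x, tubeHeight Ω x) (1, 0) • G x +
      fderiv ℝ m (h x, tubeHeight Ω x) (0, 1) • fderiv ℝ (tubeHeight Ω) x).smulRight
        (outerNormal Ω (foot Ω x))

lemma IsDisplacement.contDiffAt (hm : IsDisplacement α a L m) {e : ℝ} (he : e ∈ Ioo (-a) a)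
    (t : ℝ) : ContDiffAt ℝ 1 m (e, t) :=
  hm.contDiffOn.contDiffAt ((isOpen_Ioo.prod isOpen_univ).mem_nhds ⟨he, mem_univ _⟩)

lemma contDiffAt_displacement (hκ : 0 < tubeRadius Ω) (A : SurfaceAtlas (frontier Ω))
    (hm : IsDisplacement α a L m) {h : Euc 3 → ℝ} {x : Euc 3} (hx : x ∈ tube Ω (tubeRadius Ω))
    (hh : ContDiffAt ℝ 1 h x) (hxa : h x ∈ Ioo (-a) a) :
    ContDiffAt ℝ 1 (fun x => x + m (h x, tubeHeight Ω x) • outerNormal Ω (foot Ω x)) x ∧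
      fderiv ℝ (fun x => x + m (h x, tubeHeight Ω x) • outerNormal Ω (foot Ω x)) x =
        ContinuousLinearMap.id ℝ (Euc 3) + displacementDeriv Ω m h (fderiv ℝ h) x := by
  have hnhds := (isOpen_tube (tubeRadius Ω)).mem_nhds hx
  have hs := (contDiffOn_tubeHeight hκ A).contDiffAt hnhds
  have hN := (contDiffOn_normal hκ A).contDiffAt hnhds
  have hmx := hm.contDiffAt hxa (tubeHeight Ω x)
  have hc : ContDiffAt ℝ 1 (fun x => m (h x, tubeHeight Ω x)) x := hmx.comp x (hh.prodMk hs)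
  refine ⟨contDiffAt_id.add (hc.smul hN), HasFDerivAt.fderiv ?_⟩
  have hcd : HasFDerivAt (fun x => m (h x, tubeHeight Ω x))
      (fderiv ℝ m (h x, tubeHeight Ω x) (1, 0) • fderiv ℝ h x +
        fderiv ℝ m (h x, tubeHeight Ω x) (0, 1) • fderiv ℝ (tubeHeight Ω) x) x := by
    have h1 := (hmx.differentiableAt one_ne_zero).hasFDerivAt.comp x
      ((hh.differentiableAt one_ne_zero).hasFDerivAt.prodMk
        (hs.differentiableAt one_ne_zero).hasFDerivAt)
    refine h1.congr_fderiv ?_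
    ext1 u
    have h2 : (fderiv ℝ h x u, fderiv ℝ (tubeHeight Ω) x u) =
        fderiv ℝ h x u • ((1 : ℝ), (0 : ℝ)) + fderiv ℝ (tubeHeight Ω) x u • ((0 : ℝ), (1 : ℝ)) := by
      simp
    rw [ContinuousLinearMap.comp_apply, ContinuousLinearMap.prod_apply, h2, map_add, map_smul,
      map_smul]
    simp only [add_apply, smul_apply, smul_eq_mul]
    ring
  exact (hasFDerivAt_id x).add (hcd.smul (hN.differentiableAt one_ne_zero).hasFDerivAt)

/-- Uniform control of a continuous function along uniformly convergent arguments. -/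
lemma eventually_norm_sub_le_of_uniform {X E : Type*} [NormedAddCommGroup E] {Q : Set (ℝ × ℝ)}
    (hQ : IsCompact Q) {φ : ℝ × ℝ → E} (hφ : ContinuousOn φ Q) {S : Set X} {hn : ℕ → X → ℝ}
    {h s : X → ℝ} (hunif : TendstoUniformlyOn hn h atTop S) (hhn : ∀ n, ∀ x ∈ S, (hn n x, s x) ∈ Q)
    (hh : ∀ x ∈ S, (h x, s x) ∈ Q) {ε : ℝ} (hε : 0 < ε) :
    ∀ᶠ n in atTop, ∀ x ∈ S, ‖φ (hn n x, s x) - φ (h x, s x)‖ ≤ ε := by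
  obtain ⟨δ, hδ, hδφ⟩ := Metric.uniformContinuousOn_iff.1 (hQ.uniformContinuousOn_of_continuous hφ)
    ε hε
  filter_upwards [Metric.tendstoUniformlyOn_iff.1 hunif δ hδ] with n hn' x hx
  rw [← dist_eq_norm]
  refine (hδφ _ (hhn n x hx) _ (hh x hx) ?_).le
  rw [Prod.dist_eq, dist_self, max_eq_left dist_nonneg, dist_comm]
  exact hn' x hx

/-- Bounds for `displacementDeriv` on the collar. -/
lemma exists_displacementDeriv_bounds (hΩ : IsC4Domain Ω) (hκ : 0 < tubeRadius Ω)
    (A : SurfaceAtlas (frontier Ω)) (hα : α < tubeRadius Ω) (hm : IsDisplacement α a L m)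
    {a₁ : ℝ} (ha₁ : a₁ < a) :
    ∃ B : ℝ≥0, (∀ (h : Euc 3 → ℝ) (G : Euc 3 → Euc 3 →L[ℝ] ℝ), ∀ x ∈ collar Ω α,
        h x ∈ Icc (-a₁) a₁ → ‖displacementDeriv Ω m h G x‖ ≤ B + B * ‖G x‖) ∧
      ∀ (hn : ℕ → Euc 3 → ℝ) (h : Euc 3 → ℝ), TendstoUniformlyOn hn h atTop (collar Ω α) →
        (∀ n, ∀ x ∈ collar Ω α, hn n x ∈ Icc (-a₁) a₁) →
        (∀ x ∈ collar Ω α, h x ∈ Icc (-a₁) a₁) → ∀ δ : ℝ≥0, 0 < δ → ∀ᶠ n in atTop,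
          ∀ (Gn G : Euc 3 → Euc 3 →L[ℝ] ℝ), ∀ x ∈ collar Ω α,
            ‖displacementDeriv Ω m (hn n) Gn x - displacementDeriv Ω m h G x‖ ≤
              δ * (B + B * ‖G x‖) + B * ‖Gn x - G x‖ := by
  set Q : Set (ℝ × ℝ) := Icc (-a₁) a₁ ×ˢ Icc (-α) α
  have hQ : IsCompact Q := isCompact_Icc.prod isCompact_Icc
  have hQm : Q ⊆ Ioo (-a) a ×ˢ univ := fun z hz =>
    ⟨⟨(neg_lt_neg ha₁).trans_le hz.1.1, hz.1.2.trans_lt ha₁⟩, mem_univ _⟩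
  have hmc : ContinuousOn m Q := hm.contDiffOn.continuousOn.mono hQm
  have hdmc : ContinuousOn (fderiv ℝ m) Q :=
    (hm.contDiffOn.continuousOn_fderiv_of_isOpen (isOpen_Ioo.prod isOpen_univ) le_rfl).mono hQm
  have hec : ContinuousOn (fun z => fderiv ℝ m z (1, 0)) Q := hdmc.clm_apply continuousOn_const
  have htc : ContinuousOn (fun z => fderiv ℝ m z (0, 1)) Q := hdmc.clm_apply continuousOn_const
  have hS : collar Ω α ⊆ tube Ω (tubeRadius Ω) := fun x hx => hx.1
  have hcoll := isCompact_collar hΩ hκ A hα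
  obtain ⟨b₁, hb₁⟩ := hQ.exists_bound_of_continuousOn hmc
  obtain ⟨b₂, hb₂⟩ := hQ.exists_bound_of_continuousOn hec
  obtain ⟨b₃, hb₃⟩ := hQ.exists_bound_of_continuousOn htc
  obtain ⟨b₄, hb₄⟩ := hcoll.exists_bound_of_continuousOn
    ((contDiffOn_normal hκ A).continuousOn.mono hS)
  obtain ⟨b₅, hb₅⟩ := hcoll.exists_bound_of_continuousOn
    (((contDiffOn_normal hκ A).continuousOn_fderiv_of_isOpen (isOpen_tube _) le_rfl).mono hS)
  obtain ⟨b₆, hb₆⟩ := hcoll.exists_bound_of_continuousOn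
    (((contDiffOn_tubeHeight hκ A).continuousOn_fderiv_of_isOpen (isOpen_tube _) le_rfl).mono hS)
  -- a common bound
  obtain ⟨b, hb1, hb⟩ : ∃ b : ℝ, 1 ≤ b ∧ ∀ c ∈ ({b₁, b₂, b₃, b₄, b₅, b₆} : Set ℝ), c ≤ b := by
    obtain ⟨b, hb⟩ := ((Set.toFinite ({b₁, b₂, b₃, b₄, b₅, b₆} : Set ℝ)).insert 1).bddAbove
    exact ⟨b, hb (mem_insert _ _), fun c hc => hb (mem_insert_of_mem _ hc)⟩
  have hb0 : 0 ≤ b := zero_le_one.trans hb1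
  simp only [mem_insert_iff, mem_singleton_iff, forall_eq_or_imp, forall_eq] at hb
  obtain ⟨g1, g2, g3, g4, g5, g6⟩ := hb
  have hpow : b ^ 2 ≤ b ^ 3 ∧ b ≤ b ^ 2 := ⟨pow_le_pow_right₀ hb1 (by norm_num), by nlinarith⟩
  have hmem : ∀ {h : Euc 3 → ℝ} {x : Euc 3}, x ∈ collar Ω α → h x ∈ Icc (-a₁) a₁ →
      (h x, tubeHeight Ω x) ∈ Q := fun hx hh => ⟨hh, abs_le.1 hx.2⟩
  -- Every term is a product of at most three factors bounded by b, besides `G x`; since b ≥ 1, the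
  -- powers b, b² and b³ are all absorbed in 2b³.
  refine ⟨(2 * b ^ 3).toNNReal, fun h G x hx hh => ?_, fun hn h hunif hhn hh δ hδ => ?_⟩
  · rw [Real.coe_toNNReal _ (by positivity)]
    have e1 := (hb₁ _ (hmem hx hh)).trans g1
    have e2 := (hb₂ _ (hmem hx hh)).trans g2
    have e3 := (hb₃ _ (hmem hx hh)).trans g3
    calc ‖displacementDeriv Ω m h G x‖ ≤ b * b + (b * ‖G x‖ + b * b) * b := by
          rw [displacementDeriv]
          refine (norm_add_le _ _).trans (add_le_add ?_ ?_)
          · rw [norm_smul]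
            exact mul_le_mul e1 ((hb₅ x hx).trans g5) (norm_nonneg _) hb0
          · rw [ContinuousLinearMap.norm_smulRight_apply]
            refine mul_le_mul ((norm_add_le _ _).trans (add_le_add ?_ ?_))
              ((hb₄ x hx).trans g4) (norm_nonneg _) (by positivity)
            · rw [norm_smul]
              gcongr
            · rw [norm_smul]
              exact mul_le_mul e3 ((hb₆ x hx).trans g6) (norm_nonneg _) hb0
      _ ≤ 2 * b ^ 3 + 2 * b ^ 3 * ‖G x‖ := by
          have : b ^ 2 * ‖G x‖ ≤ 2 * b ^ 3 * ‖G x‖ := by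
            gcongr; linarith [pow_nonneg hb0 3]
          nlinarith
  · have hδ' : (0 : ℝ) < δ := hδ
    have hu : ∀ {φ : ℝ × ℝ → ℝ}, ContinuousOn φ Q → ∀ᶠ n in atTop, ∀ x ∈ collar Ω α,
        ‖φ (hn n x, tubeHeight Ω x) - φ (h x, tubeHeight Ω x)‖ ≤ δ := fun hφ =>
      eventually_norm_sub_le_of_uniform hQ hφ hunif (fun n x hx => hmem hx (hhn n x hx))
        (fun x hx => hmem hx (hh x hx)) hδ'
    filter_upwards [hu hmc, hu hec, hu htc] with n u1 u2 u3 Gn G x hx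
    rw [Real.coe_toNNReal _ (by positivity)]
    have e2 := (hb₂ _ (hmem hx (hhn n x hx))).trans g2
    specialize u1 x hx
    specialize u2 x hx
    specialize u3 x hx
    -- The difference is arranged so that the coefficient of Gₙ - G is merely bounded, while the
    -- unbounded G is multiplied by a uniformly small coefficient.
    have hsplit : displacementDeriv Ω m (hn n) Gn x - displacementDeriv Ω m h G x =
        (m (hn n x, tubeHeight Ω x) - m (h x, tubeHeight Ω x)) •
          fderiv ℝ (fun x => outerNormal Ω (foot Ω x)) x +
        (fderiv ℝ m (hn n x, tubeHeight Ω x) (1, 0) • (Gn x - G x) +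
          ((fderiv ℝ m (hn n x, tubeHeight Ω x) (1, 0) -
            fderiv ℝ m (h x, tubeHeight Ω x) (1, 0)) • G x +
          (fderiv ℝ m (hn n x, tubeHeight Ω x) (0, 1) -
            fderiv ℝ m (h x, tubeHeight Ω x) (0, 1)) • fderiv ℝ (tubeHeight Ω) x)).smulRight
          (outerNormal Ω (foot Ω x)) := by
      ext1 u
      simp only [displacementDeriv, sub_apply, add_apply,
        smul_apply, ContinuousLinearMap.smulRight_apply, smul_eq_mul]
      module
    rw [hsplit]
    calc _ ≤ δ * b + (b * ‖Gn x - G x‖ + (δ * ‖G x‖ + δ * b)) * b := by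
          refine (norm_add_le _ _).trans (add_le_add ?_ ?_)
          · rw [norm_smul]
            exact mul_le_mul u1 ((hb₅ x hx).trans g5) (norm_nonneg _) hδ'.le
          · rw [ContinuousLinearMap.norm_smulRight_apply]
            refine mul_le_mul ((norm_add_le _ _).trans (add_le_add ?_
              ((norm_add_le _ _).trans (add_le_add ?_ ?_))))
              ((hb₄ x hx).trans g4) (norm_nonneg _) (by positivity)
            · rw [norm_smul]
              gcongr
            · rw [norm_smul]
              gcongr
            · rw [norm_smul]
              exact mul_le_mul u3 ((hb₆ x hx).trans g6) (norm_nonneg _) hδ'.le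
      _ = δ * ((b + b ^ 2) + b * ‖G x‖) + b ^ 2 * ‖Gn x - G x‖ := by ring
      _ ≤ δ * (2 * b ^ 3 + 2 * b ^ 3 * ‖G x‖) + 2 * b ^ 3 * ‖Gn x - G x‖ := by
          have := pow_nonneg hb0 3
          gcongr <;> linarith

lemma aestronglyMeasurable_displacementDeriv (hΩ : IsC4Domain Ω) (hκ : 0 < tubeRadius Ω)
    (A : SurfaceAtlas (frontier Ω)) (hα : α < tubeRadius Ω) (hm : IsDisplacement α a L m)
    {h : Euc 3 → ℝ} (hh : ContinuousOn h (collar Ω α)) (hha : ∀ x ∈ collar Ω α, h x ∈ Ioo (-a) a)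
    {G : Euc 3 → Euc 3 →L[ℝ] ℝ} (hG : AEStronglyMeasurable G (volume.restrict (collar Ω α))) :
    AEStronglyMeasurable (displacementDeriv Ω m h G) (volume.restrict (collar Ω α)) := by
  have hS : collar Ω α ⊆ tube Ω (tubeRadius Ω) := fun x hx => hx.1
  have hcoll := isCompact_collar hΩ hκ A hα
  have hmeas : ∀ {E : Type} [NormedAddCommGroup E] {f : Euc 3 → E}, ContinuousOn f (collar Ω α) →
      AEStronglyMeasurable f (volume.restrict (collar Ω α)) := fun hf =>
    hf.aestronglyMeasurable_of_isCompact hcoll hcoll.measurableSet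
  have hs := (contDiffOn_tubeHeight hκ A).continuousOn.mono hS
  have hz : ContinuousOn (fun x => (h x, tubeHeight Ω x)) (collar Ω α) := hh.prodMk hs
  have hzm : MapsTo (fun x => (h x, tubeHeight Ω x)) (collar Ω α) (Ioo (-a) a ×ˢ univ) :=
    fun x hx => ⟨hha x hx, mem_univ _⟩
  have hdm : ContinuousOn (fun x => fderiv ℝ m (h x, tubeHeight Ω x)) (collar Ω α) :=
    (hm.contDiffOn.continuousOn_fderiv_of_isOpen (isOpen_Ioo.prod isOpen_univ) le_rfl).comp hz hzm
  have hmh : ContinuousOn (fun x => m (h x, tubeHeight Ω x)) (collar Ω α) :=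
    hm.contDiffOn.continuousOn.comp hz hzm
  have hN := (contDiffOn_normal hκ A).continuousOn.mono hS
  have hdN := ((contDiffOn_normal hκ A).continuousOn_fderiv_of_isOpen (isOpen_tube _)
    le_rfl).mono hS
  have hds := ((contDiffOn_tubeHeight hκ A).continuousOn_fderiv_of_isOpen (isOpen_tube _)
    le_rfl).mono hS
  have hme : ContinuousOn (fun x => fderiv ℝ m (h x, tubeHeight Ω x) (1, 0)) (collar Ω α) :=
    hdm.clm_apply continuousOn_const
  have hmt : ContinuousOn (fun x => fderiv ℝ m (h x, tubeHeight Ω x) (0, 1)) (collar Ω α) :=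
    hdm.clm_apply continuousOn_const
  have h1 : AEStronglyMeasurable (fun x => fderiv ℝ m (h x, tubeHeight Ω x) (1, 0) • G x +
      fderiv ℝ m (h x, tubeHeight Ω x) (0, 1) • fderiv ℝ (tubeHeight Ω) x)
      (volume.restrict (collar Ω α)) :=
    ((hmeas hme).smul hG).add (hmeas (hmt.smul hds))
  have h2 := (isBoundedBilinearMap_smulRight (𝕜 := ℝ) (E := Euc 3)
    (F := Euc 3)).continuous.comp_aestronglyMeasurable (h1.prodMk (hmeas hN))
  exact (hmeas (hmh.smul hdN)).add h2

/-- Maps displacing along the normal lines, for a boundary function of class `H²`, have a weak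
differential in every `L^q`. -/
theorem exists_hasApproxDeriv (hΩ : IsC4Domain Ω) (hκ : 0 < tubeRadius Ω)
    (A : SurfaceAtlas (frontier Ω)) (hα : α < tubeRadius Ω) (hm : IsDisplacement α a L m)
    (ha : a₀ < a) {q : ℝ≥0} (hq : 2 ≤ q) (M : ℝ≥0) {c₀ : ℝ≥0} (hc₀ : 1 ≤ c₀) :
    ∃ c₂ : ℝ≥0, ∀ (η : Euc 3 → ℝ) (U V : Set (Euc 3)) (Φ : Euc 3 → Euc 3),
      ContinuousOn η (frontier Ω) → (∀ q ∈ frontier Ω, |η q| ≤ a₀) → h2Norm A η ≤ M →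
      IsTubeMap Ω α m η U V Φ → volume V ≤ c₀ →
      ∃ D : Euc 3 → Euc 3 →L[ℝ] Euc 3, HasApproxDeriv V Φ D ∧
        AEStronglyMeasurable D (volume.restrict V) ∧ eLpNorm D q (volume.restrict V) ≤ c₂ := by
  have hq1 : 1 ≤ q := one_le_two.trans hq
  obtain ⟨C, hC⟩ := exists_height_approx hΩ hκ A hα hq
  obtain ⟨B, hB, hBn⟩ := exists_displacementDeriv_bounds hΩ hκ A hα hm
    (a₁ := (a₀ + a) / 2) (by linarith)
  -- As |η| ≤ a₀, approximations within (a - a₀)/2 of η stay in [-a₁, a₁], a compact part of (-a,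
  -- a), where m is C¹.
  set a₁ := (a₀ + a) / 2 with ha₁
  refine ⟨c₀ * (1 + B) + B * (C * (M + 1)), fun η U V Φ hη hηa hηM hΦ hV => ?_⟩
  obtain ⟨hn, G, hn1, hnu, hGm, hGq, hGlim⟩ := hC M η hη hηM
  set S := tube Ω (tubeRadius Ω) with hS
  set Z := collar Ω α with hZ
  set h : Euc 3 → ℝ := fun x => η (foot Ω x) with hh
  have hZS : Z ⊆ S := fun x hx => hx.1
  have hZc : IsCompact Z := isCompact_collar hΩ hκ A hα
  have hVm := hΦ.isOpen_source.measurableSet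
  have hha : ∀ x ∈ S, |h x| ≤ a₀ := fun x hx => hηa _ (tubeInv_mem hκ hx).1
  have hηI : ∀ q ∈ frontier Ω, η q ∈ Ioo (-a) a := fun q hq => abs_lt.1 ((hηa q hq).trans_lt ha)
  have hhI : ∀ x ∈ S, h x ∈ Icc (-a₁) a₁ := fun x hx =>
    abs_le.1 ((hha x hx).trans (by linarith))
  have hIcc : Icc (-a₁) a₁ ⊆ Ioo (-a) a := fun e he => ⟨by linarith [he.1], by linarith [he.2]⟩
  -- drop the first terms of the approximating sequence
  obtain ⟨N, hN⟩ := eventually_atTop.1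
    (Metric.tendstoUniformlyOn_iff.1 hnu ((a - a₀) / 2) (by linarith))
  have hnI : ∀ n, ∀ x ∈ S, hn (n + N) x ∈ Icc (-a₁) a₁ := by
    intro n x hx
    have h1 := hN (n + N) (by omega) x hx
    rw [Real.dist_eq] at h1
    have h2 := abs_lt.1 h1
    have h3 := abs_le.1 (hha x hx)
    simp only [h] at h3
    exact ⟨by linarith, by linarith⟩
  have hnu' : TendstoUniformlyOn (fun n => hn (n + N)) h atTop S := fun u hu =>
    (tendsto_add_atTop_nat N).eventually (hnu u hu)
  classical
  let Φn : ℕ → Euc 3 → Euc 3 := fun n x =>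
    if x ∈ S then x + m (hn (n + N) x, tubeHeight Ω x) • outerNormal Ω (foot Ω x) else x
  let E : Euc 3 → Euc 3 →L[ℝ] Euc 3 := displacementDeriv Ω m h G
  let En : ℕ → Euc 3 → Euc 3 →L[ℝ] Euc 3 := fun n =>
    displacementDeriv Ω m (hn (n + N)) (fderiv ℝ (hn (n + N)))
  let D : Euc 3 → Euc 3 →L[ℝ] Euc 3 := fun x =>
    ContinuousLinearMap.id ℝ (Euc 3) + Z.indicator E x
  -- Off the collar, tube points of V have height at most -α, where m vanishes for every parameter
  -- in (-a, a). So Φₙ is locally the identity there, even across the edge of the tube.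
  have hloc : ∀ n, ∀ x ∈ V, ContDiffAt ℝ 1 (Φn n) x ∧
      fderiv ℝ (Φn n) x = ContinuousLinearMap.id ℝ (Euc 3) + Z.indicator (En n) x := by
    intro n x hxV
    by_cases hxZ : x ∈ Z
    · have hxS := hZS hxZ
      have h1 := contDiffAt_displacement hκ A hm hxS
        ((hn1 (n + N)).contDiffAt ((isOpen_tube _).mem_nhds hxS)) (hIcc (hnI n x hxS))
      have h2 : Φn n =ᶠ[𝓝 x]
          fun x => x + m (hn (n + N) x, tubeHeight Ω x) • outerNormal Ω (foot Ω x) := by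
        filter_upwards [(isOpen_tube _).mem_nhds hxS] with y hy
        exact if_pos hy
      rw [indicator_of_mem hxZ, h2.fderiv_eq]
      exact ⟨h1.1.congr_of_eventuallyEq h2, h1.2⟩
    · have h2 : Φn n =ᶠ[𝓝 x] id := by
        filter_upwards [hΦ.isOpen_source.mem_nhds hxV, hZc.isClosed.isOpen_compl.mem_nhds hxZ]
          with y hyV hyZ
        by_cases hyS : y ∈ S
        · have h3 : tubeHeight Ω y ≤ -α := by
            by_contra hcon
            push Not at hcon
            exact hyZ ⟨hyS, abs_le.2 ⟨hcon.le, hΦ.height_le y hyV hyS⟩⟩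
          simp only [Φn, if_pos hyS, hm.eq_zero _ (hIcc (hnI n y hyS)) _ h3, zero_smul, add_zero,
            id]
        · exact if_neg hyS
      rw [indicator_of_notMem hxZ, h2.fderiv_eq, fderiv_id, add_zero]
      exact ⟨contDiffAt_id.congr_of_eventuallyEq h2, rfl⟩
  have hhc : ContinuousOn h Z :=
    (hη.comp (contDiffOn_foot hκ A).continuousOn fun x hx => (tubeInv_mem hκ hx).1).mono hZS
  have hEm : AEStronglyMeasurable E (volume.restrict Z) :=
    aestronglyMeasurable_displacementDeriv hΩ hκ A hα hm hhc
      (fun x hx => hIcc (hhI x (hZS hx))) hGm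
  have hDm : AEStronglyMeasurable D (volume.restrict V) :=
    aestronglyMeasurable_const.add
      (((aestronglyMeasurable_indicator_iff hZc.measurableSet).2 hEm).mono_measure
        Measure.restrict_le_self)
  have hGind : ∀ {f : Euc 3 → ℝ} (s : ℝ≥0∞), eLpNorm (Z.indicator f) s (volume.restrict V) ≤
      eLpNorm f s (volume.restrict Z) := by
    intro f s
    rw [eLpNorm_indicator_eq_eLpNorm_restrict hZc.measurableSet]
    exact eLpNorm_mono_measure _ (Measure.restrict_mono_measure Measure.restrict_le_self _)
  have hDq : eLpNorm D q (volume.restrict V) ≤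
      (c₀ * (1 + B) + B * (C * (M + 1)) : ℝ≥0) := by
    have h1 : ∀ x, ‖D x‖ ≤ ‖(1 + B : ℝ) + Z.indicator (fun x => B * ‖G x‖) x‖ := by
      intro x
      have h2 : 0 ≤ Z.indicator (fun x => B * ‖G x‖) x :=
        indicator_nonneg (fun x _ => by positivity) _
      rw [Real.norm_of_nonneg (by positivity)]
      refine (norm_add_le _ _).trans ?_
      rw [add_assoc]
      refine add_le_add ContinuousLinearMap.norm_id_le ?_
      by_cases hxZ : x ∈ Z
      · rw [indicator_of_mem hxZ, indicator_of_mem hxZ]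
        exact hB h G x hxZ (hhI x (hZS hxZ))
      · rw [indicator_of_notMem hxZ, indicator_of_notMem hxZ]
        simp
    have hGm' : AEStronglyMeasurable (Z.indicator fun x => B * ‖G x‖) (volume.restrict V) :=
      ((aestronglyMeasurable_indicator_iff hZc.measurableSet).2
        (hGm.norm.const_mul _)).mono_measure Measure.restrict_le_self
    calc eLpNorm D q (volume.restrict V)
        ≤ eLpNorm (fun x => (1 + B : ℝ) + Z.indicator (fun x => B * ‖G x‖) x) q
          (volume.restrict V) := eLpNorm_mono h1
      _ ≤ eLpNorm (fun _ => (1 + B : ℝ)) q (volume.restrict V) +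
          eLpNorm (Z.indicator fun x => B * ‖G x‖) q (volume.restrict V) :=
        eLpNorm_add_le aestronglyMeasurable_const hGm' (by exact_mod_cast hq1)
      _ ≤ c₀ * (1 + B) + B * (C * (M + 1)) := by
        refine add_le_add ?_ ((hGind _).trans ?_)
        · refine (eLpNorm_le_mul_of_exponent_le hc₀ (by simpa using hV)
            (by exact_mod_cast hq1) le_top aestronglyMeasurable_const).trans ?_
          gcongr
          refine (eLpNorm_le_of_ae_bound (C := 1 + B)
            (Eventually.of_forall fun x => ?_)).trans ?_
          · rw [Real.norm_of_nonneg (by positivity)]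
          · simp [ENNReal.ofReal_add]
        · refine (eLpNorm_le_nnreal_smul_eLpNorm_of_ae_le_mul (c := B) (g := G)
            (Eventually.of_forall fun x => ?_) q).trans ?_
          · rw [← NNReal.coe_le_coe]
            simp
          · rw [ENNReal.smul_def, smul_eq_mul]
            gcongr
      _ = _ := by push_cast; rfl
  have hVfin : IsFiniteMeasure (volume.restrict V) :=
    ⟨by simpa using hV.trans_lt ENNReal.coe_lt_top⟩
  have hZfin : IsFiniteMeasure (volume.restrict Z) := ⟨by simpa using hZc.measure_lt_top⟩
  refine ⟨D, ⟨hΦ.continuousOn hΩ hκ A hα hm hη hηI, ?_, Φn,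
    fun n x hx => (hloc n x hx).1.contDiffWithinAt, fun x hx => ?_, ?_⟩, hDm, hDq⟩
  · exact MemLp.integrable (q := q) (by exact_mod_cast hq1)
      ⟨hDm, hDq.trans_lt ENNReal.coe_lt_top⟩
  · by_cases hxS : x ∈ S
    · rw [hΦ.eq_add hκ hx hxS]
      simp only [Φn, if_pos hxS]
      have h1 := hnu'.tendsto_at hxS
      have h2 := (hm.contDiffAt (hIcc (hhI x hxS)) (tubeHeight Ω x)).continuousAt.tendsto.comp
        (h1.prodMk_nhds tendsto_const_nhds)
      exact tendsto_const_nhds.add (h2.smul_const _)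
    · rw [hΦ.eq_off_tube x hx hxS]
      simp only [Φn, if_neg hxS]
      exact tendsto_const_nhds
  · have hdG : ∀ n, AEStronglyMeasurable (fun x => fderiv ℝ (hn (n + N)) x - G x)
        (volume.restrict Z) := fun n =>
      ((((hn1 (n + N)).continuousOn_fderiv_of_isOpen (isOpen_tube _) le_rfl).mono
        hZS).aestronglyMeasurable_of_isCompact hZc hZc.measurableSet).sub hGm
    set c : ℝ≥0 := max 1 (volume Z).toNNReal
    have hZv : (volume.restrict Z) univ ≤ c := by
      rw [Measure.restrict_apply_univ, ← ENNReal.coe_toNNReal hZc.measure_lt_top.ne]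
      exact_mod_cast le_max_right _ _
    have hXfin : eLpNorm (fun x => (B : ℝ) + B * ‖G x‖) 1 (volume.restrict Z) ≠ ⊤ := by
      have h1 : MemLp G q (volume.restrict Z) := ⟨hGm, hGq.trans_lt (by
        exact ENNReal.mul_lt_top ENNReal.coe_lt_top (by simp))⟩
      exact ((memLp_const (B : ℝ)).add
        ((h1.mono_exponent (by exact_mod_cast hq1 : (1 : ℝ≥0∞) ≤ q)).norm.const_mul
          (B : ℝ))).2.ne
    -- The error is at most δ times the finite L¹ norm of B + B|G|, plus a multiple of the L²
    -- distance of the gradients; the collar has finite volume, so L² controls L¹.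
    refine tendsto_zero_of_forall_eventually_le hXfin (Y := B * c)
      (ENNReal.mul_ne_top ENNReal.coe_ne_top ENNReal.coe_ne_top)
      (g := fun n => eLpNorm (fun x => fderiv ℝ (hn (n + N)) x - G x) 2 (volume.restrict Z))
      (hGlim.comp (tendsto_add_atTop_nat N)) fun δ hδ => ?_
    filter_upwards [hBn (fun n => hn (n + N)) h (hnu'.mono hZS) (fun n x hx => hnI n x (hZS hx))
      (fun x hx => hhI x (hZS hx)) δ hδ] with n hn'
    have hbd : ∀ x ∈ V, ‖fderiv ℝ (Φn n) x - D x‖ ≤ ‖Z.indicator (fun x => δ * (B + B * ‖G x‖) +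
        B * ‖fderiv ℝ (hn (n + N)) x - G x‖) x‖ := by
      intro x hx
      rw [(hloc n x hx).2, add_sub_add_left_eq_sub]
      by_cases hxZ : x ∈ Z
      · rw [indicator_of_mem hxZ, indicator_of_mem hxZ, indicator_of_mem hxZ]
        exact (hn' _ G x hxZ).trans (Real.le_norm_self _)
      · rw [indicator_of_notMem hxZ, indicator_of_notMem hxZ, sub_zero]
        simp
    calc _ ≤ eLpNorm (Z.indicator fun x => δ * (B + B * ‖G x‖) +
          B * ‖fderiv ℝ (hn (n + N)) x - G x‖) 1 (volume.restrict V) :=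
          eLpNorm_mono_ae ((ae_restrict_mem hVm).mono hbd)
      _ ≤ eLpNorm (fun x => δ * (B + B * ‖G x‖) + B * ‖fderiv ℝ (hn (n + N)) x - G x‖) 1
          (volume.restrict Z) := hGind _
      _ ≤ eLpNorm (fun x => δ * (B + B * ‖G x‖)) 1 (volume.restrict Z) +
          eLpNorm (fun x => B * ‖fderiv ℝ (hn (n + N)) x - G x‖) 1 (volume.restrict Z) :=
          eLpNorm_add_le ((aestronglyMeasurable_const.add (hGm.norm.const_mul _)).const_mul _)
            ((hdG n).norm.const_mul _) le_rfl
      _ ≤ _ := by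
          refine add_le_add ?_ ?_
          · refine (eLpNorm_le_nnreal_smul_eLpNorm_of_ae_le_mul (c := δ)
              (g := fun x => (B : ℝ) + B * ‖G x‖)
              (Eventually.of_forall fun x => ?_) 1).trans_eq ?_
            · rw [nnnorm_mul, NNReal.nnnorm_eq]
            · rw [ENNReal.smul_def, smul_eq_mul]
          · refine (eLpNorm_le_nnreal_smul_eLpNorm_of_ae_le_mul (c := B)
              (g := fun x => fderiv ℝ (hn (n + N)) x - G x)
              (Eventually.of_forall fun x => ?_) 1).trans ?_
            · rw [nnnorm_mul, NNReal.nnnorm_eq, nnnorm_norm]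
            · rw [ENNReal.smul_def, smul_eq_mul, mul_assoc]
              gcongr
              exact eLpNorm_le_mul_of_exponent_le (le_max_left _ _) hZv le_rfl one_le_two (hdG n)

end Displacement

/-! ### Boundedness of the compositions -/

lemma CompBoundedLp.mono {d : ℕ} {U V : Set (Euc d)} {Φ : Euc d → Euc d} {p r : ℝ≥0∞} {C C' : ℝ≥0}
    (h : CompBoundedLp U V Φ p r C) (hC : C ≤ C') : CompBoundedLp U V Φ p r C' := fun v hv =>
  ⟨(h v hv).1, (h v hv).2.trans (by gcongr)⟩

lemma CompBoundedSobolev.mono {d : ℕ} {U V : Set (Euc d)} {Φ : Euc d → Euc d} {p r : ℝ≥0∞}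
    {C C' : ℝ≥0} (h : CompBoundedSobolev U V Φ p r C) (hC : C ≤ C') :
    CompBoundedSobolev U V Φ p r C' := fun v hv =>
  ⟨(h v hv).1, (h v hv).2.trans (by gcongr)⟩

/-- Choose a finite p₀ strictly between r and p and put 1/q = 1/r - 1/p₀. Strictness makes q finite,
as the Sobolev embedding demands; p₀ is finite so that mollification converges, even when p = ∞. -/
lemma exists_holderTriple {p r : ℝ≥0∞} (hr : 1 ≤ r) (hrp : r < p) :
    ∃ (p₀ : ℝ≥0) (q : ℝ≥0), r ≤ p₀ ∧ (p₀ : ℝ≥0∞) ≤ p ∧ ENNReal.HolderTriple p₀ q r ∧ 1 ≤ q := by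
  obtain ⟨p₀, h1, h2⟩ := ENNReal.lt_iff_exists_nnreal_btwn.1 hrp
  have h3 : (p₀ : ℝ≥0∞)⁻¹ < r⁻¹ := ENNReal.inv_lt_inv.2 h1
  have h4 : (r⁻¹ - (p₀ : ℝ≥0∞)⁻¹)⁻¹ ≠ ⊤ := ENNReal.inv_ne_top.2 (tsub_pos_of_lt h3).ne'
  have h5 : ENNReal.HolderTriple p₀ ((r⁻¹ - (p₀ : ℝ≥0∞)⁻¹)⁻¹) r :=
    ⟨by rw [inv_inv, add_tsub_cancel_of_le h3.le]⟩
  refine ⟨p₀, ((r⁻¹ - (p₀ : ℝ≥0∞)⁻¹)⁻¹).toNNReal, h1.le, h2.le, ?_, ?_⟩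
  · rwa [ENNReal.coe_toNNReal h4]
  · rw [← ENNReal.coe_le_coe, ENNReal.coe_toNNReal h4, ENNReal.coe_one, ENNReal.one_le_inv]
    exact tsub_le_self.trans (ENNReal.inv_le_one.2 hr)

section Compositions

variable {Ω : Set (Euc 3)} {α a a₀ : ℝ} {L : ℝ≥0} {m : ℝ × ℝ → ℝ}

theorem exists_compBounded (hΩ : IsC4Domain Ω) (hκ : 0 < tubeRadius Ω)
    (A : SurfaceAtlas (frontier Ω)) (hα : α < tubeRadius Ω) (hm : IsDisplacement α a L m)
    (ha : a₀ < a) {p r : ℝ≥0∞} (hr : 1 ≤ r) (hrp : r < p) (M : ℝ≥0) {c₀ : ℝ≥0} (hc₀ : 1 ≤ c₀) :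
    ∃ C : ℝ≥0, ∀ (η : Euc 3 → ℝ) (U V : Set (Euc 3)) (Φ : Euc 3 → Euc 3),
      ContinuousOn η (frontier Ω) → (∀ q ∈ frontier Ω, |η q| ≤ a₀) → h2Norm A η ≤ M →
      IsTubeMap Ω α m η U V Φ → volume U ≤ c₀ → volume V ≤ c₀ →
      CompBoundedLp U V Φ p r C ∧ CompBoundedSobolev U V Φ p r C := by
  obtain ⟨p₀, q, hrp₀, hp₀, hHolder, hq⟩ := exists_holderTriple hr hrp
  -- The planar embedding is stated for exponents at least 2, so the differential is bounded in
  -- L^max(q, 2); the finite volume of V brings this down to L^q.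
  obtain ⟨c₂, hc₂⟩ := exists_hasApproxDeriv hΩ hκ A hα hm ha (le_max_right q 2) M hc₀
  obtain ⟨c₁, hc₁, hmap⟩ := exists_map_volume_le hΩ hκ A hα a L
  refine ⟨c₀ * (c₁ * c₀) + (3 : ℕ) * (c₀ * c₂ * (c₁ * c₀)), fun η U V Φ hη hηa hηM hΦ hU hV => ?_⟩
  obtain ⟨D, hD, hDm, hDq⟩ := hc₂ η U V Φ hη hηa hηM hΦ hV
  have hmapΦ := hmap m η U V Φ hm hη (fun q hq => abs_lt.1 ((hηa q hq).trans_lt ha)) hΦ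
  have hDq' : eLpNorm D q (volume.restrict V) ≤ (c₀ * c₂ : ℝ≥0) := by
    refine (eLpNorm_le_mul_of_exponent_le hc₀ (by simpa using hV) (by exact_mod_cast hq)
      (ENNReal.coe_le_coe.2 (le_max_left q 2)) hDm).trans ?_
    rw [ENNReal.coe_mul]
    gcongr
  exact ⟨(compBoundedLp_of_map_le hΦ.isOpen_source.measurableSet hD.continuousOn hc₀ hc₁ hU hV
      hmapΦ hr hrp₀ hp₀).mono le_self_add,
    hD.compBoundedSobolev hΦ.isOpen_target hΦ.isOpen_source hΦ.mapsTo hc₀ hc₁ hU hV hmapΦ hr hrp₀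
      hp₀ hDm hDq'⟩

end Compositions

/-! ### The Hanzawa transform -/

section Hanzawa

variable {Ω : Set (Euc 3)} {α a : ℝ} {K : ℝ≥0} {γ β : ℝ → ℝ} {η : Euc 3 → ℝ}

/-- The shift is strictly increasing, fixes -κ and -α, and sends 0 to e with |e| < a ≤ α < κ. -/
lemma IsTransition.heightShift_mem (hγ : IsTransition α a K γ) {e : ℝ} (he : e ∈ Ioo (-a) a)
    {t κ : ℝ} (hα : α < κ) (ht : t ∈ Ioo (-κ) 0) :
    heightShift γ e t ∈ Ioo (-κ) κ ∧ heightShift γ e t < e ∧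
      (-α ≤ t → |heightShift γ e t| ≤ α) := by
  have hmono := hγ.strictMono_heightShift he
  have h1 : heightShift γ e t < e := by
    have := hmono ht.2
    rwa [hγ.heightShift_of_nonneg e le_rfl, zero_add] at this
  have h2 : -κ < heightShift γ e t := by
    have := hmono ht.1
    rwa [hγ.heightShift_of_le e (by linarith)] at this
  have h3 := hγ.le
  have h4 := he.2
  refine ⟨⟨h2, by linarith⟩, h1, fun h5 => abs_le.2 ⟨?_, by linarith⟩⟩
  have := hmono.monotone h5
  rwa [hγ.heightShift_of_le e le_rfl] at this

lemma IsTransition.heightShiftInv_mem (hγ : IsTransition α a K γ) {e : ℝ} (he : e ∈ Ioo (-a) a)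
    {s κ : ℝ} (hα : α < κ) (hs : s ∈ Ioo (-κ) e) :
    heightShiftInv γ e s ∈ Ioo (-κ) 0 ∧ (-α ≤ s → |heightShiftInv γ e s| ≤ α) := by
  have hmono := hγ.strictMono_heightShift he
  have hs' := hγ.heightShift_heightShiftInv e s
  have h1 : heightShiftInv γ e s < 0 := by
    rw [← hmono.lt_iff_lt, hs', hγ.heightShift_of_nonneg e le_rfl, zero_add]
    exact hs.2
  have h2 : -κ < heightShiftInv γ e s := by
    rw [← hmono.lt_iff_lt, hs', hγ.heightShift_of_le e (by linarith)]
    exact hs.1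
  refine ⟨⟨h2, h1⟩, fun h3 => abs_le.2 ⟨?_, ?_⟩⟩
  · rwa [← hmono.le_iff_le, hs', hγ.heightShift_of_le e le_rfl]
  · linarith [hγ.pos, hγ.le]

/-- The part of Ω off the tube need not be open. It may be enlarged to the part off the compact
collar, since the added points have height below -α < η and belong to the other piece anyway. -/
lemma isOpen_displacedDomain (hΩ : IsC4Domain Ω) (hκ : 0 < tubeRadius Ω)
    (A : SurfaceAtlas (frontier Ω)) (hα : α < tubeRadius Ω) (hη : ContinuousOn η (frontier Ω))
    (hηα : ∀ q ∈ frontier Ω, -α < η q) : IsOpen (displacedDomain Ω η) := by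
  have heq : displacedDomain Ω η = (Ω \ collar Ω α) ∪ (tube Ω (tubeRadius Ω) ∩
      (fun x => η (foot Ω x) - tubeHeight Ω x) ⁻¹' Ioi 0) := by
    ext x
    simp only [displacedDomain, mem_union, Set.mem_sdiff, mem_ofPred_eq, mem_inter_iff, mem_preimage,
      mem_Ioi, sub_pos]
    constructor
    · rintro (⟨h1, h2⟩ | h)
      · exact Or.inl ⟨h1, fun h => h2 h.1⟩
      · exact Or.inr h
    · rintro (⟨h1, h2⟩ | h)
      · by_cases hx : x ∈ tube Ω (tubeRadius Ω)
        · refine Or.inr ⟨hx, ?_⟩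
          have h3 := (hΩ.mem_iff_tubeHeight_neg hκ hx).1 h1
          have h4 : α < |tubeHeight Ω x| := by
            by_contra hcon
            exact h2 ⟨hx, not_lt.1 hcon⟩
          rw [abs_of_neg h3] at h4
          linarith [hηα _ (tubeInv_mem hκ hx).1]
        · exact Or.inl ⟨h1, hx⟩
      · exact Or.inr h
  rw [heq]
  refine (hΩ.isOpen.sdiff (isCompact_collar hΩ hκ A hα).isClosed).union
    (ContinuousOn.isOpen_inter_preimage ?_ (isOpen_tube _) isOpen_Ioi)
  exact (hη.comp (contDiffOn_foot hκ A).continuousOn fun x hx => (tubeInv_mem hκ hx).1).sub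
    (contDiffOn_tubeHeight hκ A).continuousOn

/-- The inverse of the Hanzawa transform in tubular coordinates. -/
lemma hanzawa_tubeMap (hκ : 0 < tubeRadius Ω)
    (hγβ : ∀ t ∈ Icc (-tubeRadius Ω) 0, γ t = β (t / tubeRadius Ω)) {q : Euc 3}
    (hq : q ∈ frontier Ω) {t : ℝ} (ht : t ∈ Ioo (-tubeRadius Ω) 0) :
    hanzawa Ω β η (tubeMap Ω (q, t)) = tubeMap Ω (q, heightShift γ (η q) t) := by
  obtain ⟨h1, h2, h3⟩ := tubeInv_tubeMap hκ hq ⟨ht.1, ht.2.trans hκ⟩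
  rw [hanzawa, if_pos h1, h2, h3, ← hγβ t ⟨ht.1.le, ht.2.le⟩]
  simp only [tubeMap, heightShift]
  module

lemma tubeHeight_mem_of_mem (hΩ : IsC4Domain Ω) (hκ : 0 < tubeRadius Ω) {x : Euc 3} (hx : x ∈ Ω)
    (hxS : x ∈ tube Ω (tubeRadius Ω)) : tubeHeight Ω x ∈ Ioo (-tubeRadius Ω) 0 :=
  ⟨(tubeInv_mem hκ hxS).2.1.1, (hΩ.mem_iff_tubeHeight_neg hκ hxS).1 hx⟩

lemma mem_displacedDomain_tube {x : Euc 3} (hx : x ∈ displacedDomain Ω η)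
    (hxS : x ∈ tube Ω (tubeRadius Ω)) : tubeHeight Ω x < η (foot Ω x) :=
  hx.elim (fun h => absurd hxS h.2) fun h => h.2

lemma mem_of_mem_displacedDomain {x : Euc 3} (hx : x ∈ displacedDomain Ω η)
    (hxS : x ∉ tube Ω (tubeRadius Ω)) : x ∈ Ω :=
  hx.elim (fun h => h.1) fun h => absurd h.1 hxS

theorem isTubeMap_hanzawa (hΩ : IsC4Domain Ω) (hκ : 0 < tubeRadius Ω)
    (A : SurfaceAtlas (frontier Ω)) (hα : α < tubeRadius Ω) (hγ : IsTransition α a K γ)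
    (hγβ : ∀ t ∈ Icc (-tubeRadius Ω) 0, γ t = β (t / tubeRadius Ω))
    (hη : ContinuousOn η (frontier Ω)) (hηa : ∀ q ∈ frontier Ω, η q ∈ Ioo (-a) a) :
    IsTubeMap Ω α (fun z => z.1 * γ z.2) η (displacedDomain Ω η) Ω (hanzawa Ω β η) := by
  have hαa := hγ.le
  have heq : ∀ x ∈ Ω, x ∈ tube Ω (tubeRadius Ω) →
      hanzawa Ω β η x = tubeMap Ω (foot Ω x, heightShift γ (η (foot Ω x)) (tubeHeight Ω x)) := by
    intro x hx hxS
    conv_lhs => rw [← (tubeInv_mem hκ hxS).2.2]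
    exact hanzawa_tubeMap hκ hγβ (tubeInv_mem hκ hxS).1 (tubeHeight_mem_of_mem hΩ hκ hx hxS)
  refine ⟨isOpen_displacedDomain hΩ hκ A hα hη fun q hq => by linarith [(hηa q hq).1], hΩ.isOpen,
    fun x hx => ?_, heq, fun x _ hxS => if_neg hxS, fun x hx hxS => ?_, fun x hx hxZ => ?_⟩
  · by_cases hxS : x ∈ tube Ω (tubeRadius Ω)
    · have h1 := (tubeInv_mem hκ hxS).1
      obtain ⟨h2, h3, -⟩ := hγ.heightShift_mem (hηa _ h1) hα (tubeHeight_mem_of_mem hΩ hκ hx hxS)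
      rw [heq x hx hxS]
      obtain ⟨h4, h5, h6⟩ := tubeInv_tubeMap hκ h1 h2
      exact Or.inr ⟨h4, by rwa [h5, h6]⟩
    · rw [hanzawa, if_neg hxS]
      exact Or.inl ⟨hx, hxS⟩
  · linarith [(tubeHeight_mem_of_mem hΩ hκ hx hxS).2, hγ.pos]
  · exact (hγ.heightShift_mem (hηa _ (tubeInv_mem hκ hxZ.1).1) hα
      (tubeHeight_mem_of_mem hΩ hκ hx hxZ.1)).2.2 (abs_le.1 hxZ.2).1

/-- The preimage under the Hanzawa transform of a point of the displaced domain in the tube. -/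
lemma hanzawa_rightInv (hΩ : IsC4Domain Ω) (hκ : 0 < tubeRadius Ω) (hα : α < tubeRadius Ω)
    (hγ : IsTransition α a K γ)
    (hγβ : ∀ t ∈ Icc (-tubeRadius Ω) 0, γ t = β (t / tubeRadius Ω))
    (hηa : ∀ q ∈ frontier Ω, η q ∈ Ioo (-a) a) {y : Euc 3} (hy : y ∈ displacedDomain Ω η)
    (hyS : y ∈ tube Ω (tubeRadius Ω)) :
    tubeMap Ω (foot Ω y, heightShiftInv γ (η (foot Ω y)) (tubeHeight Ω y)) ∈ Ω ∧
      hanzawa Ω β η (tubeMap Ω (foot Ω y, heightShiftInv γ (η (foot Ω y)) (tubeHeight Ω y))) =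
        y := by
  obtain ⟨h1, h2, h3⟩ := tubeInv_mem hκ hyS
  obtain ⟨h4, -⟩ := hγ.heightShiftInv_mem (hηa _ h1) hα ⟨h2.1, mem_displacedDomain_tube hy hyS⟩
  refine ⟨(hΩ.tubeMap_mem_iff hκ h1 ⟨h4.1, h4.2.trans hκ⟩).2 h4.2, ?_⟩
  rw [hanzawa_tubeMap hκ hγβ h1 h4, hγ.heightShift_heightShiftInv, h3]

/-- On the tube the foot point is preserved and the height undergoes a strictly increasing shift
from (-κ, 0) onto (-κ, η(q)); off the tube the map is the identity. Tube points stay in the tube, so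
the two regimes do not interfere. -/
theorem bijOn_hanzawa (hΩ : IsC4Domain Ω) (hκ : 0 < tubeRadius Ω)
    (A : SurfaceAtlas (frontier Ω)) (hα : α < tubeRadius Ω) (hγ : IsTransition α a K γ)
    (hγβ : ∀ t ∈ Icc (-tubeRadius Ω) 0, γ t = β (t / tubeRadius Ω))
    (hη : ContinuousOn η (frontier Ω)) (hηa : ∀ q ∈ frontier Ω, η q ∈ Ioo (-a) a) :
    BijOn (hanzawa Ω β η) Ω (displacedDomain Ω η) := by
  have hΦ := isTubeMap_hanzawa hΩ hκ A hα hγ hγβ hη hηa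
  -- the foot point and the height of the image of a point of the tube
  have himg : ∀ x ∈ Ω, x ∈ tube Ω (tubeRadius Ω) → hanzawa Ω β η x ∈ tube Ω (tubeRadius Ω) ∧
      foot Ω (hanzawa Ω β η x) = foot Ω x ∧
      tubeHeight Ω (hanzawa Ω β η x) = heightShift γ (η (foot Ω x)) (tubeHeight Ω x) := by
    intro x hx hxS
    rw [hΦ.eq_on_tube x hx hxS]
    exact tubeInv_tubeMap hκ (tubeInv_mem hκ hxS).1 (hγ.heightShift_mem
      (hηa _ (tubeInv_mem hκ hxS).1) hα (tubeHeight_mem_of_mem hΩ hκ hx hxS)).1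
  refine ⟨hΦ.mapsTo, fun x hx x' hx' h => ?_, fun y hy => ?_⟩
  · by_cases hxS : x ∈ tube Ω (tubeRadius Ω) <;> by_cases hxS' : x' ∈ tube Ω (tubeRadius Ω)
    · obtain ⟨-, h2, h3⟩ := himg x hx hxS
      obtain ⟨-, h2', h3'⟩ := himg x' hx' hxS'
      have h4 : foot Ω x = foot Ω x' := by rw [← h2, h, h2']
      have h5 : tubeHeight Ω x = tubeHeight Ω x' := by
        refine (hγ.strictMono_heightShift (hηa _ (tubeInv_mem hκ hxS).1)).injective ?_
        rw [← h3, h, h3', h4]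
      rw [← (tubeInv_mem hκ hxS).2.2, ← (tubeInv_mem hκ hxS').2.2, h4, h5]
    · refine absurd ?_ hxS'
      rw [← hΦ.eq_off_tube x' hx' hxS', ← h]
      exact (himg x hx hxS).1
    · refine absurd ?_ hxS
      rw [← hΦ.eq_off_tube x hx hxS, h]
      exact (himg x' hx' hxS').1
    · rwa [hΦ.eq_off_tube x hx hxS, hΦ.eq_off_tube x' hx' hxS'] at h
  · by_cases hyS : y ∈ tube Ω (tubeRadius Ω)
    · obtain ⟨h1, h2⟩ := hanzawa_rightInv hΩ hκ hα hγ hγβ hηa hy hyS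
      exact ⟨_, h1, h2⟩
    · have h1 := mem_of_mem_displacedDomain hy hyS
      exact ⟨y, h1, hΦ.eq_off_tube y h1 hyS⟩

/-- With `isDisplacement_inv` this places the inverse in the same class as the transform, with the
same α and a, so that `exists_compBounded` applies to both. -/
theorem isTubeMap_hanzawaInv (hΩ : IsC4Domain Ω) (hκ : 0 < tubeRadius Ω)
    (A : SurfaceAtlas (frontier Ω)) (hα : α < tubeRadius Ω) (hγ : IsTransition α a K γ)
    (hγβ : ∀ t ∈ Icc (-tubeRadius Ω) 0, γ t = β (t / tubeRadius Ω))
    (hη : ContinuousOn η (frontier Ω)) (hηa : ∀ q ∈ frontier Ω, η q ∈ Ioo (-a) a) :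
    IsTubeMap Ω α (fun z => heightShiftInv γ z.1 z.2 - z.2) η Ω (displacedDomain Ω η)
      (hanzawaInv Ω β η) := by
  have hαa := hγ.le
  have hΦ := isTubeMap_hanzawa hΩ hκ A hα hγ hγβ hη hηa
  have hbij := bijOn_hanzawa hΩ hκ A hα hγ hγβ hη hηa
  have hinv : ∀ x ∈ Ω, hanzawaInv Ω β η (hanzawa Ω β η x) = x := fun x hx =>
    hbij.injOn.leftInvOn_invFunOn hx
  refine ⟨hΩ.isOpen, hΦ.isOpen_target, fun y hy => Function.invFunOn_mem (hbij.surjOn hy),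
    fun y hy hyS => ?_, fun y hy hyS => ?_, fun y hy hyS => ?_, fun y hy hyZ => ?_⟩
  · obtain ⟨h1, h2⟩ := hanzawa_rightInv hΩ hκ hα hγ hγβ hηa hy hyS
    have h3 := hinv _ h1
    rw [h2] at h3
    rw [h3]
    simp only [add_sub_cancel]
  · have h1 := mem_of_mem_displacedDomain hy hyS
    have h3 := hinv y h1
    rwa [hΦ.eq_off_tube y h1 hyS] at h3
  · linarith [mem_displacedDomain_tube hy hyS, (hηa _ (tubeInv_mem hκ hyS).1).2]
  · obtain ⟨h1, h2, -⟩ := tubeInv_mem hκ hyZ.1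
    simp only [add_sub_cancel]
    exact (hγ.heightShiftInv_mem (hηa _ h1) hα ⟨h2.1, mem_displacedDomain_tube hy hyZ.1⟩).2
      (abs_le.1 hyZ.2).1

end Hanzawa

/-! ### From the bound on τ(η) to the theorem -/

lemma abs_le_supNormOn {Ω : Set (Euc 3)} (hΩ : IsC4Domain Ω) {η : Euc 3 → ℝ}
    (hη : ContinuousOn η (frontier Ω)) {q : Euc 3} (hq : q ∈ frontier Ω) :
    |η q| ≤ supNormOn (frontier Ω) η := by
  have hbdd : BddAbove (range fun q : frontier Ω => |η q|) := by
    obtain ⟨C, hC⟩ := hΩ.isCompact_frontier.exists_bound_of_continuousOn hη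
    exact ⟨C, by rintro _ ⟨q, rfl⟩; exact hC q q.2⟩
  exact le_ciSup hbdd ⟨q, hq⟩

lemma supNormOn_le_of_tau_le {Ω : Set (Euc 3)} {η : Euc 3 → ℝ} (hκ : 0 < tubeRadius Ω)
    (hη : supNormOn (frontier Ω) η < tubeRadius Ω) {T : ℝ≥0} (hT : 1 ≤ T) (hτ : tau Ω η ≤ T) :
    supNormOn (frontier Ω) η ≤ (1 - (T : ℝ)⁻¹) * tubeRadius Ω := by
  have hT' : (0 : ℝ) < T := by exact_mod_cast zero_lt_one.trans_le hT
  have hpos : 0 < 1 - supNormOn (frontier Ω) η / tubeRadius Ω := by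
    rw [sub_pos, div_lt_one hκ]; exact hη
  rw [tau, if_pos hη, ← ENNReal.ofReal_coe_nnreal, ENNReal.ofReal_le_ofReal_iff hT'.le,
    inv_le_comm₀ hpos hT', le_sub_comm, div_le_iff₀ hκ] at hτ
  exact hτ

theorem mainTheorem8 (Ω : Set (Euc 3)) (hΩ : IsC4Domain Ω) (A : SurfaceAtlas (frontier Ω)) :
    (∀ T : ℝ≥0, 1 ≤ T → ∃ β : ℝ → ℝ, IsCutoff T β) ∧
    ∀ p r : ℝ≥0∞, 1 < p → 1 ≤ r → r < p →
      ∀ M T : ℝ≥0, 1 ≤ T → ∀ β : ℝ → ℝ, IsCutoff T β →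
        ∃ C : ℝ≥0, ∀ η : Euc 3 → ℝ,
          ContinuousOn η (frontier Ω) →
          h2Norm A η ≤ M →
          supNormOn (frontier Ω) η < tubeRadius Ω →
          tau Ω η ≤ T →
          BijOn (hanzawa Ω β η) Ω (displacedDomain Ω η) ∧
          CompBoundedLp (displacedDomain Ω η) Ω (hanzawa Ω β η) p r C ∧
          CompBoundedSobolev (displacedDomain Ω η) Ω (hanzawa Ω β η) p r C ∧
          CompBoundedLp Ω (displacedDomain Ω η) (hanzawaInv Ω β η) p r C ∧
          CompBoundedSobolev Ω (displacedDomain Ω η) (hanzawaInv Ω β η) p r C := by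
  refine ⟨fun T hT => exists_isCutoff hT, fun p r _ hr hrp M T hT β hβ => ?_⟩
  -- If κ were not positive, no η could satisfy ‖η‖_∞ < κ, and any constant would do.
  by_cases hκ : 0 < tubeRadius Ω
  swap
  · refine ⟨0, fun η _ _ hlt _ => absurd (lt_of_le_of_lt ?_ hlt) hκ⟩
    exact Real.iSup_nonneg fun q => abs_nonneg _
  obtain ⟨γ, α, a, K, hγ, ha, hα, hγβ⟩ := hβ.exists_transition hT hκ
  -- A bounded set containing Ω and all displaced domains, whose volume makes the constants
  -- independent of η.
  set W : Set (Euc 3) := Ω ∪ tube Ω (tubeRadius Ω)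
  have hW : volume W ≠ ⊤ :=
    (hΩ.isBounded.union hΩ.isCompact_frontier.isBounded.thickening).measure_lt_top.ne
  have hWc : ∀ {U : Set (Euc 3)}, U ⊆ W → volume U ≤ (max 1 (volume W).toNNReal : ℝ≥0) := by
    intro U hU
    refine (measure_mono hU).trans ?_
    rw [← ENNReal.coe_toNNReal hW]
    exact_mod_cast le_max_right _ _
  have hηW : ∀ η, displacedDomain Ω η ⊆ W := fun η x hx =>
    hx.elim (fun h => Or.inl h.1) fun h => Or.inr h.1
  obtain ⟨C₁, hC₁⟩ := exists_compBounded hΩ hκ A hα hγ.isDisplacement ha hr hrp M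
    (le_max_left 1 (volume W).toNNReal)
  obtain ⟨C₂, hC₂⟩ := exists_compBounded hΩ hκ A hα hγ.isDisplacement_inv ha hr hrp M
    (le_max_left 1 (volume W).toNNReal)
  refine ⟨max C₁ C₂, fun η hη hηM hηκ hτ => ?_⟩
  have hηa₀ : ∀ q ∈ frontier Ω, |η q| ≤ (1 - (T : ℝ)⁻¹) * tubeRadius Ω := fun q hq =>
    (abs_le_supNormOn hΩ hη hq).trans (supNormOn_le_of_tau_le hκ hηκ hT hτ)
  have hηa : ∀ q ∈ frontier Ω, η q ∈ Ioo (-a) a := fun q hq =>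
    abs_lt.1 ((hηa₀ q hq).trans_lt ha)
  have h₁ := hC₁ η _ _ _ hη hηa₀ hηM (isTubeMap_hanzawa hΩ hκ A hα hγ hγβ hη hηa)
    (hWc (hηW η)) (hWc subset_union_left)
  have h₂ := hC₂ η _ _ _ hη hηa₀ hηM (isTubeMap_hanzawaInv hΩ hκ A hα hγ hγβ hη hηa)
    (hWc subset_union_left) (hWc (hηW η))
  exact ⟨bijOn_hanzawa hΩ hκ A hα hγ hγβ hη hηa, h₁.1.mono (le_max_left _ _),
    h₁.2.mono (le_max_left _ _), h₂.1.mono (le_max_right _ _), h₂.2.mono (le_max_right _ _)⟩
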